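/- Let $r,q\ge 1$ be integers. There is a function $k_0:(0,\infty)\to\mathbb N$ depending only on $r$ and $q$, with $k_0(\varepsilon)=O(\varepsilon^{-4}\log(\varepsilon^{-1}))$ as $\varepsilon\to0^+$, such that the following holds. **Setting.** Let $\mathcal K$ be a compact Polish space with its Borel $\sigma$-algebra, and let $E$ be a finite set of layers. For a finite set $M$, let $s(M,r)$ be the set of non-empty subsets of $M$ with at most $r$ elements. A $(\mathcal K,r)$-graphon is a measurable map $[0,1]^{s([r],r)}\to\mathcal K$. Let $W=(W^e)_{e\in E}$ be a tuple of $(\mathcal K,r)$-graphons and let $J=(J^e_z)_{e\in E,\,z\in[q]^r}$ with $J^e_z\in C(\mathcal K)$ real-valued. Put $\|J\|_\infty=\max_{e,z}\|J^e_z\|_\infty$. Let $a=(a_1,\dots,a_q)$ with $a_i\ge0$ and $\sum_i a_i=1$. **Energy of the graphon.** Let $\Omega_a$ be the set of all $\phi=(\phi_1,\dots,\phi_q)$ with $\phi_i:[0,1]\to[0,1]$ measurable, $\sum_i\phi_i=1$ pointwise and $\int_0^1\phi_i=a_i$ for every $i$. Set $$\mathcal E_a(W,J)=\sup_{\phi\in\Omega_a}\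 \sum_{e\in E}\sum_{z\in[q]^r}\int_{[0,1]^{s([r],r)}}J^e_z(W^e(x))\prod_{j=1}^r\phi_{z_j}(x_{\{j\}})\,dx .$$ **Integer energy of a finite graph.** For a tuple $G=(G^e)_{e\in E}$ of maps $[k]^r\to\mathcal K$, let $$\hat{\mathcal E}_a(G,J)=\max_{x}\ \sum_{e\in E}\frac1{k^r}\sum_{z\in[q]^r}\sum_{n\in[k]^r}J^e_z(G^e(n))\prod_{j=1}^r x_{n_j,z_j},$$ where $x$ runs over all $x\in\{0,1\}^{[k]\times[q]}$ with $\sum_i x_{u,i}=1$ for every $u\in[k]$ and $\bigl|\frac1k\sum_u x_{u,i}-a_i\bigr|\le\frac1k$ for every $i\in[q]$. **Sampling.** Let $(U_S)_{S\in s([k],r)}$ be independent and uniform on $[0,1]$, and fix a colour $\iota\in\mathcal K$. The random tuple $\mathbb G(k,W)=(\mathbb G(k,W^e))_{e\in E}$ uses the same sample for all layers. Its entry at $n=(n_1,\dots,n_r)\in[k]^r$ in layer $e$ is $W^e\bigl((U_{\{n_j:\,j\in S\}})_{\emptyset\ne S\subseteq[r]}\bigr)$ if $n_1,\dots,n_r$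 are distinct, and $\iota$ otherwise. **Claim.** 1. For all $\mathcal K,E,J,W,a,\iota$ as above, every $\varepsilon>0$ and every $k\ge k_0(\varepsilon)$, $$\mathbb P\Bigl(\bigl|\mathcal E_a(W,J)-\hat{\mathcal E}_a(\mathbb G(k,W),J)\bigr|>\varepsilon\,|E|\,\|J\|_\infty\Bigr)<\varepsilon .$$ 2. Suppose moreover that $\mathcal K=[-d,d]$ for some $d\ge0$, that $\iota=0$, and that $J^e_z(t)=A^e_z\,t$ with real numbers $A^e_z$. Put $\|A\|_\infty=\max_{e,z}|A^e_z|$ and $\|W\|_\infty=\max_e\operatorname{ess\,sup}|W^e|$. Then for every $\varepsilon>0$ and every $k\ge k_0(\varepsilon)$, with the same function $k_0$, $$\mathbb P\Bigl(\bigl|\mathcal E_a(W,J)-\hat{\mathcal E}_a(\mathbb G(k,W),J)\bigr|>\varepsilon\,|E|\,\|A\|_\infty\,\|W\|_\infty\Bigr)<\varepsilon .$$ -/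

import Mathlib

open MeasureTheory Filter Topology Asymptotics

namespace GroundState

/-- The cube `[0,1]^{s([r],r)}`: coordinates are indexed by the non-empty subsets of `[r]`.
It carries the product Lebesgue measure `volume`. -/
abbrev Cube (r : ℕ) : Type := {S : Finset (Fin r) // S.Nonempty} → unitInterval

/-- The coordinate of a point of the cube indexed by the singleton `{j}`. -/
def Cube.vertex {r : ℕ} (x : Cube r) (j : Fin r) : unitInterval :=
  x ⟨{j}, Finset.singleton_nonempty j⟩

/-- A `(K, r)`-graphon: a measurable function `[0,1]^{s([r],r)} → K`. -/
structure Graphon (K : Type*) [MeasurableSpace K] (r : ℕ) where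
  toFun : Cube r → K
  measurable_toFun : Measurable toFun

instance {K : Type*} [MeasurableSpace K] {r : ℕ} :
    CoeFun (Graphon K r) (fun _ => Cube r → K) := ⟨Graphon.toFun⟩

/-- `E`-layered `r`-arrays of size `q × ⋯ × q` with entries in `C(K)`. Its (iterated supremum)
norm is `‖J‖ = max_{e, z} ‖J^e_z‖_∞`. -/
abbrev Interaction (E K : Type*) [TopologicalSpace K] (r q : ℕ) : Type _ :=
  E → (Fin r → Fin q) → C(K, ℝ)

/-- `q`-fractional partitions of `[0,1]`. -/
structure IsFracPartition {q : ℕ} (φ : Fin q → unitInterval → ℝ) : Prop where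
  measurable : ∀ i, Measurable (φ i)
  mem_Icc : ∀ i t, φ i t ∈ Set.Icc (0 : ℝ) 1
  sum_eq_one : ∀ t, ∑ i, φ i t = 1

/-- `Ω_a`: the fractional partitions of `[0,1]` whose classes have sizes `a`. -/
def Omega {q : ℕ} (a : Fin q → ℝ) : Set (Fin q → unitInterval → ℝ) :=
  {φ | IsFracPartition φ ∧ ∀ i, ∫ t, φ i t = a i}

/-- `q`-integer partitions of the vertex set `[k]`. -/
structure IsIntPartition {k q : ℕ} (x : Fin k → Fin q → ℝ) : Prop where
  zero_or_one : ∀ u i, x u i = 0 ∨ x u i = 1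
  sum_eq_one : ∀ u, ∑ i, x u i = 1

/-- `ω̂_a`: the integer partitions of `[k]` whose relative class sizes differ from `a` by at
most `1 / k`. -/
def omegaHat (k : ℕ) {q : ℕ} (a : Fin q → ℝ) : Set (Fin k → Fin q → ℝ) :=
  {x | IsIntPartition x ∧ ∀ i, |(∑ u, x u i) / (k : ℝ) - a i| ≤ 1 / (k : ℝ)}

/-- The layered energy `ℰ_φ(W, J)` of a tuple of graphons at a fractional partition `φ`. -/
noncomputable def graphonEnergy {E K : Type*} [Fintype E] [TopologicalSpace K]
    [MeasurableSpace K] {r q : ℕ} (W : E → Graphon K r) (J : Interaction E K r q)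
    (φ : Fin q → unitInterval → ℝ) : ℝ :=
  ∑ e, ∑ z : Fin r → Fin q, ∫ x : Cube r, J e z (W e x) * ∏ j, φ (z j) (x.vertex j)

/-- The layered energy `ℰ_x(G, J)` of a tuple of `K`-valued `r`-graphs on `[k]`. -/
noncomputable def graphEnergy {E K : Type*} [Fintype E] [TopologicalSpace K]
    {r q k : ℕ} (G : E → (Fin r → Fin k) → K) (J : Interaction E K r q)
    (x : Fin k → Fin q → ℝ) : ℝ :=
  ∑ e, 1 / (k : ℝ) ^ r *
    ∑ z : Fin r → Fin q, ∑ n : Fin r → Fin k, J e z (G e n) * ∏ j, x (n j) (z j)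

/-- The microcanonical ground state energy `ℰ_a(W, J)`. -/
noncomputable def microEnergy {E K : Type*} [Fintype E] [TopologicalSpace K]
    [MeasurableSpace K] {r q : ℕ} (a : Fin q → ℝ) (W : E → Graphon K r)
    (J : Interaction E K r q) : ℝ :=
  sSup (graphonEnergy W J '' Omega a)

/-- The integer microcanonical ground state energy `ℰ̂_a(G, J)`. -/
noncomputable def microEnergyHat {E K : Type*} [Fintype E] [TopologicalSpace K]
    {r q k : ℕ} (a : Fin q → ℝ) (G : E → (Fin r → Fin k) → K)
    (J : Interaction E K r q) : ℝ :=
  sSup (graphEnergy G J '' omegaHat k a)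

/-- The space of samples `(U_S)_{S ∈ s([k], r)}`; under `volume` the coordinates are independent
and uniform on `[0,1]`. -/
abbrev Sample (k r : ℕ) : Type :=
  {S : Finset (Fin k) // S.Nonempty ∧ S.card ≤ r} → unitInterval

/-- For an edge `n = (n_1, …, n_r)`, the point of the cube whose `S`-coordinate is
`U_{{n_j : j ∈ S}}`. -/
def Sample.edgePoint {k r : ℕ} (U : Sample k r) (n : Fin r → Fin k) : Cube r :=
  fun S => U ⟨S.1.image n, S.2.image n,
    Finset.card_image_le.trans (card_finset_fin_le S.1)⟩

/-- The layered random `r`-graph `𝔾(k, W)` as a function of the sample `U`; all layers use the same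
sample, and edges with a repeated vertex (the diagonal) receive the special colour `ι`. -/
def sampleGraph {E K : Type*} [MeasurableSpace K] {k r : ℕ} (ι : K) (W : E → Graphon K r)
    (U : Sample k r) : E → (Fin r → Fin k) → K :=
  fun e n => if Function.Injective n then W e (U.edgePoint n) else ι

/-- A real `r`-array `A` acting on real colours by multiplication, `x ↦ A^e_z x`. -/
def linearInteraction {E : Type*} {r q : ℕ} (d : ℝ) (A : E → (Fin r → Fin q) → ℝ) :
    Interaction E (Set.Icc (-d) d) r q :=
  fun e z => ⟨fun x => A e z * (x : ℝ), by fun_prop⟩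

/-- `‖W‖_∞ = max_e ‖W^e‖_{L^∞}` for a tuple of graphons with colours in `[-d, d]`. -/
noncomputable def layeredSupNorm {E : Type*} {d : ℝ} {r : ℕ}
    (W : E → Graphon (Set.Icc (-d) d) r) : ℝ :=
  ⨆ e, (eLpNorm (fun x => (W e x : ℝ)) ⊤ volume).toReal

end GroundState

namespace GroundState
open ProbabilityTheory

/-! Summing over the layers, which share one sample, and rescaling leaves a single family of kernels
bounded by 1. Integrating out the coordinates of faces with at least two vertices turns it into a
kernel F of r coloured points (`vertexKernel`), and the energy of a fractional partition becomes the
integral of F against the r-th power of its coloured-point measure. Each integrated coordinate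
influences only O(1/k^2) of the edges. Given the vertices, the energy of one colouring therefore
deviates by s, beyond O(1/k), with probability at most 2 exp(-c s^2 k^2), which survives a union
bound over all q^k colourings (`measureReal_sampleEnergy_sub_le`).

What remains is the maximum of the vertex energy over balanced colourings. It is not much smaller
than the graphon energy: colour the sample at random according to a nearly optimal φ, repair the
class sizes, and use McDiarmid's inequality (`measureReal_vertexEnergy_lt_le`).

The opposite direction is the hard one, since vertex coordinates concentrate only at rate exp(-c k
ε^2), too weak against q^k colourings. For a linear functional the difficulty disappears: the
expectation of its minimum over colourings equals its value at the expected colouring, which is a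
fractional partition, and the minimum itself concentrates (`measureReal_exists_balanced_le`). The
general case is reduced to this one. In each argument of F the empirical measure of a coloured
sample is replaced by an average over m = O(ε^-2) of its own points, the seeds (`exists_seeds`). If
the seeds predict too large an energy, they cannot represent any admissible fractional partition.
The deviations are affine in the measure, so a minimax argument certifies this failure by one linear
functional (`exists_separating_functional`). Since the seeds do represent the sample, that
functional is small on the sample although it is large on all of `Omega a`, which is exponentially
unlikely.

The union bound thus runs over the (kq)^(rm) choices of coloured seeds only. The requirement ε^-2
log k ≪ k ε^2 gives the sample size ε^-4 log(1/ε). -/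

/-! ### Concentration for functions of independent coordinates -/

/-- Reindexing a power of a probability measure along an injective map preserves it. -/
theorem measurePreserving_comp_injective {ι κ Ω : Type*} [Fintype ι] [Fintype κ]
    [MeasurableSpace Ω] (μ : Measure Ω) [IsProbabilityMeasure μ] {σ : κ → ι}
    (hσ : Function.Injective σ) :
    MeasurePreserving (fun (U : ι → Ω) (j : κ) => U (σ j))
      (Measure.pi fun _ => μ) (Measure.pi fun _ => μ) := by
  refine ⟨by fun_prop, ?_⟩
  have h : iIndepFun (fun (i : ι) (U : ι → Ω) => U i) (Measure.pi fun _ => μ) :=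
    iIndepFun_pi (μ := fun _ : ι => μ) (X := fun _ => id) (fun _ => aemeasurable_id)
  have h2 := h.precomp hσ
  have h3 := (iIndepFun_iff_map_fun_eq_pi_map
    (fun j => (measurable_pi_apply (σ j)).aemeasurable)).1 h2
  refine h3.trans ?_
  congr 1
  funext j
  exact (measurePreserving_eval (fun _ : ι => μ) (σ j)).map_eq

theorem integrable_of_abs_le {Ω : Type*} [MeasurableSpace Ω] {μ : Measure Ω} [IsFiniteMeasure μ]
    {F : Ω → ℝ} (hF : Measurable F) {B : ℝ} (hB : ∀ x, |F x| ≤ B) : Integrable F μ :=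
  Integrable.of_bound hF.aestronglyMeasurable B (Eventually.of_forall hB)

theorem abs_integral_le_of_abs_le {Ω : Type*} [MeasurableSpace Ω] {μ : Measure Ω}
    [IsProbabilityMeasure μ] {F : Ω → ℝ} {B : ℝ} (hB : ∀ x, |F x| ≤ B) :
    |∫ x, F x ∂μ| ≤ B := by
  simpa using norm_integral_le_of_norm_le_const (μ := μ) (f := F) (C := B)
    (Eventually.of_forall hB)

/-- One coordinate is integrated out at a time. The conditional mean given the remaining coordinates
inherits their bounded differences, so the induction hypothesis applies to it. Hoeffding's lemma
bounds the fluctuation in the removed coordinate. -/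
theorem mgf_le_of_boundedDifferences_fin {Ω : Type*} [MeasurableSpace Ω] (μ : Measure Ω)
    [IsProbabilityMeasure μ] (n : ℕ) :
    ∀ (F : (Fin n → Ω) → ℝ) (c : Fin n → ℝ) (B : ℝ), Measurable F → (∀ x, |F x| ≤ B) →
      (∀ i x a, |F (Function.update x i a) - F x| ≤ c i) → ∀ t : ℝ,
      ∫ x, Real.exp (t * (F x - ∫ y, F y ∂(Measure.pi fun _ => μ))) ∂(Measure.pi fun _ => μ)
        ≤ Real.exp (t ^ 2 / 2 * ∑ i, c i ^ 2) := by
  induction n with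
  | zero =>
    intro F c B hF hB hc t
    have : ∀ x, F x = F default := fun x => by rw [Subsingleton.elim x default]
    simp [this]
  | succ n ih =>
    intro F c B hF hB hc t
    have hmp := (measurePreserving_piFinSuccAbove (fun _ : Fin (n + 1) => μ) 0).symm
    have hcons : ∀ p : Ω × (Fin n → Ω),
        (MeasurableEquiv.piFinSuccAbove (fun _ : Fin (n + 1) => Ω) 0).symm p
          = Fin.cons p.1 p.2 := by
      intro p; simp [MeasurableEquiv.piFinSuccAbove, Fin.insertNthEquiv]
    have hconsm : Measurable fun p : Ω × (Fin n → Ω) =>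
        (Fin.cons p.1 p.2 : Fin (n + 1) → Ω) := by
      have := (MeasurableEquiv.piFinSuccAbove (fun _ : Fin (n + 1) => Ω) 0).symm.measurable
      simpa only [funext hcons] using this
    have key : ∀ G : (Fin (n + 1) → Ω) → ℝ, Measurable G → ∀ C, (∀ x, |G x| ≤ C) →
        ∫ x, G x ∂(Measure.pi fun _ => μ)
          = ∫ ω, ∫ a, G (Fin.cons a ω) ∂μ ∂(Measure.pi fun _ : Fin n => μ) := by
      intro G hG C hC
      rw [← hmp.integral_comp', integral_prod_symm]
      · simp only [hcons]
      · refine integrable_of_abs_le (B := C) ?_ ?_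
        · exact hG.comp (MeasurableEquiv.measurable _)
        · intro p; exact hC _
    set m := ∫ y, F y ∂(Measure.pi fun _ => μ) with hm
    have hexpb : ∀ (s : ℝ) x, |Real.exp (t * (F x - s))| ≤ Real.exp (|t| * (B + |s|)) := by
      intro s x
      rw [abs_of_pos (Real.exp_pos _), Real.exp_le_exp]
      refine (le_abs_self _).trans ?_
      rw [abs_mul]
      gcongr
      exact (abs_sub _ _).trans (by gcongr; exact hB x)
    have hB0 : 0 ≤ B := by
      have : Nonempty Ω := nonempty_of_isProbabilityMeasure μ
      exact (abs_nonneg _).trans (hB (fun _ => Classical.arbitrary Ω))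
    set Fb : (Fin n → Ω) → ℝ := fun ω => ∫ a, F (Fin.cons a ω) ∂μ with hFb
    have hFm : Measurable fun p : (Fin n → Ω) × Ω => F (Fin.cons p.2 p.1) :=
      hF.comp (hconsm.comp measurable_swap)
    have hFbm : Measurable Fb :=
      (hFm.stronglyMeasurable.integral_prod_right' (ν := μ)).measurable
    have hFbB : ∀ ω, |Fb ω| ≤ B := fun ω => abs_integral_le_of_abs_le fun a => hB _
    have hsec : ∀ ω, Measurable fun a => F (Fin.cons a ω) := fun ω =>
      hF.comp (hconsm.comp (measurable_id.prodMk measurable_const))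
    have hmb : ∫ ω, Fb ω ∂(Measure.pi fun _ => μ) = m := (key F hF B hB).symm
    have hFbc : ∀ i ω a, |Fb (Function.update ω i a) - Fb ω| ≤ c i.succ := by
      intro i ω a
      rw [hFb]
      dsimp only
      rw [← integral_sub (integrable_of_abs_le (hsec _) fun _ => hB _)
        (integrable_of_abs_le (hsec _) fun _ => hB _)]
      refine abs_integral_le_of_abs_le fun b => ?_
      rw [Fin.cons_update (α := fun _ => Ω)]
      exact hc _ _ _
    have hoeff : ∀ ω, ∫ a, Real.exp (t * (F (Fin.cons a ω) - m)) ∂μ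
        ≤ Real.exp (t * (Fb ω - m)) * Real.exp (t ^ 2 / 2 * c 0 ^ 2) := by
      intro ω
      have : Nonempty Ω := nonempty_of_isProbabilityMeasure μ
      let a₀ := Classical.arbitrary Ω
      have hc0 : 0 ≤ c 0 := (abs_nonneg _).trans (hc 0 (Fin.cons a₀ ω) a₀)
      -- Comparison with one reference value confines F to an interval of length `2 * c 0`, so
      -- Hoeffding's lemma gives variance proxy `c 0 ^ 2`. This is four times the optimal value,
      -- which affects constants only.
      have hI : ∀ a, F (Fin.cons a ω) ∈
          Set.Icc (F (Fin.cons a₀ ω) - c 0) (F (Fin.cons a₀ ω) + c 0) := by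
        intro a
        have := hc 0 (Fin.cons a₀ ω) a
        rw [Fin.update_cons_zero, abs_le] at this
        constructor <;> linarith [this.1, this.2]
      have hsub := hasSubgaussianMGF_of_mem_Icc (μ := μ) (hsec ω).aemeasurable
        (Eventually.of_forall hI)
      have h1 := hsub.mgf_le t
      rw [mgf] at h1
      have h2 : ((‖(F (Fin.cons a₀ ω) + c 0) - (F (Fin.cons a₀ ω) - c 0)‖₊ / 2) ^ 2 : NNReal)
          = c 0 ^ 2 := by
        push_cast
        rw [Real.norm_eq_abs, abs_of_nonneg (by linarith)]
        ring
      rw [h2] at h1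
      calc ∫ a, Real.exp (t * (F (Fin.cons a ω) - m)) ∂μ
          = ∫ a, Real.exp (t * (Fb ω - m)) * Real.exp (t * (F (Fin.cons a ω) - Fb ω)) ∂μ := by
            congr 1; funext a; rw [← Real.exp_add]; congr 1; ring
        _ = Real.exp (t * (Fb ω - m)) * ∫ a, Real.exp (t * (F (Fin.cons a ω) - Fb ω)) ∂μ :=
            integral_const_mul _ _
        _ ≤ _ := by
            gcongr
            refine h1.trans_eq ?_
            congr 1; ring
    rw [key _ (by fun_prop) _ (hexpb m)]
    calc ∫ ω, ∫ a, Real.exp (t * (F (Fin.cons a ω) - m)) ∂μ ∂(Measure.pi fun _ => μ)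
        ≤ ∫ ω, Real.exp (t * (Fb ω - m)) * Real.exp (t ^ 2 / 2 * c 0 ^ 2)
            ∂(Measure.pi fun _ => μ) := by
          refine integral_mono ?_ ?_ hoeff
          · refine integrable_of_abs_le ?_ (fun ω => abs_integral_le_of_abs_le
              fun a => hexpb m (Fin.cons a ω))
            have : Measurable fun p : (Fin n → Ω) × Ω =>
              Real.exp (t * (F (Fin.cons p.2 p.1) - m)) := by fun_prop
            exact (this.stronglyMeasurable.integral_prod_right' (ν := μ)).measurable
          · refine Integrable.mul_const (integrable_of_abs_le (by fun_prop)
              (B := Real.exp (|t| * (B + |m|))) ?_) _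
            intro ω
            rw [abs_of_pos (Real.exp_pos _), Real.exp_le_exp]
            refine (le_abs_self _).trans ?_
            rw [abs_mul]
            gcongr
            exact (abs_sub _ _).trans (by gcongr; exact hFbB ω)
      _ = (∫ ω, Real.exp (t * (Fb ω - m)) ∂(Measure.pi fun _ => μ))
            * Real.exp (t ^ 2 / 2 * c 0 ^ 2) := integral_mul_const _ _
      _ ≤ Real.exp (t ^ 2 / 2 * ∑ i : Fin n, c i.succ ^ 2) * Real.exp (t ^ 2 / 2 * c 0 ^ 2) := by
          gcongr
          have := ih Fb (fun i => c i.succ) B hFbm hFbB hFbc t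
          rwa [hmb] at this
      _ = _ := by
          rw [← Real.exp_add, Fin.sum_univ_succ]
          congr 1; ring

/-- **McDiarmid's inequality** for a function of bounded differences on a power of a
probability space. -/
theorem measureReal_ge_le_of_boundedDifferences {ι Ω : Type*} [Fintype ι] [DecidableEq ι]
    [MeasurableSpace Ω] (μ : Measure Ω) [IsProbabilityMeasure μ]
    {F : (ι → Ω) → ℝ} {c : ι → ℝ} {B V s : ℝ} (hF : Measurable F) (hB : ∀ x, |F x| ≤ B)
    (hc : ∀ i x a, |F (Function.update x i a) - F x| ≤ c i) (hV : 0 < V)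
    (hcV : ∑ i, c i ^ 2 ≤ V) (hs : 0 ≤ s) :
    (Measure.pi fun _ => μ).real {x | ∫ y, F y ∂(Measure.pi fun _ => μ) + s ≤ F x}
      ≤ Real.exp (-s ^ 2 / (2 * V)) := by
  classical
  let e := Fintype.equivFin ι
  have hmp := measurePreserving_comp_injective μ e.injective
  have hE : ∀ G : (ι → Ω) → ℝ, Measurable G →
      ∫ x, G x ∂(Measure.pi fun _ => μ)
        = ∫ y : Fin (Fintype.card ι) → Ω, G (fun j => y (e j)) ∂(Measure.pi fun _ => μ) := by
    intro G hG
    rw [← hmp.map_eq, integral_map hmp.measurable.aemeasurable hG.aestronglyMeasurable]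
  set m := ∫ y, F y ∂(Measure.pi fun _ => μ) with hm
  have hsub : HasSubgaussianMGF (fun x => F x - m) ⟨V, hV.le⟩ (Measure.pi fun _ : ι => μ) := by
    constructor
    · intro t
      refine integrable_of_abs_le (by fun_prop) (B := Real.exp (|t| * (B + |m|))) ?_
      intro ω
      rw [abs_of_pos (Real.exp_pos _), Real.exp_le_exp]
      refine (le_abs_self _).trans ?_
      rw [abs_mul]
      gcongr
      exact (abs_sub _ _).trans (by gcongr; exact hB ω)
    · intro t
      rw [mgf, hE _ (by fun_prop), hm, hE _ hF]
      refine (mgf_le_of_boundedDifferences_fin μ _ (fun y => F fun j => y (e j))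
        (fun i => c (e.symm i)) B (by fun_prop) (fun _ => hB _) ?_ t).trans ?_
      · intro i x a
        have : (fun j => Function.update x i a (e j))
            = Function.update (fun j => x (e j)) (e.symm i) a := by
          funext j
          by_cases h : e j = i
          · subst h; simp
          · rw [Function.update_of_ne h, Function.update_of_ne]
            rintro rfl; simp at h
        rw [this]
        exact hc _ _ _
      · rw [Equiv.sum_comp e.symm (fun i => c i ^ 2), Real.exp_le_exp]
        have : t ^ 2 / 2 * ∑ i, c i ^ 2 ≤ t ^ 2 / 2 * V := by gcongr
        refine this.trans_eq ?_
        change _ = V * t ^ 2 / 2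
        ring
  have h := hsub.measure_ge_le hs
  refine le_trans (le_of_eq ?_) h
  congr 1
  ext x
  simp only [Set.mem_ofPred_eq]
  constructor <;> intro h <;> linarith

/-- Lower-tail form of McDiarmid's inequality. -/
theorem measureReal_le_le_of_boundedDifferences {ι Ω : Type*} [Fintype ι] [DecidableEq ι]
    [MeasurableSpace Ω] (μ : Measure Ω) [IsProbabilityMeasure μ]
    {F : (ι → Ω) → ℝ} {c : ι → ℝ} {B V s : ℝ} (hF : Measurable F) (hB : ∀ x, |F x| ≤ B)
    (hc : ∀ i x a, |F (Function.update x i a) - F x| ≤ c i) (hV : 0 < V)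
    (hcV : ∑ i, c i ^ 2 ≤ V) (hs : 0 ≤ s) :
    (Measure.pi fun _ => μ).real {x | F x ≤ ∫ y, F y ∂(Measure.pi fun _ => μ) - s}
      ≤ Real.exp (-s ^ 2 / (2 * V)) := by
  have h := measureReal_ge_le_of_boundedDifferences μ (F := fun x => -F x) (c := c) (B := B)
    hF.neg (fun x => by simpa using hB x)
    (fun i x a => by rw [neg_sub_neg, abs_sub_comm]; exact hc i x a) hV hcV hs
  refine le_trans (le_of_eq ?_) h
  congr 1
  ext x
  simp only [Set.mem_ofPred_eq, integral_neg]
  constructor <;> intro h <;> linarith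

/-- The empirical mean of a function bounded by `1` is close to the mean, in `L¹`. -/
theorem integral_abs_average_sub_le {Ω : Type*} [MeasurableSpace Ω] (μ : Measure Ω)
    [IsProbabilityMeasure μ] {a : Ω → ℝ} (ha : Measurable a) (ha1 : ∀ x, |a x| ≤ 1)
    {m : ℕ} (hm : 0 < m) :
    ∫ ω : Fin m → Ω, |(∑ i, a (ω i)) / m - ∫ x, a x ∂μ| ∂(Measure.pi fun _ => μ)
      ≤ 1 / √m := by
  have hmR : (0 : ℝ) < m := by exact_mod_cast hm
  set X : (Fin m → Ω) → ℝ := fun ω => (∑ i, a (ω i)) / m - ∫ x, a x ∂μ with hX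
  have hXm : Measurable X := by fun_prop
  have hXb : ∀ ω, |X ω| ≤ 2 := by
    intro ω
    refine (abs_sub _ _).trans ?_
    have h1 : |(∑ i, a (ω i)) / m| ≤ 1 := by
      rw [abs_div, abs_of_pos hmR, div_le_one hmR]
      refine (Finset.abs_sum_le_sum_abs _ _).trans ?_
      refine (Finset.sum_le_sum fun i _ => ha1 (ω i)).trans ?_
      simp
    linarith [abs_integral_le_of_abs_le (μ := μ) ha1]
  have hai : Integrable a μ := integrable_of_abs_le ha ha1
  have hamem : MemLp a 2 μ := MemLp.of_bound ha.aestronglyMeasurable 1 (Eventually.of_forall ha1)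
  have hsum : ∫ ω : Fin m → Ω, ∑ i, a (ω i) ∂(Measure.pi fun _ => μ) = m * ∫ x, a x ∂μ := by
    rw [integral_finsetSum]
    · have : ∀ i : Fin m, ∫ ω : Fin m → Ω, a (ω i) ∂(Measure.pi fun _ => μ) = ∫ x, a x ∂μ := by
        intro i
        have hi := measurePreserving_eval (fun _ : Fin m => μ) i
        have h := integral_map (μ := Measure.pi fun _ : Fin m => μ) (f := a)
          hi.measurable.aemeasurable ha.aestronglyMeasurable
        rw [hi.map_eq] at h
        exact h.symm
      simp [this]
    · intro i _
      exact integrable_of_abs_le (by fun_prop) fun ω => ha1 _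
  have hvar : ∫ ω, X ω ^ 2 ∂(Measure.pi fun _ => μ) ≤ 1 / m := by
    have h1 := variance_sum_pi (μ := fun _ : Fin m => μ) (X := fun _ => a) (fun _ => hamem)
    have hv1 : variance a μ ≤ 1 := by
      refine (variance_le_sq_of_bounded (a := -1) (b := 1) ?_ ha.aemeasurable).trans ?_
      · exact Eventually.of_forall fun x => abs_le.1 (ha1 x)
      · norm_num
    have h2 : variance (∑ i, fun ω : Fin m → Ω => a (ω i)) (Measure.pi fun _ => μ) ≤ m := by
      rw [h1]
      refine (Finset.sum_le_sum fun i _ => hv1).trans ?_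
      simp
    rw [variance_eq_integral (by fun_prop)] at h2
    have h3 : ∀ ω, X ω ^ 2 = (1 / (m : ℝ) ^ 2) * ((∑ i, fun ω : Fin m → Ω => a (ω i)) ω
        - ∫ x, (∑ i, fun ω : Fin m → Ω => a (ω i)) x ∂(Measure.pi fun _ => μ)) ^ 2 := by
      intro ω
      simp only [Finset.sum_apply, hX]
      rw [hsum]
      field_simp
    simp_rw [h3]
    rw [integral_const_mul]
    calc _ ≤ 1 / (m : ℝ) ^ 2 * m := by gcongr
      _ = 1 / m := by field_simp
  have hs0 : 0 < √(m : ℝ) := Real.sqrt_pos.2 hmR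
  have hss : √(m : ℝ) ^ 2 = m := Real.sq_sqrt hmR.le
  -- The arithmetic-geometric mean inequality, balanced for the variance bound 1/m, passes from the
  -- second moment to the first.
  have hpt : ∀ ω, |X ω| ≤ (√m * X ω ^ 2 + 1 / √m) / 2 := by
    intro ω
    have := sq_nonneg (√m * |X ω| - 1)
    rw [sub_sq, mul_pow, sq_abs, hss] at this
    rw [le_div_iff₀ two_pos]
    have h2 : √m * X ω ^ 2 + 1 / √m = (m * X ω ^ 2 + 1) / √m := by
      field_simp; rw [hss]; ring
    rw [h2, le_div_iff₀ hs0]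
    linarith
  calc ∫ ω, |X ω| ∂(Measure.pi fun _ => μ)
      ≤ ∫ ω, (√m * X ω ^ 2 + 1 / √m) / 2 ∂(Measure.pi fun _ => μ) := by
        refine integral_mono (integrable_of_abs_le (by fun_prop) (B := 2) (by simpa using hXb)) ?_ hpt
        refine Integrable.div_const (Integrable.add (Integrable.const_mul ?_ _)
          (integrable_const _)) _
        refine integrable_of_abs_le (by fun_prop) (B := 4) fun ω => ?_
        rw [abs_pow]
        nlinarith [hXb ω, abs_nonneg (X ω)]
    _ = (√m * ∫ ω, X ω ^ 2 ∂(Measure.pi fun _ => μ) + 1 / √m) / 2 := by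
        rw [integral_div, integral_add, integral_const_mul]
        · simp
        · refine Integrable.const_mul ?_ _
          refine integrable_of_abs_le (by fun_prop) (B := 4) fun ω => ?_
          rw [abs_pow]
          nlinarith [hXb ω, abs_nonneg (X ω)]
        · exact integrable_const _
    _ ≤ (√m * (1 / m) + 1 / √m) / 2 := by gcongr
    _ = 1 / √m := by
        have : √(m : ℝ) * (1 / m) = 1 / √m := by
          field_simp; exact hss
        rw [this]; ring

/-! ### Separation of a convex family from zero -/

/-- A minimax principle: a convex family of uniformly bounded functions which stays away from
zero in `L¹` is separated from zero by a single bounded test function. -/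
theorem exists_separating_test_function {Θ : Type*} [MeasurableSpace Θ] (κ : Measure Θ)
    [IsProbabilityMeasure κ] {C : Set (Θ → ℝ)} (hC : Convex ℝ C) (hmeas : ∀ c ∈ C, Measurable c)
    (hbd : ∀ c ∈ C, ∀ θ, |c θ| ≤ 2) {ε : ℝ} (hε : 0 < ε) (hε1 : ε ≤ 1)
    (hfar : ∀ c ∈ C, 3 * ε ≤ ∫ θ, |c θ| ∂κ) :
    ∃ g : Θ → ℝ, Measurable g ∧ (∀ θ, |g θ| ≤ 1) ∧ ∀ c ∈ C, ε ≤ ∫ θ, g θ * c θ ∂κ := by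
  rcases C.eq_empty_or_nonempty with rfl | hne
  · exact ⟨fun _ => 0, measurable_const, by simp, by simp⟩
  -- S is a smoothed absolute value: it lies within ε of |x| and has second derivative at most 1/ε.
  -- Minimising its integral over C has a first-order condition that produces the test function.
  set S : ℝ → ℝ := fun x => √(x ^ 2 + ε ^ 2) with hS
  have hSpos : ∀ x, 0 < S x := fun x => Real.sqrt_pos.2 (by positivity)
  have hSsq : ∀ x, S x ^ 2 = x ^ 2 + ε ^ 2 := fun x => Real.sq_sqrt (by positivity)
  have hSm : Measurable S := by fun_prop
  have hSε : ∀ x, ε ≤ S x := fun x => by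
    apply Real.le_sqrt_of_sq_le; nlinarith [sq_nonneg x]
  have hSabs : ∀ x, |x| ≤ S x := fun x => by
    apply Real.le_sqrt_of_sq_le; rw [sq_abs]; nlinarith [sq_nonneg ε]
  have hSle : ∀ x, S x ≤ |x| + ε := fun x => by
    apply Real.sqrt_le_iff.2 ⟨by positivity, ?_⟩
    rw [add_sq, sq_abs]; nlinarith [mul_nonneg (abs_nonneg x) hε.le]
  -- The second-order upper bound at a. It comes from concavity of the square root applied to `x ^ 2
  -- + ε ^ 2`, together with S ≥ ε.
  have hquad : ∀ a b, S b ≤ S a + a / S a * (b - a) + (b - a) ^ 2 / (2 * ε) := by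
    intro a b
    have h1 : S b ≤ S a + (b ^ 2 - a ^ 2) / (2 * S a) := by
      have h := sq_nonneg (S a - S b)
      have e : S a + (b ^ 2 - a ^ 2) / (2 * S a) = (S a ^ 2 + S b ^ 2) / (2 * S a) := by
        rw [eq_div_iff (by have := hSpos a; positivity)]
        have := hSpos a
        field_simp
        rw [hSsq a, hSsq b]; ring
      rw [e, le_div_iff₀ (by have := hSpos a; positivity)]
      nlinarith
    have h2 : (b ^ 2 - a ^ 2) / (2 * S a) = a / S a * (b - a) + (b - a) ^ 2 / (2 * S a) := by
      have := hSpos a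
      field_simp; ring
    have h3 : (b - a) ^ 2 / (2 * S a) ≤ (b - a) ^ 2 / (2 * ε) := by
      have := hSε a
      gcongr
    linarith
  set Φ : (Θ → ℝ) → ℝ := fun c => ∫ θ, S (c θ) ∂κ with hΦ
  have hSint : ∀ c ∈ C, Integrable (fun θ => S (c θ)) κ := fun c hc =>
    integrable_of_abs_le (hSm.comp (hmeas c hc)) (B := 2 + ε) fun θ => by
      rw [abs_of_pos (hSpos _)]; linarith [hSle (c θ), hbd c hc θ]
  have hbb : BddBelow (Φ '' C) := ⟨0, by
    rintro _ ⟨c, _, rfl⟩; exact integral_nonneg fun θ => (hSpos _).le⟩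
  -- An approximate minimiser suffices, so C need not be closed. With t = ε²/16, both η and the
  -- quadratic error 8t²/ε equal tε/2, hence the first-order condition is lost only by ε.
  set η := ε ^ 3 / 32 with hη
  have hηpos : 0 < η := by positivity
  obtain ⟨_, ⟨c₀, hc₀, rfl⟩, hlt⟩ := exists_lt_of_csInf_lt (hne.image Φ)
    (lt_add_of_pos_right (sInf (Φ '' C)) hηpos)
  -- The test function is the derivative of S at `c₀`.
  set g : Θ → ℝ := fun θ => c₀ θ / S (c₀ θ) with hg
  have hc₀m := hmeas c₀ hc₀
  have hgm : Measurable g := by fun_prop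
  have hg1 : ∀ θ, |g θ| ≤ 1 := fun θ => by
    rw [hg]; dsimp only
    rw [abs_div, abs_of_pos (hSpos _), div_le_one (hSpos _)]; exact hSabs _
  refine ⟨g, hgm, hg1, fun c hc => ?_⟩
  have hcm := hmeas c hc
  have hgc : ∀ c ∈ C, Integrable (fun θ => g θ * c θ) κ := fun c hc =>
    integrable_of_abs_le (hgm.mul (hmeas c hc)) (B := 2) fun θ => by
      rw [abs_mul]
      nlinarith [hg1 θ, hbd c hc θ, abs_nonneg (g θ), abs_nonneg (c θ)]
  set t := ε ^ 2 / 16 with ht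
  have ht0 : 0 < t := by positivity
  have ht1 : t ≤ 1 := by rw [ht]; nlinarith
  set ct : Θ → ℝ := (1 - t) • c₀ + t • c with hct
  have hctC : ct ∈ C := hC hc₀ hc (by linarith) ht0.le (by ring)
  have h1 : Φ c₀ - η ≤ Φ ct := by
    have := csInf_le hbb (Set.mem_image_of_mem Φ hctC)
    linarith
  have h2 : Φ ct ≤ Φ c₀ + t * (∫ θ, g θ * c θ ∂κ - ∫ θ, g θ * c₀ θ ∂κ) + t ^ 2 * 8 / ε := by
    have hi1 : Integrable (fun θ => t * (g θ * c θ - g θ * c₀ θ)) κ :=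
      ((hgc c hc).sub (hgc c₀ hc₀)).const_mul t
    have hi2 : Integrable (fun θ => S (c₀ θ) + t * (g θ * c θ - g θ * c₀ θ)) κ :=
      (hSint c₀ hc₀).add hi1
    calc Φ ct ≤ ∫ θ, (S (c₀ θ) + t * (g θ * c θ - g θ * c₀ θ) + t ^ 2 * 8 / ε) ∂κ := by
          refine integral_mono (hSint ct hctC)
            (hi2.add (integrable_const _)) fun θ => ?_
          have h := hquad (c₀ θ) (ct θ)
          have e : ct θ - c₀ θ = t * (c θ - c₀ θ) := by
            simp only [hct, Pi.add_apply, Pi.smul_apply, smul_eq_mul]; ring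
          rw [e] at h
          have h5 : (t * (c θ - c₀ θ)) ^ 2 / (2 * ε) ≤ t ^ 2 * 8 / ε := by
            have h6 : (c θ - c₀ θ) ^ 2 ≤ 16 := by
              have h7 := abs_le.1 (hbd c hc θ)
              have h8 := abs_le.1 (hbd c₀ hc₀ θ)
              nlinarith [h7.1, h7.2, h8.1, h8.2]
            rw [div_le_div_iff₀ (by positivity) hε]
            have : t ^ 2 * ε * (c θ - c₀ θ) ^ 2 ≤ t ^ 2 * ε * 16 := by gcongr
            nlinarith
          simp only [hg]
          have e2 : c₀ θ / S (c₀ θ) * (t * (c θ - c₀ θ))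
            = t * (c₀ θ / S (c₀ θ) * c θ - c₀ θ / S (c₀ θ) * c₀ θ) := by ring
          rw [e2] at h
          linarith
      _ = _ := by
          rw [integral_add hi2 (integrable_const _),
            integral_add (hSint c₀ hc₀) hi1, integral_const_mul,
            integral_sub (hgc c hc) (hgc c₀ hc₀)]
          simp [hΦ]
  -- Pairing g with `c₀` nearly recovers the L¹ norm, so the value is at least 2ε. Passing from `c₀`
  -- to any other c loses at most ε.
  have h3 : ∫ θ, |c₀ θ| ∂κ - ε ≤ ∫ θ, g θ * c₀ θ ∂κ := by
    have habs : Integrable (fun θ => |c₀ θ|) κ :=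
      integrable_of_abs_le (by fun_prop) (B := 2) fun θ => by simpa using hbd c₀ hc₀ θ
    have : ∫ θ, |c₀ θ| ∂κ - ε = ∫ θ, (|c₀ θ| - ε) ∂κ := by
      rw [integral_sub habs (integrable_const _)]; simp
    rw [this]
    refine integral_mono (habs.sub (integrable_const _)) (hgc c₀ hc₀) fun θ => ?_
    simp only [hg]
    have e : c₀ θ / S (c₀ θ) * c₀ θ = |c₀ θ| ^ 2 / S (c₀ θ) := by rw [sq_abs]; ring
    rw [e, le_div_iff₀ (hSpos _)]
    have h4 := hSle (c₀ θ)
    have h5 := hSabs (c₀ θ)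
    rcases le_total (|c₀ θ|) ε with h | h
    · nlinarith [hSpos (c₀ θ), sq_nonneg |c₀ θ|]
    · nlinarith [sq_nonneg ε]
  have h4 := hfar c₀ hc₀
  have h5 : -η ≤ t * (∫ θ, g θ * c θ ∂κ - ∫ θ, g θ * c₀ θ ∂κ) + t ^ 2 * 8 / ε := by linarith
  have h6 : t ^ 2 * 8 / ε = t * (ε / 2) := by rw [ht]; field_simp; ring
  have h7 : η = t * (ε / 2) := by rw [hη, ht]; ring
  rw [h6, h7] at h5
  have h8 : -ε ≤ ∫ θ, g θ * c θ ∂κ - ∫ θ, g θ * c₀ θ ∂κ := by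
    by_contra hcon
    push Not at hcon
    nlinarith
  linarith

/-! ### Resampling coordinates and measurable selection -/

/-- Assembling a point of a power of a probability space from two independent points. -/
theorem measurePreserving_sumElim_comp {ι κ κ' Ω : Type*} [Fintype ι] [Fintype κ] [Fintype κ']
    [MeasurableSpace Ω] (μ : Measure Ω) [IsProbabilityMeasure μ] {τ : ι → κ ⊕ κ'}
    (hτ : Function.Injective τ) :
    MeasurePreserving (fun (p : (κ → Ω) × (κ' → Ω)) (i : ι) => Sum.elim p.1 p.2 (τ i))
      ((Measure.pi fun _ => μ).prod (Measure.pi fun _ => μ)) (Measure.pi fun _ => μ) := by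
  have h1 := measurePreserving_sumPiEquivProdPi_symm (fun _ : κ ⊕ κ' => μ)
  have h2 := (measurePreserving_comp_injective μ hτ).comp h1
  convert h2 using 1
  funext p i
  simp only [Function.comp]
  cases h : τ i <;> simp [MeasurableEquiv.sumPiEquivProdPi, Equiv.sumPiEquivProdPi]

theorem measurable_update_pair {ι Ω : Type*} [DecidableEq ι] [MeasurableSpace Ω] (u : ι) :
    Measurable fun p : Ω × (ι → Ω) => Function.update p.2 u p.1 := by
  refine measurable_pi_lambda _ fun i => ?_
  by_cases h : i = u
  · subst h; simpa using measurable_fst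
  · simp only [Function.update_of_ne h]; fun_prop

/-- Resampling one coordinate preserves a power of a probability measure. -/
theorem measurePreserving_update {ι Ω : Type*} [Fintype ι] [DecidableEq ι]
    [MeasurableSpace Ω] (μ : Measure Ω) [IsProbabilityMeasure μ] (u : ι) :
    MeasurePreserving (fun p : Ω × (ι → Ω) => Function.update p.2 u p.1)
      (μ.prod (Measure.pi fun _ => μ)) (Measure.pi fun _ => μ) := by
  have hf := measurable_update_pair (Ω := Ω) u
  have hτ : Function.Injective (fun i : ι => if i = u then (Sum.inl u : ι ⊕ ι) else Sum.inr i) := by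
    intro i j hij
    by_cases hi : i = u <;> by_cases hj : j = u <;> simp_all
  have h1 := measurePreserving_sumElim_comp μ hτ
  have h2 := (measurePreserving_eval (fun _ : ι => μ) u).prod
    (MeasurePreserving.id (Measure.pi fun _ : ι => μ))
  refine ⟨hf, ?_⟩
  rw [← h2.map_eq, Measure.map_map hf h2.measurable]
  refine Eq.trans ?_ h1.map_eq
  congr 1
  funext p i
  by_cases hi : i = u
  · subst hi; simp
  · simp [hi]

theorem integral_update {ι Ω : Type*} [Fintype ι] [DecidableEq ι]
    [MeasurableSpace Ω] (μ : Measure Ω) [IsProbabilityMeasure μ] (u : ι) {G : (ι → Ω) → ℝ}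
    (hG : Measurable G) {B : ℝ} (hB : ∀ x, |G x| ≤ B) :
    ∫ x, G x ∂(Measure.pi fun _ => μ)
      = ∫ t, ∫ x, G (Function.update x u t) ∂(Measure.pi fun _ => μ) ∂μ := by
  have hmp := measurePreserving_update μ u
  rw [← hmp.map_eq, integral_map hmp.measurable.aemeasurable hG.aestronglyMeasurable, hmp.map_eq,
    integral_prod]
  exact integrable_of_abs_le (hG.comp hmp.measurable) fun _ => hB _

theorem integral_update' {ι Ω : Type*} [Fintype ι] [DecidableEq ι]
    [MeasurableSpace Ω] (μ : Measure Ω) [IsProbabilityMeasure μ] (u : ι) {G : (ι → Ω) → ℝ}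
    (hG : Measurable G) {B : ℝ} (hB : ∀ x, |G x| ≤ B) :
    ∫ x, G x ∂(Measure.pi fun _ => μ)
      = ∫ x, ∫ t, G (Function.update x u t) ∂μ ∂(Measure.pi fun _ => μ) := by
  have hmp := measurePreserving_update μ u
  rw [← hmp.map_eq, integral_map hmp.measurable.aemeasurable hG.aestronglyMeasurable, hmp.map_eq,
    integral_prod_symm]
  exact integrable_of_abs_le (hG.comp hmp.measurable) fun _ => hB _

/-- Minimisers over a finite set can be selected measurably. -/
theorem exists_measurable_argmin {α Ω : Type*} [MeasurableSpace Ω] {S : Finset α}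
    (hS : S.Nonempty) (G : α → Ω → ℝ) (hG : ∀ c, Measurable (G c)) :
    ∃ sel : Ω → α, (∀ ω, sel ω ∈ S) ∧ (∀ ω, ∀ c ∈ S, G (sel ω) ω ≤ G c ω) ∧
      ∀ c, MeasurableSet {ω | sel ω = c} := by
  classical
  induction hS using Finset.Nonempty.cons_induction with
  | singleton a => exact ⟨fun _ => a, by simp, by simp, fun c => by simp⟩
  | cons a s ha hs ih =>
    obtain ⟨sel, h1, h2, h3⟩ := ih
    have hA : MeasurableSet {ω | ∀ c ∈ s, G a ω ≤ G c ω} := by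
      have : {ω | ∀ c ∈ s, G a ω ≤ G c ω} = ⋂ c ∈ s, {ω | G a ω ≤ G c ω} := by ext; simp
      rw [this]
      exact Finset.measurableSet_biInter s fun c _ => measurableSet_le (hG a) (hG c)
    refine ⟨fun ω => if ∀ c ∈ s, G a ω ≤ G c ω then a else sel ω, fun ω => ?_, fun ω => ?_,
      fun c => ?_⟩
    · dsimp only; split_ifs
      · simp
      · exact Finset.mem_cons.2 (Or.inr (h1 ω))
    · intro c hc
      dsimp only; split_ifs with h
      · rcases Finset.mem_cons.1 hc with rfl | hc
        · exact le_rfl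
        · exact h c hc
      · rcases Finset.mem_cons.1 hc with rfl | hc
        · push Not at h
          obtain ⟨d, hd, hlt⟩ := h
          exact (h2 ω d hd).trans hlt.le
        · exact h2 ω c hc
    · have : {ω | (if ∀ c ∈ s, G a ω ≤ G c ω then a else sel ω) = c}
          = ({ω | ∀ c ∈ s, G a ω ≤ G c ω} ∩ {_ω | a = c}) ∪
            ({ω | ∀ c ∈ s, G a ω ≤ G c ω}ᶜ ∩ {ω | sel ω = c}) := by
        ext ω
        simp only [Set.mem_ofPred_eq, Set.mem_union, Set.mem_inter_iff, Set.mem_compl_iff]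
        by_cases h : ∀ c ∈ s, G a ω ≤ G c ω
        · rw [if_pos h]; tauto
        · rw [if_neg h]; tauto
      rw [this]
      exact (hA.inter (MeasurableSet.const _)).union (hA.compl.inter (h3 c))

/-! ### Colourings with prescribed class sizes -/

/-- The size of a colour class. -/
def classSize {k q : ℕ} (χ : Fin k → Fin q) (i : Fin q) : ℕ :=
  (Finset.univ.filter fun u => χ u = i).card

open Classical in
/-- The colourings of `[k]` whose relative class sizes differ from `a` by at most `1 / k`. -/
noncomputable def balanced (k : ℕ) {q : ℕ} (a : Fin q → ℝ) : Finset (Fin k → Fin q) :=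
  Finset.univ.filter fun χ => ∀ i, |(classSize χ i : ℝ) / k - a i| ≤ 1 / k

theorem sum_classSize {k q : ℕ} (χ : Fin k → Fin q) : ∑ i, classSize χ i = k := by
  have := Finset.card_eq_sum_card_fiberwise (f := χ) (s := Finset.univ) (t := Finset.univ)
    (by simp)
  simpa [classSize] using this.symm

/-- The differences are truncated, so their sum is the total deficit of the classes that are too
small. A positive deficit forces some other class to be too large, and moving one vertex from it
lowers the deficit by exactly one. -/
theorem exists_recolouring {k q : ℕ} (n : Fin q → ℕ) (hn : ∑ i, n i = k) (d : ℕ) :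
    ∀ χ : Fin k → Fin q, ∑ i, (n i - classSize χ i) = d →
      ∃ χ' : Fin k → Fin q, (∀ i, classSize χ' i = n i) ∧
        (Finset.univ.filter fun u => χ u ≠ χ' u).card ≤ d := by
  induction d with
  | zero =>
    intro χ h
    refine ⟨χ, ?_, by simp⟩
    have h1 : ∀ i, n i ≤ classSize χ i := by
      intro i
      have := (Finset.sum_eq_zero_iff.1 h) i (Finset.mem_univ i)
      omega
    have h2 : ∑ i, n i = ∑ i, classSize χ i := by rw [hn, sum_classSize]
    have := (Finset.sum_eq_sum_iff_of_le (fun i _ => h1 i)).1 h2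
    exact fun i => (this i (Finset.mem_univ i)).symm
  | succ d ih =>
    intro χ h
    have hj : ∃ j, classSize χ j < n j := by
      by_contra hcon
      push Not at hcon
      have : ∑ i, (n i - classSize χ i) = 0 :=
        Finset.sum_eq_zero fun i _ => Nat.sub_eq_zero_of_le (hcon i)
      omega
    obtain ⟨j, hj⟩ := hj
    have hi : ∃ i, n i < classSize χ i := by
      by_contra hcon
      push Not at hcon
      have : ∑ i, classSize χ i < ∑ i, n i :=
        Finset.sum_lt_sum (fun i _ => hcon i) ⟨j, Finset.mem_univ _, hj⟩
      rw [hn, sum_classSize] at this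
      exact lt_irrefl _ this
    obtain ⟨i, hi⟩ := hi
    have hij : i ≠ j := by rintro rfl; omega
    obtain ⟨u, hu⟩ := Finset.card_pos.1 (lt_of_le_of_lt (Nat.zero_le _) hi)
    have hu : χ u = i := by simpa using hu
    have hsz : ∀ l, classSize (Function.update χ u j) l =
        if l = j then classSize χ j + 1 else if l = i then classSize χ i - 1
          else classSize χ l := by
      intro l
      unfold classSize
      split_ifs with h1 h2
      · subst h1
        rw [← Finset.card_insert_of_notMem (a := u) (by simp [hu, hij])]
        congr 1; ext v
        by_cases hv : v = u <;> simp [hv]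
      · subst h2
        rw [← Finset.card_erase_of_mem (a := u) (by simp [hu])]
        congr 1; ext v
        by_cases hv : v = u
        · subst hv; simp [hij.symm]
        · simp [hv]
      · congr 1; ext v
        by_cases hv : v = u
        · subst hv; simp only [Finset.mem_filter, Finset.mem_univ, true_and, Function.update_self,
            hu]
          exact ⟨fun h => absurd h.symm h1, fun h => absurd h.symm h2⟩
        · simp [hv]
    have hd : ∑ l, (n l - classSize (Function.update χ u j) l) = d := by
      have h1 := Finset.sum_erase_add Finset.univ (fun l => n l - classSize χ l)
        (Finset.mem_univ j)
      have h2 := Finset.sum_erase_add Finset.univ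
        (fun l => n l - classSize (Function.update χ u j) l) (Finset.mem_univ j)
      have h3 : ∑ l ∈ Finset.univ.erase j, (n l - classSize (Function.update χ u j) l)
          = ∑ l ∈ Finset.univ.erase j, (n l - classSize χ l) := by
        refine Finset.sum_congr rfl fun l hl => ?_
        rw [hsz, if_neg (Finset.ne_of_mem_erase hl)]
        split_ifs with h
        · subst h; omega
        · rfl
      rw [h3, hsz j, if_pos rfl] at h2
      omega
    obtain ⟨χ', h1, h2⟩ := ih _ hd
    refine ⟨χ', h1, ?_⟩
    calc (Finset.univ.filter fun v => χ v ≠ χ' v).card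
        ≤ (insert u (Finset.univ.filter fun v => Function.update χ u j v ≠ χ' v)).card := by
          refine Finset.card_le_card fun v hv => ?_
          by_cases hvu : v = u
          · simp [hvu]
          · simpa [hvu] using hv
      _ ≤ d + 1 := (Finset.card_insert_le _ _).trans (by omega)

/-- The floors of the targets sum to at most k and miss it by at most q, so adding one to suitably
many of them makes the sum exact. -/
theorem exists_rounding {q : ℕ} (k : ℕ) {a : Fin q → ℝ} (ha : a ∈ stdSimplex ℝ (Fin q)) :
    ∃ n : Fin q → ℕ, ∑ i, n i = k ∧ ∀ i, |(n i : ℝ) - k * a i| ≤ 1 := by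
  classical
  have hka : ∀ i, 0 ≤ (k : ℝ) * a i := fun i => mul_nonneg (Nat.cast_nonneg k) (ha.1 i)
  have hsum : ∑ i, (k : ℝ) * a i = k := by rw [← Finset.mul_sum, ha.2, mul_one]
  have hle : ∑ i, ⌊(k : ℝ) * a i⌋₊ ≤ k := by
    have : ((∑ i, ⌊(k : ℝ) * a i⌋₊ : ℕ) : ℝ) ≤ k := by
      push_cast
      refine le_of_le_of_eq ?_ hsum
      exact Finset.sum_le_sum fun i _ => Nat.floor_le (hka i)
    exact_mod_cast this
  have hlt : k - ∑ i, ⌊(k : ℝ) * a i⌋₊ ≤ (Finset.univ : Finset (Fin q)).card := by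
    have : (k : ℝ) ≤ ((∑ i, ⌊(k : ℝ) * a i⌋₊ + q : ℕ) : ℝ) := by
      push_cast
      calc (k : ℝ) = ∑ i, (k : ℝ) * a i := hsum.symm
        _ ≤ ∑ i, ((⌊(k : ℝ) * a i⌋₊ : ℝ) + 1) :=
          Finset.sum_le_sum fun i _ => (Nat.lt_floor_add_one _).le
        _ = _ := by rw [Finset.sum_add_distrib]; simp
    have : k ≤ ∑ i, ⌊(k : ℝ) * a i⌋₊ + q := by exact_mod_cast this
    simp only [Finset.card_univ, Fintype.card_fin]
    omega
  obtain ⟨T, -, hT⟩ := Finset.exists_subset_card_eq hlt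
  refine ⟨fun i => ⌊(k : ℝ) * a i⌋₊ + if i ∈ T then 1 else 0, ?_, fun i => ?_⟩
  · rw [Finset.sum_add_distrib, Finset.sum_ite_mem]
    simp only [Finset.univ_inter, Finset.sum_const, smul_eq_mul, mul_one, hT]
    omega
  · have h1 := Nat.floor_le (hka i)
    have h2 := Nat.lt_floor_add_one ((k : ℝ) * a i)
    rw [abs_le]
    push_cast
    split_ifs <;> constructor <;> linarith

/-- Every colouring can be made balanced by changing few colours. -/
theorem exists_balanced_near {k q : ℕ} (hk : 0 < k) {a : Fin q → ℝ}
    (ha : a ∈ stdSimplex ℝ (Fin q)) (χ : Fin k → Fin q) :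
    ∃ χ' ∈ balanced k a, ((Finset.univ.filter fun u => χ u ≠ χ' u).card : ℝ) / k
      ≤ ∑ i, |(classSize χ i : ℝ) / k - a i| + q / k := by
  have hkR : (0 : ℝ) < k := by exact_mod_cast hk
  obtain ⟨n, hn, hna⟩ := exists_rounding k ha
  obtain ⟨χ', h1, h2⟩ := exists_recolouring n hn _ χ rfl
  refine ⟨χ', ?_, ?_⟩
  · simp only [balanced, Finset.mem_filter, Finset.mem_univ, true_and, h1]
    intro i
    have : (n i : ℝ) / k - a i = (n i - k * a i) / k := by field_simp
    rw [this, abs_div, abs_of_pos hkR]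
    gcongr
    exact hna i
  · have h3 : ((Finset.univ.filter fun u => χ u ≠ χ' u).card : ℝ)
        ≤ ∑ i, (|(classSize χ i : ℝ) - k * a i| + 1) := by
      refine (Nat.cast_le.2 h2).trans ?_
      push_cast
      refine Finset.sum_le_sum fun i _ => ?_
      have h4 : ((n i - classSize χ i : ℕ) : ℝ) ≤ |(n i : ℝ) - classSize χ i| := by
        rcases le_total (n i) (classSize χ i) with h | h
        · rw [Nat.sub_eq_zero_of_le h]; simp
        · rw [Nat.cast_sub h]; exact le_abs_self _
      have h5 := abs_sub_le (n i : ℝ) (k * a i) (classSize χ i)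
      rw [abs_sub_comm (k * a i : ℝ)] at h5
      linarith [hna i]
    calc _ ≤ (∑ i, (|(classSize χ i : ℝ) - k * a i| + 1)) / k := by gcongr
      _ = _ := by
        rw [Finset.sum_add_distrib, add_div, Finset.sum_div]
        congr 1
        · refine Finset.sum_congr rfl fun i _ => ?_
          have : (classSize χ i : ℝ) / k - a i = (classSize χ i - k * a i) / k := by field_simp
          rw [this, abs_div, abs_of_pos hkR]
        · simp

theorem balanced_nonempty {k q : ℕ} (hk : 0 < k) {a : Fin q → ℝ}
    (ha : a ∈ stdSimplex ℝ (Fin q)) : (balanced k a).Nonempty := by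
  have hq : 0 < q := by
    rcases Nat.eq_zero_or_pos q with rfl | h
    · simpa using ha.2
    · exact h
  obtain ⟨χ', h, -⟩ := exists_balanced_near hk ha (fun _ => ⟨0, hq⟩)
  exact ⟨χ', h⟩

/-! ### Fractional partitions -/

theorem IsFracPartition.integrable {q : ℕ} {φ : Fin q → unitInterval → ℝ}
    (hφ : IsFracPartition φ) (i : Fin q) : Integrable (φ i) :=
  integrable_of_abs_le (hφ.measurable i) (B := 1) fun t => by
    rw [abs_of_nonneg (hφ.mem_Icc i t).1]; exact (hφ.mem_Icc i t).2

/-- A fractional partition can be adjusted to have class sizes `a`. -/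
theorem IsFracPartition.exists_omega_near {q : ℕ} {φ : Fin q → unitInterval → ℝ}
    (hφ : IsFracPartition φ) {a : Fin q → ℝ} (ha : a ∈ stdSimplex ℝ (Fin q)) :
    ∃ ψ ∈ Omega a, ∑ i, ∫ t, |φ i t - ψ i t| ≤ ∑ i, |(∫ t, φ i t) - a i| := by
  have hint := hφ.integrable
  set b : Fin q → ℝ := fun i => ∫ t, φ i t with hb
  have hb0 : ∀ i, 0 ≤ b i := fun i => integral_nonneg fun t => (hφ.mem_Icc i t).1
  have hbs : ∑ i, b i = 1 := by
    rw [hb]; dsimp only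
    rw [← integral_finsetSum _ fun i _ => hint i]
    simp [hφ.sum_eq_one]
  change ∃ ψ ∈ Omega a, ∑ i, ∫ t, |φ i t - ψ i t| ≤ ∑ i, |b i - a i|
  set m : Fin q → ℝ := fun i => min (a i) (b i) with hm
  set D : ℝ := ∑ i, (a i - m i) with hD
  have hma : ∀ i, m i ≤ a i := fun i => min_le_left _ _
  have hmb : ∀ i, m i ≤ b i := fun i => min_le_right _ _
  have hm0 : ∀ i, 0 ≤ m i := fun i => le_min (ha.1 i) (hb0 i)
  have hDm : 1 - ∑ i, m i = D := by rw [hD, Finset.sum_sub_distrib, ha.2]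
  rcases (Finset.sum_nonneg fun i _ => sub_nonneg.2 (hma i) : 0 ≤ D).eq_or_lt with h0 | hDpos
  · have h1 : ∀ i, a i = m i := fun i => by
      have := (Finset.sum_eq_zero_iff_of_nonneg fun i _ => sub_nonneg.2 (hma i)).1 h0.symm i
        (Finset.mem_univ i)
      linarith
    have h2 : ∀ i, a i = b i := by
      have h3 : ∑ i, a i = ∑ i, b i := by rw [ha.2, hbs]
      have h4 := (Finset.sum_eq_sum_iff_of_le fun i _ => (h1 i).trans_le (hmb i)).1 h3
      exact fun i => h4 i (Finset.mem_univ i)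
    exact ⟨φ, ⟨hφ, fun i => (h2 i).symm⟩, by simp [h2]⟩
  · replace hDpos : 0 < D := hDpos
    have hD0 : D ≠ 0 := hDpos.ne'
    clear_value D
    set ρ : Fin q → ℝ := fun i => m i / b i with hρ
    have hρ0 : ∀ i, 0 ≤ ρ i := fun i => div_nonneg (hm0 i) (hb0 i)
    have hρ1 : ∀ i, ρ i ≤ 1 := fun i => div_le_one_of_le₀ (hmb i) (hb0 i)
    have hρb : ∀ i, ρ i * b i = m i := fun i => by
      rcases (hb0 i).eq_or_lt with h | h
      · have : m i = 0 := le_antisymm (h ▸ hmb i) (hm0 i)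
        rw [this, ← h, mul_zero]
      · exact div_mul_cancel₀ _ h.ne'
    set rest : unitInterval → ℝ := fun t => 1 - ∑ j, ρ j * φ j t with hrest
    have hφm := hφ.measurable
    have hrm : Measurable rest := by fun_prop
    have hr0 : ∀ t, 0 ≤ rest t := fun t => by
      have : ∑ j, ρ j * φ j t ≤ ∑ j, φ j t :=
        Finset.sum_le_sum fun j _ => mul_le_of_le_one_left (hφ.mem_Icc j t).1 (hρ1 j)
      rw [hφ.sum_eq_one] at this
      simpa [hrest] using this
    have hr1 : ∀ t, rest t ≤ 1 := fun t => by
      have : 0 ≤ ∑ j, ρ j * φ j t :=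
        Finset.sum_nonneg fun j _ => mul_nonneg (hρ0 j) (hφ.mem_Icc j t).1
      simpa [hrest] using this
    have hri : Integrable rest :=
      integrable_of_abs_le hrm (B := 1) fun t => by rw [abs_of_nonneg (hr0 t)]; exact hr1 t
    have hrint : ∫ t, rest t = D := by
      rw [hrest, integral_sub (integrable_const _)
        (integrable_finsetSum _ fun j _ => (hint j).const_mul _),
        integral_finsetSum _ fun j _ => (hint j).const_mul _]
      simp_rw [integral_const_mul]
      have : ∀ j, ρ j * ∫ t, φ j t = m j := hρb
      simp only [this, integral_const, probReal_univ, smul_eq_mul, mul_one]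
      exact hDm
    set w : Fin q → ℝ := fun i => (a i - m i) / D with hw
    have hw0 : ∀ i, 0 ≤ w i := fun i => div_nonneg (sub_nonneg.2 (hma i)) hDpos.le
    have hws : ∑ i, w i = 1 := by rw [hw, ← Finset.sum_div, ← hD]; exact div_self hD0
    set ψ : Fin q → unitInterval → ℝ := fun i t => ρ i * φ i t + rest t * w i with hψ
    have hψ0 : ∀ i t, 0 ≤ ψ i t := fun i t =>
      add_nonneg (mul_nonneg (hρ0 i) (hφ.mem_Icc i t).1) (mul_nonneg (hr0 t) (hw0 i))
    have hψs : ∀ t, ∑ i, ψ i t = 1 := fun t => by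
      simp only [hψ, Finset.sum_add_distrib, ← Finset.mul_sum, hws, hrest]; ring
    refine ⟨ψ, ⟨⟨fun i => by fun_prop, fun i t => ⟨hψ0 i t, ?_⟩, hψs⟩, fun i => ?_⟩, ?_⟩
    · rw [← hψs t]
      exact Finset.single_le_sum (f := fun i => ψ i t) (fun j _ => hψ0 j t) (Finset.mem_univ i)
    · rw [hψ]
      dsimp only
      rw [integral_add ((hint i).const_mul _) (hri.mul_const _), integral_const_mul,
        integral_mul_const, hrint]
      have : ρ i * ∫ t, φ i t = m i := hρb i
      rw [this, hw]
      field_simp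
      ring
    · refine Finset.sum_le_sum fun i _ => ?_
      calc ∫ t, |φ i t - ψ i t| ≤ ∫ t, ((1 - ρ i) * φ i t + rest t * w i) := by
            refine integral_mono_of_nonneg (Eventually.of_forall fun t => abs_nonneg _)
              (((hint i).const_mul _).add (hri.mul_const _)) (Eventually.of_forall fun t => ?_)
            have h1 : φ i t - ψ i t = (1 - ρ i) * φ i t - rest t * w i := by
              simp only [hψ]; ring
            have h2 : 0 ≤ (1 - ρ i) * φ i t :=
              mul_nonneg (sub_nonneg.2 (hρ1 i)) (hφ.mem_Icc i t).1
            have h3 : 0 ≤ rest t * w i := mul_nonneg (hr0 t) (hw0 i)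
            dsimp only
            rw [h1, abs_le]
            constructor <;> linarith
        _ = (b i - m i) + (a i - m i) := by
            rw [integral_add ((hint i).const_mul _) (hri.mul_const _), integral_const_mul,
              integral_mul_const, hrint]
            have : (1 - ρ i) * ∫ t, φ i t = b i - m i := by
              have : ρ i * ∫ t, φ i t = m i := hρb i
              rw [sub_mul, this, one_mul]
            rw [this, hw]
            field_simp
        _ = |b i - a i| := by
            rcases le_total (a i) (b i) with h | h
            · rw [abs_of_nonneg (sub_nonneg.2 h), hm]; simp [h]
            · rw [abs_of_nonpos (sub_nonpos.2 h), hm]; simp [h]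

/-! ### The coloured-point measure of a fractional partition -/

/-- The law of a uniform point of `[0,1]` together with a colour drawn according to `φ`. -/
noncomputable def colourMeasure {q : ℕ} (φ : Fin q → unitInterval → ℝ) :
    Measure (unitInterval × Fin q) :=
  ((volume : Measure unitInterval).prod Measure.count).withDensity
    fun p => ENNReal.ofReal (φ p.2 p.1)

theorem IsFracPartition.measurable_uncurry {q : ℕ} {φ : Fin q → unitInterval → ℝ}
    (hφ : IsFracPartition φ) : Measurable fun p : unitInterval × Fin q => φ p.2 p.1 :=
  measurable_from_prod_countable_left fun i => hφ.measurable i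

theorem integral_prod_count {Ω : Type*} [MeasurableSpace Ω] (μ : Measure Ω)
    [IsFiniteMeasure μ] {ι : Type*} [Fintype ι] [MeasurableSpace ι] [MeasurableSingletonClass ι]
    {G : Ω × ι → ℝ} (hG : Measurable G) {B : ℝ} (hB : ∀ p, |G p| ≤ B) :
    ∫ p, G p ∂(μ.prod Measure.count) = ∑ i, ∫ t, G (t, i) ∂μ := by
  rw [integral_prod_symm _ (integrable_of_abs_le hG hB), integral_fintype .of_finite]
  simp

theorem integral_colourMeasure {q : ℕ} {φ : Fin q → unitInterval → ℝ} (hφ : IsFracPartition φ)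
    {G : unitInterval × Fin q → ℝ} (hG : Measurable G) {B : ℝ} (hB : ∀ p, |G p| ≤ B) :
    ∫ p, G p ∂(colourMeasure φ) = ∑ i, ∫ t, φ i t * G (t, i) := by
  have hm := hφ.measurable_uncurry
  rw [colourMeasure, integral_withDensity_eq_integral_toReal_smul hm.ennreal_ofReal
    (Eventually.of_forall fun _ => ENNReal.ofReal_lt_top)]
  have : ∀ p : unitInterval × Fin q, (ENNReal.ofReal (φ p.2 p.1)).toReal • G p
      = φ p.2 p.1 * G p := fun p => by
    rw [ENNReal.toReal_ofReal (hφ.mem_Icc _ _).1, smul_eq_mul]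
  simp_rw [this]
  refine integral_prod_count volume (G := fun p => φ p.2 p.1 * G p) (hm.mul hG) (B := B) ?_
  intro p
  rw [abs_mul, abs_of_nonneg (hφ.mem_Icc _ _).1]
  exact (mul_le_of_le_one_left (abs_nonneg _) (hφ.mem_Icc _ _).2).trans (hB p)

instance isProbabilityMeasure_colourMeasure {q : ℕ} (φ : Fin q → unitInterval → ℝ)
    [h : Fact (IsFracPartition φ)] : IsProbabilityMeasure (colourMeasure φ) := by
  have hφ := h.out
  refine ⟨?_⟩
  rw [colourMeasure, withDensity_apply _ MeasurableSet.univ, Measure.restrict_univ,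
    lintegral_prod_symm _ hφ.measurable_uncurry.ennreal_ofReal.aemeasurable, lintegral_count,
    tsum_fintype, ← lintegral_finsetSum _ fun i _ => (hφ.measurable i).ennreal_ofReal]
  have : ∀ t, ∑ i, ENNReal.ofReal (φ i t) = 1 := fun t => by
    rw [← ENNReal.ofReal_sum_of_nonneg fun i _ => (hφ.mem_Icc i t).1, hφ.sum_eq_one,
      ENNReal.ofReal_one]
  simp [this]

/-- Forgetting the colours leaves a uniform point. This allows a vertex sample to be lifted to a
randomly coloured one. -/
theorem map_fst_colourMeasure {q : ℕ} {φ : Fin q → unitInterval → ℝ} (hφ : IsFracPartition φ) :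
    (colourMeasure φ).map Prod.fst = volume := by
  ext A hA
  have h0 := hφ.measurable_uncurry.ennreal_ofReal
  have h2 : ∀ i : Fin q, Measurable fun t => (Prod.fst ⁻¹' A).indicator
      (fun p : unitInterval × Fin q => ENNReal.ofReal (φ p.2 p.1)) (t, i) := fun i =>
    (h0.indicator (measurable_fst hA)).comp (measurable_id.prodMk measurable_const)
  rw [Measure.map_apply measurable_fst hA, colourMeasure,
    withDensity_apply _ (measurable_fst hA), ← lintegral_indicator (measurable_fst hA),
    lintegral_prod_symm _ (h0.indicator (measurable_fst hA)).aemeasurable, lintegral_count,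
    tsum_fintype, ← lintegral_finsetSum _ fun i _ => h2 i]
  have : ∀ t, ∑ i : Fin q, (Prod.fst ⁻¹' A).indicator
      (fun p : unitInterval × Fin q => ENNReal.ofReal (φ p.2 p.1)) (t, i) =
      A.indicator 1 t := fun t => by
    by_cases ht : t ∈ A
    · simp only [Set.indicator, Set.mem_preimage, ht, if_true]
      rw [← ENNReal.ofReal_sum_of_nonneg fun i _ => (hφ.mem_Icc i t).1, hφ.sum_eq_one,
        ENNReal.ofReal_one]
      rfl
    · simp [Set.indicator, ht]
  simp_rw [this]
  exact lintegral_indicator_one hA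

theorem pi_withDensity {Ω ι : Type*} [Fintype ι] [MeasurableSpace Ω] (β : Measure Ω)
    [IsFiniteMeasure β] {w : Ω → ℝ} (hw : Measurable w) (hw0 : ∀ x, 0 ≤ w x)
    (hw1 : ∀ x, w x ≤ 1) :
    (Measure.pi fun _ : ι => β.withDensity fun x => ENNReal.ofReal (w x))
      = (Measure.pi fun _ : ι => β).withDensity fun p => ENNReal.ofReal (∏ j, w (p j)) := by
  have hfin : IsFiniteMeasure (β.withDensity fun x => ENNReal.ofReal (w x)) := by
    refine isFiniteMeasure_withDensity_ofReal ?_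
    exact (integrable_of_abs_le hw (B := 1) fun x => by
      rw [abs_of_nonneg (hw0 x)]; exact hw1 x).2
  refine Measure.pi_eq fun s hs => ?_
  have hg : ∀ i, Measurable ((s i).indicator w) := fun i => hw.indicator (hs i)
  have hg0 : ∀ i x, 0 ≤ (s i).indicator w x := fun i x => Set.indicator_nonneg (fun x _ => hw0 x) x
  have hg1 : ∀ i x, |(s i).indicator w x| ≤ 1 := fun i x => by
    rw [abs_of_nonneg (hg0 i x)]
    exact Set.indicator_le' (fun x _ => hw1 x) (fun _ _ => zero_le_one) x
  have hprod : Measurable fun p : ι → Ω => ∏ j, (s j).indicator w (p j) :=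
    Finset.measurable_prod _ fun j _ => (hg j).comp (measurable_pi_apply j)
  rw [withDensity_apply _ (MeasurableSet.univ_pi hs),
    ← lintegral_indicator (MeasurableSet.univ_pi hs)]
  have h1 : ∀ p : ι → Ω, (Set.univ.pi s).indicator
      (fun p => ENNReal.ofReal (∏ j, w (p j))) p
        = ENNReal.ofReal (∏ j, (s j).indicator w (p j)) := fun p => by
    by_cases hp : p ∈ Set.univ.pi s
    · rw [Set.indicator_of_mem hp]
      congr 1
      exact Finset.prod_congr rfl fun j _ =>
        (Set.indicator_of_mem (hp j (Set.mem_univ j)) w).symm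
    · rw [Set.indicator_of_notMem hp]
      simp only [Set.mem_pi, Set.mem_univ, true_imp_iff, not_forall] at hp
      obtain ⟨j, hj⟩ := hp
      rw [Finset.prod_eq_zero (Finset.mem_univ j) (Set.indicator_of_notMem hj w),
        ENNReal.ofReal_zero]
  simp_rw [h1]
  rw [← ofReal_integral_eq_lintegral_ofReal
      (integrable_of_abs_le hprod (B := 1) fun p => by
        rw [Finset.abs_prod]
        exact Finset.prod_le_one (fun _ _ => abs_nonneg _) fun j _ => hg1 j _)
      (Eventually.of_forall fun p => Finset.prod_nonneg fun j _ => hg0 j _),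
    integral_fintype_prod_eq_prod (μ := fun _ => β) (f := fun j => (s j).indicator w),
    ENNReal.ofReal_prod_of_nonneg fun j _ => integral_nonneg fun x => hg0 j x]
  refine Finset.prod_congr rfl fun j _ => ?_
  rw [ofReal_integral_eq_lintegral_ofReal (integrable_of_abs_le (hg j) (hg1 j))
    (Eventually.of_forall (hg0 j)), withDensity_apply _ (hs j), ← lintegral_indicator (hs j)]
  congr 1
  funext x
  by_cases hx : x ∈ s j <;> simp [hx]

theorem pi_count_eq {ι κ : Type*} [Fintype ι] [Fintype κ] [MeasurableSpace κ]
    [MeasurableSingletonClass κ] :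
    (Measure.pi fun _ : ι => (Measure.count : Measure κ)) = Measure.count := by
  refine (Measure.pi_eq fun s _ => ?_)
  classical
  have hfin : (Set.univ.pi s).Finite := Set.toFinite _
  rw [Measure.count_apply (Set.toFinite _).measurableSet]
  simp_rw [Measure.count_apply (Set.toFinite (s _)).measurableSet]
  simp only [Set.encard_eq_coe_toFinset_card]
  have : (Set.univ.pi s).toFinset = Fintype.piFinset fun i => (s i).toFinset := by
    ext; simp [Set.mem_pi]
  rw [this, Fintype.card_piFinset, ENat.toENNReal_coe, Nat.cast_prod]
  simp only [ENat.toENNReal_coe]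

theorem integral_pi_colourMeasure {q r : ℕ} {φ : Fin q → unitInterval → ℝ}
    (hφ : IsFracPartition φ) {G : (Fin r → unitInterval × Fin q) → ℝ} (hG : Measurable G)
    {B : ℝ} (hB : ∀ p, |G p| ≤ B) :
    ∫ p, G p ∂(Measure.pi fun _ => colourMeasure φ)
      = ∑ z : Fin r → Fin q, ∫ t : Fin r → unitInterval,
          G (fun j => (t j, z j)) * ∏ j, φ (z j) (t j) := by
  have hm := hφ.measurable_uncurry
  have hpm : Measurable fun p : Fin r → unitInterval × Fin q => ∏ j, φ (p j).2 (p j).1 :=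
    Finset.measurable_prod _ fun j _ => hm.comp (measurable_pi_apply j)
  have hp0 : ∀ p : Fin r → unitInterval × Fin q, 0 ≤ ∏ j, φ (p j).2 (p j).1 := fun p =>
    Finset.prod_nonneg fun j _ => (hφ.mem_Icc _ _).1
  have hp1 : ∀ p : Fin r → unitInterval × Fin q, ∏ j, φ (p j).2 (p j).1 ≤ 1 := fun p =>
    Finset.prod_le_one (fun j _ => (hφ.mem_Icc _ _).1) fun j _ => (hφ.mem_Icc _ _).2
  have h1 := pi_withDensity (ι := Fin r)
    ((volume : Measure unitInterval).prod (Measure.count : Measure (Fin q))) hm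
    (fun p => (hφ.mem_Icc _ _).1) (fun p => (hφ.mem_Icc _ _).2)
  unfold colourMeasure
  rw [h1, integral_withDensity_eq_integral_toReal_smul hpm.ennreal_ofReal
    (Eventually.of_forall fun _ => ENNReal.ofReal_lt_top)]
  have : ∀ p : Fin r → unitInterval × Fin q,
      (ENNReal.ofReal (∏ j, φ (p j).2 (p j).1)).toReal • G p
      = G p * ∏ j, φ (p j).2 (p j).1 := fun p => by
    rw [ENNReal.toReal_ofReal (hp0 p), smul_eq_mul, mul_comm]
  simp_rw [this]
  have hmp := (measurePreserving_arrowProdEquivProdArrow unitInterval (Fin q) (Fin r)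
    (fun _ => volume) (fun _ => Measure.count)).symm
  rw [← hmp.integral_comp', pi_count_eq]
  refine integral_prod_count (Measure.pi fun _ => volume)
    (G := fun x => (fun p => G p * ∏ j, φ (p j).2 (p j).1)
      ((MeasurableEquiv.arrowProdEquivProdArrow unitInterval (Fin q) (Fin r)).symm x))
    (B := B) ?_ ?_
  · exact (hG.mul hpm).comp (MeasurableEquiv.measurable _)
  · intro p
    rw [abs_mul, abs_of_nonneg (hp0 _)]
    exact (mul_le_of_le_one_right (abs_nonneg _) (hp1 _)).trans (hB _)

theorem isFracPartition_const {q : ℕ} (hq : 1 ≤ q) :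
    IsFracPartition (fun (_ : Fin q) (_ : unitInterval) => (1 : ℝ) / q) := by
  have : (1 : ℝ) ≤ q := by exact_mod_cast hq
  refine ⟨fun _ => measurable_const, fun _ _ => ⟨by positivity, ?_⟩, fun _ => ?_⟩
  · rw [div_le_one (by linarith)]; exact this
  · simp; field_simp

/-- Every coloured-point measure is dominated by the one with uniform colours. -/
theorem integral_pi_colourMeasure_le {q r : ℕ} (hq : 1 ≤ q) {φ : Fin q → unitInterval → ℝ}
    (hφ : IsFracPartition φ) {G : (Fin r → unitInterval × Fin q) → ℝ} (hG : Measurable G)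
    (hG0 : ∀ p, 0 ≤ G p) {B : ℝ} (hB : ∀ p, |G p| ≤ B) :
    ∫ p, G p ∂(Measure.pi fun _ => colourMeasure φ)
      ≤ (q : ℝ) ^ r * ∫ p, G p ∂(Measure.pi fun _ =>
          colourMeasure fun (_ : Fin q) (_ : unitInterval) => (1 : ℝ) / q) := by
  rw [integral_pi_colourMeasure hφ hG hB,
    integral_pi_colourMeasure (isFracPartition_const hq) hG hB, Finset.mul_sum]
  refine Finset.sum_le_sum fun z _ => ?_
  rw [← integral_const_mul]
  have hq0 : (q : ℝ) ≠ 0 := by positivity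
  have hGz : Measurable fun t : Fin r → unitInterval => G fun j => (t j, z j) := by fun_prop
  refine integral_mono_of_nonneg (Eventually.of_forall fun t => ?_) ?_
    (Eventually.of_forall fun t => ?_)
  · exact mul_nonneg (hG0 _) (Finset.prod_nonneg fun j _ => (hφ.mem_Icc _ _).1)
  · exact ((integrable_of_abs_le hGz fun _ => hB _).mul_const _).const_mul _
  · have : ∏ j, φ (z j) (t j) ≤ 1 :=
      Finset.prod_le_one (fun j _ => (hφ.mem_Icc _ _).1) fun j _ => (hφ.mem_Icc _ _).2
    -- The constant density of the uniform colouring is q^-r, while the density of any fractional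
    -- partition is at most 1.
    have h2 : (q : ℝ) ^ r * (G (fun j => (t j, z j)) * ∏ _j : Fin r, (1 : ℝ) / q)
        = G fun j => (t j, z j) := by
      rw [Finset.prod_const, Finset.card_univ, Fintype.card_fin, one_div, inv_pow]
      field_simp
    dsimp only
    rw [h2]
    exact mul_le_of_le_one_right (hG0 _) this

/-! ### The expected colouring of a measurable selection -/

/-- The average colouring seen by a uniform vertex, as a fractional partition. -/
noncomputable def averageColouring {k q : ℕ} (sel : (Fin k → unitInterval) → Fin k → Fin q)
    (i : Fin q) (t : unitInterval) : ℝ :=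
  (∑ u, ∫ U : Fin k → unitInterval,
    {ω | sel ω u = i}.indicator (fun _ => (1 : ℝ)) (Function.update U u t)) / k

section
variable {k q : ℕ} {sel : (Fin k → unitInterval) → Fin k → Fin q}

theorem measurableSet_colour_eq (hsel : ∀ χ, MeasurableSet {ω | sel ω = χ}) (u : Fin k)
    (i : Fin q) : MeasurableSet {ω | sel ω u = i} := by
  classical
  have : {ω | sel ω u = i} = ⋃ χ ∈ (Finset.univ.filter fun χ : Fin k → Fin q => χ u = i),
      {ω | sel ω = χ} := by
    ext ω; simp
  rw [this]
  exact Finset.measurableSet_biUnion _ fun χ _ => hsel χ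

theorem measurable_colour_indicator (hsel : ∀ χ, MeasurableSet {ω | sel ω = χ}) (u : Fin k)
    (i : Fin q) : Measurable ({ω | sel ω u = i}.indicator (fun _ => (1 : ℝ))) :=
  measurable_const.indicator (measurableSet_colour_eq hsel u i)

theorem abs_colour_indicator_le (u : Fin k) (i : Fin q) (ω : Fin k → unitInterval) :
    |{ω | sel ω u = i}.indicator (fun _ => (1 : ℝ)) ω| ≤ 1 := by
  by_cases h : sel ω u = i <;> simp [h]

theorem sum_colour_indicator (u : Fin k) (F : Fin q → ℝ) (ω : Fin k → unitInterval) :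
    ∑ i, F i * {ω | sel ω u = i}.indicator (fun _ => (1 : ℝ)) ω = F (sel ω u) := by
  simp [Set.indicator_apply]

theorem measurable_integral_colour_indicator (hsel : ∀ χ, MeasurableSet {ω | sel ω = χ})
    (u : Fin k) (i : Fin q) : Measurable fun t : unitInterval => ∫ U : Fin k → unitInterval,
      {ω | sel ω u = i}.indicator (fun _ => (1 : ℝ)) (Function.update U u t) := by
  have h := (measurable_colour_indicator hsel u i).comp (measurable_update_pair u)
  exact (h.stronglyMeasurable.integral_prod_right' (ν := volume)).measurable

theorem integral_colour_indicator_mem_Icc (u : Fin k) (i : Fin q) (t : unitInterval) :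
    ∫ U : Fin k → unitInterval,
      {ω | sel ω u = i}.indicator (fun _ => (1 : ℝ)) (Function.update U u t) ∈ Set.Icc (0 : ℝ) 1 := by
  refine ⟨integral_nonneg fun U => Set.indicator_nonneg (fun _ _ => zero_le_one) _, ?_⟩
  exact (le_abs_self _).trans (abs_integral_le_of_abs_le fun U => abs_colour_indicator_le u i _)

theorem isFracPartition_averageColouring (hk : 0 < k)
    (hsel : ∀ χ, MeasurableSet {ω | sel ω = χ}) : IsFracPartition (averageColouring sel) := by
  have hkR : (0 : ℝ) < k := by exact_mod_cast hk
  refine ⟨fun i => ?_, fun i t => ⟨?_, ?_⟩, fun t => ?_⟩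
  · exact (Finset.measurable_sum _ fun u _ =>
      measurable_integral_colour_indicator hsel u i).div_const _
  · exact div_nonneg (Finset.sum_nonneg fun u _ =>
      (integral_colour_indicator_mem_Icc u i t).1) hkR.le
  · rw [averageColouring, div_le_one hkR]
    refine (Finset.sum_le_sum fun u _ => (integral_colour_indicator_mem_Icc u i t).2).trans ?_
    simp
  · unfold averageColouring
    rw [← Finset.sum_div, Finset.sum_comm]
    have : ∀ u : Fin k, ∑ i, ∫ U : Fin k → unitInterval,
        {ω | sel ω u = i}.indicator (fun _ => (1 : ℝ)) (Function.update U u t) = 1 := fun u => by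
      rw [← integral_finsetSum]
      · have := fun ω => sum_colour_indicator (sel := sel) u (fun _ => 1) ω
        simp only [one_mul] at this
        simp [this]
      · intro i _
        refine integrable_of_abs_le ?_ fun U => abs_colour_indicator_le u i _
        exact (measurable_colour_indicator hsel u i).comp measurable_update_left
    simp only [this]
    simp [hkR.ne']

/-- The selected colour of u may depend on the entire sample. Conditioning on the coordinate of u
alone turns it into a fractional colour, and a linear functional sees only this average. The
expected value on a random colouring is thus attained by a fractional partition. -/
theorem integral_colourMeasure_averageColouring (hk : 0 < k)
    (hsel : ∀ χ, MeasurableSet {ω | sel ω = χ}) {h : unitInterval × Fin q → ℝ}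
    (hh : Measurable h) {R : ℝ} (hR : ∀ p, |h p| ≤ R) :
    ∫ p, h p ∂(colourMeasure (averageColouring sel))
      = ∫ ω : Fin k → unitInterval, (∑ u, h (ω u, sel ω u)) / k := by
  have hkR : (0 : ℝ) < k := by exact_mod_cast hk
  have hR0 : 0 ≤ R := by
    obtain ⟨i⟩ : Nonempty (Fin q) := ⟨sel (fun _ => 0) ⟨0, hk⟩⟩
    exact (abs_nonneg _).trans (hR (0, i))
  rw [integral_colourMeasure (isFracPartition_averageColouring hk hsel) hh hR]
  have hsec : ∀ i, Measurable fun t => h (t, i) := fun i => by fun_prop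
  have hprodb : ∀ (x y : ℝ), |x| ≤ R → |y| ≤ 1 → |x * y| ≤ R := fun x y hx hy => by
    rw [abs_mul]; nlinarith [abs_nonneg x, abs_nonneg y]
  have h1 : ∀ (u : Fin k) (i : Fin q),
      ∫ ω : Fin k → unitInterval, h (ω u, i) * {ω | sel ω u = i}.indicator (fun _ => (1 : ℝ)) ω
      = ∫ t, h (t, i) * ∫ U : Fin k → unitInterval,
        {ω | sel ω u = i}.indicator (fun _ => (1 : ℝ)) (Function.update U u t) := by
    intro u i
    have hGm : Measurable fun ω : Fin k → unitInterval =>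
        h (ω u, i) * {ω | sel ω u = i}.indicator (fun _ => (1 : ℝ)) ω :=
      Measurable.mul (by fun_prop) (measurable_colour_indicator hsel u i)
    have := integral_update (volume : Measure unitInterval) u hGm (B := R)
      fun ω => hprodb _ _ (hR _) (abs_colour_indicator_le u i ω)
    refine this.trans ?_
    simp only [Function.update_self, integral_const_mul]
    rfl
  calc ∑ i, ∫ t, averageColouring sel i t * h (t, i)
      = ∑ i, ∫ t, ∑ u, (h (t, i) * ∫ U : Fin k → unitInterval,
        {ω | sel ω u = i}.indicator (fun _ => (1 : ℝ)) (Function.update U u t)) / k := by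
        refine Finset.sum_congr rfl fun i _ => ?_
        congr 1; funext t
        rw [averageColouring, ← Finset.sum_div, ← Finset.mul_sum]; ring
    _ = ∑ i, ∑ u, (∫ ω : Fin k → unitInterval,
          h (ω u, i) * {ω | sel ω u = i}.indicator (fun _ => (1 : ℝ)) ω) / k := by
        refine Finset.sum_congr rfl fun i _ => ?_
        rw [integral_finsetSum]
        · refine Finset.sum_congr rfl fun u _ => ?_
          rw [integral_div, h1]
        · intro u _
          refine Integrable.div_const (integrable_of_abs_le
            ((hsec i).mul (measurable_integral_colour_indicator hsel u i)) (B := R)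
              fun t => hprodb _ _ (hR _) ?_) _
          exact abs_integral_le_of_abs_le fun U => abs_colour_indicator_le u i _
    _ = ∫ ω : Fin k → unitInterval, ∑ u, ∑ i,
          (h (ω u, i) * {ω | sel ω u = i}.indicator (fun _ => (1 : ℝ)) ω) / k := by
        have hint : ∀ (u : Fin k) (i : Fin q), Integrable fun ω : Fin k → unitInterval =>
          (h (ω u, i) * {ω | sel ω u = i}.indicator (fun _ => (1 : ℝ)) ω) / k := fun u i =>
          Integrable.div_const (integrable_of_abs_le
            (Measurable.mul (by fun_prop) (measurable_colour_indicator hsel u i)) (B := R)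
            fun ω => hprodb _ _ (hR _) (abs_colour_indicator_le u i ω)) _
        rw [Finset.sum_comm, integral_finsetSum _ fun u _ => integrable_finsetSum _ fun i _ =>
          hint u i]
        refine Finset.sum_congr rfl fun u _ => ?_
        rw [integral_finsetSum _ fun i _ => hint u i]
        simp_rw [integral_div]
    _ = _ := by
        congr 1; funext ω
        rw [Finset.sum_div]
        refine Finset.sum_congr rfl fun u _ => ?_
        rw [← Finset.sum_div, sum_colour_indicator u (fun i => h (ω u, i)) ω]

theorem integral_averageColouring (hk : 0 < k) (hsel : ∀ χ, MeasurableSet {ω | sel ω = χ})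
    (i : Fin q) : ∫ t, averageColouring sel i t
      = ∫ ω : Fin k → unitInterval, (classSize (sel ω) i : ℝ) / k := by
  have h := integral_colourMeasure_averageColouring hk hsel
    (h := fun p => if p.2 = i then 1 else 0) (R := 1)
    ((measurable_of_countable (fun j : Fin q => if j = i then (1 : ℝ) else 0)).comp measurable_snd)
    (fun p => by split_ifs <;> simp)
  rw [integral_colourMeasure (G := fun p => if p.2 = i then 1 else 0) (B := 1) (isFracPartition_averageColouring hk hsel)
    ((measurable_of_countable (fun j : Fin q => if j = i then (1 : ℝ) else 0)).comp measurable_snd)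
    (fun p => by split_ifs <;> simp)] at h
  have h2 : ∀ j, ∫ t, averageColouring sel j t * (if j = i then (1 : ℝ) else 0)
      = if j = i then ∫ t, averageColouring sel j t else 0 := fun j => by
    split_ifs <;> simp
  simp only [h2, Finset.sum_ite_eq', Finset.mem_univ, if_true] at h
  rw [h]
  congr 1; funext ω
  simp [classSize]

end

/-- For a fixed linear functional, sampling does not lower its minimum by much. -/
theorem measureReal_exists_balanced_le {k q : ℕ} (hk : 0 < k) {a : Fin q → ℝ}
    (ha : a ∈ stdSimplex ℝ (Fin q)) {h : unitInterval × Fin q → ℝ} (hh : Measurable h)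
    {R : ℝ} (hR0 : 0 < R) (hR : ∀ p, |h p| ≤ R) {L s : ℝ}
    (hL : ∀ φ ∈ Omega a, L ≤ ∫ p, h p ∂(colourMeasure φ)) (hs : 0 ≤ s) (hks : R * q / k ≤ s / 2) :
    (volume : Measure (Fin k → unitInterval)).real
      {U | ∃ χ ∈ balanced k a, (∑ u, h (U u, χ u)) / k ≤ L - s}
      ≤ Real.exp (-(k * s ^ 2 / (32 * R ^ 2))) := by
  have hkR : (0 : ℝ) < k := by exact_mod_cast hk
  set G : (Fin k → Fin q) → (Fin k → unitInterval) → ℝ := fun χ U => (∑ u, h (U u, χ u)) / k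
    with hG
  have hGm : ∀ χ, Measurable (G χ) := fun χ => by fun_prop
  have hGb : ∀ χ U, |G χ U| ≤ R := fun χ U => by
    rw [hG]; dsimp only
    rw [abs_div, abs_of_pos hkR, div_le_iff₀ hkR]
    refine (Finset.abs_sum_le_sum_abs _ _).trans ((Finset.sum_le_sum fun u _ => hR _).trans ?_)
    simp [mul_comm]
  have hGd : ∀ χ i U t, |G χ (Function.update U i t) - G χ U| ≤ 2 * R / k := fun χ i U t => by
    rw [hG]; dsimp only
    rw [← sub_div, abs_div, abs_of_pos hkR, ← Finset.sum_sub_distrib,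
      Finset.sum_eq_single_of_mem i (Finset.mem_univ i)]
    · gcongr
      refine (abs_sub _ _).trans ?_
      linarith [hR (Function.update U i t i, χ i), hR (U i, χ i)]
    · intro u _ hu
      rw [Function.update_of_ne hu, sub_self]
  -- The minimum over all balanced colourings is treated as one random variable, which avoids a
  -- union bound over q^k colourings.
  obtain ⟨sel, h1, h2, h3⟩ := exists_measurable_argmin (balanced_nonempty hk ha) G hGm
  set V : (Fin k → unitInterval) → ℝ := fun U => G (sel U) U with hV
  have hVm : Measurable V := by
    have : V = fun U => ∑ χ, {ω | sel ω = χ}.indicator (G χ) U := by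
      funext U; simp [hV, Set.indicator_apply]
    rw [this]
    exact Finset.measurable_sum _ fun χ _ => (hGm χ).indicator (h3 χ)
  -- Two minima are compared by testing each minimiser on the other sample, so the minimum inherits
  -- the bounded differences of the individual functionals.
  have hVd : ∀ i U t, |V (Function.update U i t) - V U| ≤ 2 * R / k := fun i U t => by
    have e1 := h2 (Function.update U i t) (sel U) (h1 U)
    have e2 := h2 U (sel (Function.update U i t)) (h1 _)
    have e3 := abs_le.1 (hGd (sel U) i U t)
    have e4 := abs_le.1 (hGd (sel (Function.update U i t)) i U t)
    rw [abs_le]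
    constructor <;> simp only [hV] <;> linarith [e3.1, e3.2, e4.1, e4.2]
  have hφ := isFracPartition_averageColouring hk h3
  -- The mean is the functional at the average colouring, whose class sizes are within 1/k of a.
  -- Moving it into `Omega a` costs at most q/k in L¹, hence R q/k ≤ s/2 in value. The other half of
  -- s is left for concentration.
  have hmean : L - s / 2 ≤ ∫ U, V U := by
    obtain ⟨ψ, hψ, hd⟩ := hφ.exists_omega_near ha
    have e1 := integral_colourMeasure_averageColouring hk h3 hh hR
    rw [integral_colourMeasure hφ hh hR] at e1
    have e2 := hL ψ hψ
    rw [integral_colourMeasure hψ.1 hh hR] at e2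
    have e3 : ∑ i, |(∫ t, averageColouring sel i t) - a i| ≤ q / k := by
      calc _ ≤ ∑ i : Fin q, 1 / (k : ℝ) := by
            refine Finset.sum_le_sum fun i _ => ?_
            rw [integral_averageColouring hk h3]
            have hm : Measurable fun ω => (classSize (sel ω) i : ℝ) / k := by
              have : (fun ω => (classSize (sel ω) i : ℝ) / k) = fun ω => ∑ χ,
                  {ω | sel ω = χ}.indicator (fun _ => (classSize χ i : ℝ) / k) ω := by
                funext U; simp [Set.indicator_apply]
              rw [this]
              exact Finset.measurable_sum _ fun χ _ => measurable_const.indicator (h3 χ)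
            have hb : ∀ ω, |(classSize (sel ω) i : ℝ) / k - a i| ≤ 1 / k := fun ω => by
              have := h1 ω
              simp only [balanced, Finset.mem_filter] at this
              exact this.2 i
            have hint : Integrable fun ω => (classSize (sel ω) i : ℝ) / k := by
              refine integrable_of_abs_le hm (B := 1 / k + |a i|) fun ω => ?_
              have := abs_add_le ((classSize (sel ω) i : ℝ) / k - a i) (a i)
              rw [sub_add_cancel] at this
              linarith [hb ω]
            have : (∫ ω, (classSize (sel ω) i : ℝ) / k) - a i
                = ∫ ω, ((classSize (sel ω) i : ℝ) / k - a i) := by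
              rw [integral_sub hint (integrable_const _)]; simp
            rw [this]
            exact abs_integral_le_of_abs_le hb
        _ = q / k := by simp; rfl
    have e4 : (∑ i, ∫ t, ψ i t * h (t, i)) - ∑ i, ∫ t, averageColouring sel i t * h (t, i)
        ≤ R * ∑ i, ∫ t, |averageColouring sel i t - ψ i t| := by
      rw [← Finset.sum_sub_distrib, Finset.mul_sum]
      refine Finset.sum_le_sum fun i _ => ?_
      have hmul : ∀ φ : Fin q → unitInterval → ℝ, IsFracPartition φ →
          Integrable fun t => φ i t * h (t, i) := fun φ hφ =>
        integrable_of_abs_le ((hφ.measurable i).mul (by fun_prop)) (B := R) fun t => by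
          rw [abs_mul, abs_of_nonneg (hφ.mem_Icc i t).1]
          exact (mul_le_of_le_one_left (abs_nonneg _) (hφ.mem_Icc i t).2).trans (hR _)
      rw [← integral_sub (hmul ψ hψ.1) (hmul _ hφ), ← integral_const_mul]
      refine integral_mono ((hmul ψ hψ.1).sub (hmul _ hφ))
        (((hφ.integrable i).sub (hψ.1.integrable i)).abs.const_mul R) fun t => ?_
      dsimp only
      rw [← sub_mul]
      refine (le_abs_self _).trans ?_
      rw [abs_mul, abs_sub_comm, mul_comm]
      exact mul_le_mul_of_nonneg_right (hR _) (abs_nonneg _)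
    have e5 : R * ∑ i, ∫ t, |averageColouring sel i t - ψ i t| ≤ R * (q / k) := by
      gcongr; exact hd.trans e3
    have e6 : R * (q / k) = R * q / k := by ring
    have e7 : ∫ U, V U = ∑ i, ∫ t, averageColouring sel i t * h (t, i) := e1.symm
    have e8 : ∑ i, ∫ t, ψ i t * h (t, i) ≤ (∑ i, ∫ t, averageColouring sel i t * h (t, i))
      + R * q / k := by linarith
    linarith
  have hmc := measureReal_le_le_of_boundedDifferences (volume : Measure unitInterval)
    (c := fun _ : Fin k => 2 * R / k) (V := 4 * R ^ 2 / k) (s := s / 2) hVm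
    (fun U => hGb (sel U) U) hVd (by positivity) (by
      simp only [Finset.sum_const, Finset.card_univ, Fintype.card_fin, nsmul_eq_mul]
      apply le_of_eq; field_simp; ring) (by linarith)
  refine le_trans (measureReal_mono ?_ (measure_ne_top _ _)) (hmc.trans (le_of_eq ?_))
  · rintro U ⟨χ, hχ, hle⟩
    have := h2 U χ hχ
    have e : ∫ y, V y ∂(Measure.pi fun _ => (volume : Measure unitInterval)) = ∫ U, V U := rfl
    simp only [Set.mem_ofPred_eq]
    rw [e]
    simp only [hV]
    simp only [hG] at this hmean ⊢
    linarith
  · congr 1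
    field_simp
    ring

/-! ### Empirical measures -/

/-- The uniform probability measure on `[k]`. -/
noncomputable def unif (k : ℕ) : Measure (Fin k) := (k : ENNReal)⁻¹ • Measure.count

theorem isProbabilityMeasure_unif {k : ℕ} (hk : 0 < k) : IsProbabilityMeasure (unif k) := by
  refine ⟨?_⟩
  rw [unif, Measure.smul_apply, Measure.count_univ, smul_eq_mul]
  simp only [ENat.card_eq_coe_fintype_card, Fintype.card_fin, ENat.toENNReal_coe]
  exact ENNReal.inv_mul_cancel (by exact_mod_cast hk.ne') (ENNReal.natCast_ne_top k)

theorem integral_unif {k : ℕ} (a : Fin k → ℝ) : ∫ u, a u ∂(unif k) = (∑ u, a u) / k := by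
  rw [unif, integral_smul_measure, integral_fintype .of_finite]
  have h : ∀ u : Fin k, (Measure.count : Measure (Fin k)).real {u} = 1 := fun u => by
    simp [measureReal_def]
  simp only [h, one_mul, ENNReal.toReal_inv, ENNReal.toReal_natCast, smul_eq_mul]
  rw [inv_mul_eq_div]

/-- The empirical measure of a finite family of points. -/
noncomputable def emp {X : Type*} [MeasurableSpace X] {k : ℕ} (P : Fin k → X) : Measure X :=
  (unif k).map P

section
variable {X : Type*} [MeasurableSpace X]

theorem isProbabilityMeasure_emp {k : ℕ} (hk : 0 < k) (P : Fin k → X) :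
    IsProbabilityMeasure (emp P) := by
  have := isProbabilityMeasure_unif hk
  exact Measure.isProbabilityMeasure_map (measurable_of_countable P).aemeasurable

theorem integral_emp {k : ℕ} (P : Fin k → X) {G : X → ℝ} (hG : Measurable G) :
    ∫ x, G x ∂(emp P) = (∑ u, G (P u)) / k := by
  rw [emp, integral_map (measurable_of_countable P).aemeasurable hG.aestronglyMeasurable,
    integral_unif]

theorem integral_pi_emp {k r : ℕ} (hk : 0 < k) (P : Fin k → X) {G : (Fin r → X) → ℝ}
    (hG : Measurable G) : ∫ x, G x ∂(Measure.pi fun _ => emp P)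
      = (∑ n : Fin r → Fin k, G fun j => P (n j)) / (k : ℝ) ^ r := by
  have := isProbabilityMeasure_unif hk
  have := isProbabilityMeasure_emp hk P
  unfold emp
  rw [← Measure.pi_map_pi (fun _ => (measurable_of_countable P).aemeasurable),
    integral_map (measurable_of_countable _).aemeasurable hG.aestronglyMeasurable,
    integral_fintype .of_finite, Finset.sum_div]
  refine Finset.sum_congr rfl fun n _ => ?_
  rw [measureReal_def, Measure.pi_singleton, ENNReal.toReal_prod]
  simp only [unif, Measure.smul_apply, Measure.count_singleton, smul_eq_mul, mul_one,
    ENNReal.toReal_inv, ENNReal.toReal_natCast, Finset.prod_const, Finset.card_univ,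
    Fintype.card_fin]
  rw [inv_pow]; ring

end

/-! ### Kernels averaged over seeds -/

section
variable {X : Type*} {r m : ℕ} {F : (Fin r → X) → ℝ}

/-- The function `F` with its first `n` arguments averaged over the seeds `p`. -/
noncomputable def seedKernel (F : (Fin r → X) → ℝ) (p : Fin r → Fin m → X) :
    ℕ → (Fin r → X) → ℝ
  | 0 => F
  | n + 1 => fun x => if h : n < r then
      (∑ i, seedKernel F p n (Function.update x ⟨n, h⟩ (p ⟨n, h⟩ i))) / m
    else seedKernel F p n x

theorem seedKernel_succ (p : Fin r → Fin m → X) (j : Fin r) (x : Fin r → X) :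
    seedKernel F p (j + 1) x
      = (∑ i, seedKernel F p j (Function.update x j (p j i))) / m := by
  simp [seedKernel]

theorem abs_average_le {m : ℕ} {a : Fin m → ℝ} (ha : ∀ i, |a i| ≤ 1) : |(∑ i, a i) / m| ≤ 1 := by
  rw [abs_div, Nat.abs_cast]
  refine div_le_one_of_le₀ ?_ (Nat.cast_nonneg m)
  refine (Finset.abs_sum_le_sum_abs _ _).trans ((Finset.sum_le_sum fun i _ => ha i).trans ?_)
  simp

theorem abs_seedKernel_le (hF : ∀ x, |F x| ≤ 1) (p : Fin r → Fin m → X) (n : ℕ) :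
    ∀ x, |seedKernel F p n x| ≤ 1 := by
  induction n with
  | zero => exact hF
  | succ n ih =>
    intro x
    simp only [seedKernel]
    split_ifs
    · exact abs_average_le fun i => ih _
    · exact ih x

/-- The n-th kernel ignores the seeds of later arguments, so these seeds can be chosen one argument
at a time. -/
theorem seedKernel_congr {p p' : Fin r → Fin m → X} (n : ℕ)
    (h : ∀ j : Fin r, (j : ℕ) < n → p j = p' j) : seedKernel F p n = seedKernel F p' n := by
  induction n with
  | zero => rfl
  | succ n ih =>
    have ih := ih fun j hj => h j (by omega)
    funext x
    simp only [seedKernel, ih]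
    split_ifs with hn
    · rw [h ⟨n, hn⟩ (by simp)]
    · rfl

/-- An averaged argument no longer matters. In particular the kernel at stage r is a constant, the
energy predicted by the seeds. -/
theorem seedKernel_eq_of_agree (p : Fin r → Fin m → X) (n : ℕ) :
    ∀ x y : Fin r → X, (∀ j : Fin r, n ≤ (j : ℕ) → x j = y j) →
      seedKernel F p n x = seedKernel F p n y := by
  induction n with
  | zero => intro x y h; rw [funext fun j => h j (Nat.zero_le _)]
  | succ n ih =>
    intro x y h
    simp only [seedKernel]
    split_ifs with hn
    · congr 1
      refine Finset.sum_congr rfl fun i _ => ih _ _ fun j hj => ?_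
      by_cases hjn : j = ⟨n, hn⟩
      · subst hjn; simp
      · rw [Function.update_of_ne hjn, Function.update_of_ne hjn]
        refine h j ?_
        have : (j : ℕ) ≠ n := fun h => hjn (Fin.ext h)
        omega
    · refine ih _ _ fun j _ => absurd j.2 (by omega)

end

section
variable {X : Type*} [MeasurableSpace X] {r m : ℕ} {F : (Fin r → X) → ℝ}

theorem measurable_update_of {Ω : Type*} [MeasurableSpace Ω] {ι : Type*} [DecidableEq ι]
    {f : Ω → ι → X} (hf : Measurable f) (j : ι) {g : Ω → X} (hg : Measurable g) :
    Measurable fun ω => Function.update (f ω) j (g ω) :=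
  (measurable_update_pair j).comp (hg.prodMk hf)

theorem measurable_seedKernel (hF : Measurable F) (n : ℕ) :
    Measurable fun y : (Fin r → Fin m → X) × (Fin r → X) => seedKernel F y.1 n y.2 := by
  induction n with
  | zero => exact hF.comp measurable_snd
  | succ n ih =>
    simp only [seedKernel]
    split_ifs with h
    · refine (Finset.measurable_sum _ fun i _ => ?_).div_const _
      exact ih.comp (measurable_fst.prodMk
        (measurable_update_of measurable_snd _ (by fun_prop)))
    · exact ih

theorem measurable_seedKernel_right (hF : Measurable F) (p : Fin r → Fin m → X) (n : ℕ) :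
    Measurable (seedKernel F p n) :=
  (measurable_seedKernel hF n).comp (measurable_const.prodMk measurable_id)

/-- The effect of replacing, in the `j`-th argument, the measure `μ` by the seeds `p j`. -/
noncomputable def seedDeviation (F : (Fin r → X) → ℝ) (μ : Measure X) (p : Fin r → Fin m → X)
    (j : Fin r) (x : Fin r → X) : ℝ :=
  (∫ t, seedKernel F p j (Function.update x j t) ∂μ) - seedKernel F p (j + 1) x

theorem measurable_integral_update (hF : Measurable F) (μ : Measure X) [SFinite μ]
    (p : Fin r → Fin m → X) (j : Fin r) (n : ℕ) :
    Measurable fun x => ∫ t, seedKernel F p n (Function.update x j t) ∂μ := by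
  have h : Measurable fun y : (Fin r → X) × X => seedKernel F p n (Function.update y.1 j y.2) :=
    (measurable_seedKernel_right hF p n).comp
      (measurable_update_of measurable_fst j measurable_snd)
  exact (h.stronglyMeasurable.integral_prod_right' (ν := μ)).measurable

theorem measurable_seedDeviation (hF : Measurable F) (μ : Measure X) [SFinite μ]
    (p : Fin r → Fin m → X) (j : Fin r) : Measurable (seedDeviation F μ p j) :=
  (measurable_integral_update hF μ p j j).sub (measurable_seedKernel_right hF p _)

theorem abs_seedDeviation_le (hF1 : ∀ x, |F x| ≤ 1) (μ : Measure X) [IsProbabilityMeasure μ]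
    (p : Fin r → Fin m → X) (j : Fin r) (x : Fin r → X) : |seedDeviation F μ p j x| ≤ 2 := by
  refine (abs_sub _ _).trans ?_
  have h1 := abs_integral_le_of_abs_le (μ := μ)
    (fun t => abs_seedKernel_le hF1 p j (Function.update x j t))
  have h2 := abs_seedKernel_le hF1 p (j + 1) x
  linarith

/-- Replacing a measure by seeds in all arguments, one after the other. -/
theorem abs_integral_pi_sub_seedKernel_le (hF : Measurable F) (hF1 : ∀ x, |F x| ≤ 1)
    (μ : Measure X) [IsProbabilityMeasure μ] (p : Fin r → Fin m → X) (x₀ : Fin r → X) :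
    |(∫ x, F x ∂(Measure.pi fun _ => μ)) - seedKernel F p r x₀|
      ≤ ∑ j, ∫ x, |seedDeviation F μ p j x| ∂(Measure.pi fun _ => μ) := by
  have hm := fun n => measurable_seedKernel_right (F := F) hF p n
  have hb := fun n => abs_seedKernel_le hF1 p n
  have hconst : ∫ x, seedKernel F p r x ∂(Measure.pi fun _ => μ) = seedKernel F p r x₀ := by
    have : ∀ x, seedKernel F p r x = seedKernel F p r x₀ := fun x =>
      seedKernel_eq_of_agree p r x x₀ fun j hj => absurd j.2 (by omega)
    simp [this]
  have hstep : ∀ j : Fin r, (∫ x, seedKernel F p j x ∂(Measure.pi fun _ => μ))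
      - ∫ x, seedKernel F p (j + 1) x ∂(Measure.pi fun _ => μ)
      = ∫ x, seedDeviation F μ p j x ∂(Measure.pi fun _ => μ) := by
    intro j
    rw [integral_update' μ j (hm j) (hb j), ← integral_sub]
    · rfl
    · exact integrable_of_abs_le (measurable_integral_update hF μ p j j) (B := 1)
        fun x => abs_integral_le_of_abs_le fun t => hb _ _
    · exact integrable_of_abs_le (hm _) (hb _)
  -- The integrals of successive kernels telescope from F to the constant final kernel.
  have htel : (∫ x, F x ∂(Measure.pi fun _ => μ)) - seedKernel F p r x₀
      = ∑ j : Fin r, ∫ x, seedDeviation F μ p j x ∂(Measure.pi fun _ => μ) := by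
    rw [← hconst]
    have := Finset.sum_range_sub' (fun n => ∫ x, seedKernel F p n x ∂(Measure.pi fun _ => μ)) r
    rw [← Fin.sum_univ_eq_sum_range (fun n => (∫ x, seedKernel F p n x ∂(Measure.pi fun _ => μ))
      - ∫ x, seedKernel F p (n + 1) x ∂(Measure.pi fun _ => μ))] at this
    rw [← Finset.sum_congr rfl fun j _ => hstep j, this]
    rfl
  rw [htel]
  refine (Finset.abs_sum_le_sum_abs _ _).trans (Finset.sum_le_sum fun j _ => ?_)
  exact abs_integral_le_integral_abs

/-- First-moment method. For m indices drawn uniformly from [k], the expected L¹ error is at most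
1/√m under each of the two measures, so some choice keeps the sum of the errors below 2/√m. -/
theorem exists_seed_average {k : ℕ} (hk : 0 < k) (hm : 0 < m) {G : (Fin r → X) → ℝ}
    (hG : Measurable G) (hG1 : ∀ x, |G x| ≤ 1) (P : Fin k → X) (j : Fin r)
    (ν₁ ν₂ : Measure (Fin r → X)) [IsProbabilityMeasure ν₁] [IsProbabilityMeasure ν₂] :
    ∃ s : Fin m → Fin k,
      (∫ x, |(∫ t, G (Function.update x j t) ∂(emp P))
        - (∑ i, G (Function.update x j (P (s i)))) / m| ∂ν₁)
      + (∫ x, |(∫ t, G (Function.update x j t) ∂(emp P))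
        - (∑ i, G (Function.update x j (P (s i)))) / m| ∂ν₂) ≤ 2 / √m := by
  have := isProbabilityMeasure_unif hk
  set D : (Fin m → Fin k) → (Fin r → X) → ℝ := fun s x =>
    |(∫ t, G (Function.update x j t) ∂(emp P))
        - (∑ i, G (Function.update x j (P (s i)))) / m| with hD
  have hGu : ∀ x : Fin r → X, Measurable fun t => G (Function.update x j t) := fun x =>
    hG.comp (measurable_update x)
  have hDe : ∀ s x, D s x = |(∑ u, G (Function.update x j (P u))) / k
      - (∑ i, G (Function.update x j (P (s i)))) / m| := fun s x => by
    simp only [hD, integral_emp P (hGu x)]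
  have hup : ∀ t, Measurable fun x : Fin r → X => G (Function.update x j t) := fun t =>
    hG.comp (measurable_update_of measurable_id j measurable_const)
  have hDm : ∀ s, Measurable (D s) := fun s => by
    rw [funext (hDe s)]; fun_prop
  have hDb : ∀ s x, |D s x| ≤ 2 := fun s x => by
    rw [hDe, abs_abs]
    refine (abs_sub _ _).trans ?_
    have h1 := abs_average_le fun u => hG1 (Function.update x j (P u))
    have h2 := abs_average_le fun i => hG1 (Function.update x j (P (s i)))
    linarith
  have hDpair : Measurable fun y : (Fin m → Fin k) × (Fin r → X) => D y.1 y.2 :=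
    measurable_from_prod_countable_right fun s => hDm s
  have hpt : ∀ x, ∫ s, D s x ∂(Measure.pi fun _ => unif k) ≤ 1 / √m := fun x => by
    have := integral_abs_average_sub_le (unif k) (a := fun u => G (Function.update x j (P u)))
      (measurable_of_countable _) (fun u => hG1 _) hm
    rw [integral_unif] at this
    refine le_of_eq_of_le ?_ this
    congr 1; funext s
    rw [hDe, abs_sub_comm]
  have hν : ∀ (ν : Measure (Fin r → X)) [IsProbabilityMeasure ν],
      ∫ s, ∫ x, D s x ∂ν ∂(Measure.pi fun _ => unif k) ≤ 1 / √m := by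
    intro ν _
    rw [integral_integral_swap (integrable_of_abs_le hDpair fun y => hDb _ _)]
    calc _ ≤ ∫ _x, 1 / √m ∂ν := by
          refine integral_mono ?_ (integrable_const _) hpt
          exact (integrable_of_abs_le hDpair (μ := (Measure.pi fun _ => unif k).prod ν)
            fun y => hDb _ _).integral_prod_right
      _ = 1 / √m := by simp
  obtain ⟨s, hs⟩ := exists_le_integral (μ := Measure.pi fun _ : Fin m => unif k)
    (f := fun s => (∫ x, D s x ∂ν₁) + ∫ x, D s x ∂ν₂) .of_finite
  refine ⟨s, hs.trans ?_⟩
  rw [integral_add .of_finite .of_finite]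
  have e : 2 / √(m : ℝ) = 1 / √m + 1 / √m := by ring
  rw [e]
  exact add_le_add (hν ν₁) (hν ν₂)

/-- Seeds drawn from a finite family represent its empirical measure. -/
theorem exists_seeds {k : ℕ} (hk : 0 < k) (hm : 0 < m) (hF : Measurable F)
    (hF1 : ∀ x, |F x| ≤ 1) (P : Fin k → X)
    (ν₁ ν₂ : Measure (Fin r → X)) [IsProbabilityMeasure ν₁] [IsProbabilityMeasure ν₂] :
    ∃ s : Fin r → Fin m → Fin k, ∀ j,
      ∫ x, |seedDeviation F (emp P) (fun l i => P (s l i)) j x| ∂ν₁ ≤ 2 / √m ∧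
      ∫ x, |seedDeviation F (emp P) (fun l i => P (s l i)) j x| ∂ν₂ ≤ 2 / √m := by
  -- The deviation in argument j involves only the seeds of arguments up to j, so choosing later
  -- seeds does not spoil bounds already obtained.
  have key : ∀ n, n ≤ r → ∃ s : Fin r → Fin m → Fin k, ∀ j : Fin r, (j : ℕ) < n →
      (∫ x, |seedDeviation F (emp P) (fun l i => P (s l i)) j x| ∂ν₁) +
      ∫ x, |seedDeviation F (emp P) (fun l i => P (s l i)) j x| ∂ν₂ ≤ 2 / √m := by
    intro n
    induction n with
    | zero => exact fun _ => ⟨fun _ _ => ⟨0, hk⟩, fun j hj => absurd hj (Nat.not_lt_zero _)⟩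
    | succ n ih =>
      intro hn
      obtain ⟨s, hs⟩ := ih (by omega)
      obtain ⟨s', hs'⟩ := exists_seed_average hk hm
        (measurable_seedKernel_right hF (fun l i => P (s l i)) n)
        (abs_seedKernel_le hF1 _ n) P ⟨n, hn⟩ ν₁ ν₂
      have hagree : ∀ l : Fin r, (l : ℕ) < n →
          (fun i => P (Function.update s ⟨n, hn⟩ s' l i)) = fun i => P (s l i) := by
        intro l hl
        rw [Function.update_of_ne]
        rintro rfl
        exact lt_irrefl _ hl
      refine ⟨Function.update s ⟨n, hn⟩ s', fun j hj => ?_⟩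
      rcases Nat.lt_succ_iff_lt_or_eq.1 hj with hj | hj
      · have e : seedDeviation F (emp P) (fun l i => P (Function.update s ⟨n, hn⟩ s' l i)) j
            = seedDeviation F (emp P) (fun l i => P (s l i)) j := by
          funext x
          unfold seedDeviation
          rw [seedKernel_congr (p := fun l i => P (Function.update s ⟨n, hn⟩ s' l i)) (j : ℕ)
              fun l hl => hagree l (by omega),
            seedKernel_congr (p := fun l i => P (Function.update s ⟨n, hn⟩ s' l i)) (j + 1 : ℕ)
              fun l hl => hagree l (by omega)]
        rw [e]
        exact hs j hj
      · have hjn : j = ⟨n, hn⟩ := Fin.ext hj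
        subst hjn
        have e : ∀ x, seedDeviation F (emp P)
            (fun l i => P (Function.update s ⟨n, hn⟩ s' l i)) ⟨n, hn⟩ x
            = (∫ t, seedKernel F (fun l i => P (s l i)) n
                (Function.update x ⟨n, hn⟩ t) ∂(emp P))
              - (∑ i, seedKernel F (fun l i => P (s l i)) n
                (Function.update x ⟨n, hn⟩ (P (s' i)))) / m := by
          intro x
          unfold seedDeviation
          rw [seedKernel_succ]
          simp only [Function.update_self]
          rw [seedKernel_congr (p := fun l i => P (Function.update s ⟨n, hn⟩ s' l i)) n hagree]
        simp only [e]
        exact hs'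
  obtain ⟨s, hs⟩ := key r le_rfl
  refine ⟨s, fun j => ?_⟩
  have h := hs j j.2
  have h1 : 0 ≤ ∫ x, |seedDeviation F (emp P) (fun l i => P (s l i)) j x| ∂ν₁ :=
    integral_nonneg fun _ => abs_nonneg _
  have h2 : 0 ≤ ∫ x, |seedDeviation F (emp P) (fun l i => P (s l i)) j x| ∂ν₂ :=
    integral_nonneg fun _ => abs_nonneg _
  constructor <;> linarith

/-- A bounded weight on the deviations acts as a linear functional of the measure. -/
theorem exists_linear_functional (hF : Measurable F) (hF1 : ∀ x, |F x| ≤ 1) (hr : 0 < r)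
    (p : Fin r → Fin m → X) (κ : Measure (Fin r → X)) [IsProbabilityMeasure κ]
    {g : Fin r × (Fin r → X) → ℝ} (hg : Measurable g) (hg1 : ∀ y, |g y| ≤ 1) :
    ∃ (h : X → ℝ) (b : ℝ), Measurable h ∧ (∀ t, |h t| ≤ 1) ∧
      ∀ (μ : Measure X) [IsProbabilityMeasure μ],
        ∫ y, g y * seedDeviation F μ p y.1 y.2 ∂((unif r).prod κ) = ∫ t, h t ∂μ - b := by
  have := isProbabilityMeasure_unif hr
  have hmul : ∀ (x y : ℝ), |x| ≤ 1 → |y| ≤ 1 → |x * y| ≤ 1 := fun x y hx hy => by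
    rw [abs_mul]; nlinarith [abs_nonneg x, abs_nonneg y]
  have hK : Measurable fun w : (Fin r × (Fin r → X)) × X =>
      seedKernel F p w.1.1 (Function.update w.1.2 w.1.1 w.2) := by
    have h1 : Measurable fun w : Fin r × ((Fin r → X) × X) =>
        seedKernel F p w.1 (Function.update w.2.1 w.1 w.2.2) :=
      measurable_from_prod_countable_right fun j =>
        (measurable_seedKernel_right hF p j).comp
          (measurable_update_of measurable_fst j measurable_snd)
    exact h1.comp (by fun_prop : Measurable fun w : (Fin r × (Fin r → X)) × X =>
      (w.1.1, (w.1.2, w.2)))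
  have hL : Measurable fun y : Fin r × (Fin r → X) => seedKernel F p (y.1 + 1) y.2 :=
    measurable_from_prod_countable_right fun j => measurable_seedKernel_right hF p (j + 1)
  have hgK : Measurable fun w : (Fin r × (Fin r → X)) × X =>
      g w.1 * seedKernel F p w.1.1 (Function.update w.1.2 w.1.1 w.2) :=
    (hg.comp measurable_fst).mul hK
  have hgKb : ∀ w : (Fin r × (Fin r → X)) × X,
      |g w.1 * seedKernel F p w.1.1 (Function.update w.1.2 w.1.1 w.2)| ≤ 1 := fun w =>
    hmul _ _ (hg1 _) (abs_seedKernel_le hF1 p _ _)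
  refine ⟨fun t => ∫ y, g y * seedKernel F p y.1 (Function.update y.2 y.1 t) ∂((unif r).prod κ),
    ∫ y, g y * seedKernel F p (y.1 + 1) y.2 ∂((unif r).prod κ), ?_, fun t => ?_, ?_⟩
  · exact (hgK.stronglyMeasurable.integral_prod_left' (μ := (unif r).prod κ)).measurable
  · exact abs_integral_le_of_abs_le fun y => hgKb (y, t)
  · intro μ _
    have hint := integrable_of_abs_le (μ := ((unif r).prod κ).prod μ) hgK hgKb
    have hint2 : Integrable (fun y : Fin r × (Fin r → X) => g y * seedKernel F p (y.1 + 1) y.2)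
        ((unif r).prod κ) :=
      integrable_of_abs_le (hg.mul hL) fun y => hmul _ _ (hg1 y) (abs_seedKernel_le hF1 p _ _)
    have hint3 := hint.integral_prod_left
    -- By Fubini the integral over μ moves outside the weight. Only the kernel averaged against μ
    -- depends on μ; the other term of the deviation becomes the constant b.
    rw [← integral_integral_swap hint, ← integral_sub hint3 hint2]
    congr 1; funext y
    dsimp only
    rw [seedDeviation, integral_const_mul]; ring

end

/-! ### The sampled energy does not exceed the graphon energy by much -/

theorem integral_unif_prod {r : ℕ} {Y : Type*} [MeasurableSpace Y] (hr : 0 < r) (κ : Measure Y)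
    [IsProbabilityMeasure κ] {G : Fin r × Y → ℝ} (hG : Measurable G) {B : ℝ}
    (hB : ∀ y, |G y| ≤ B) :
    ∫ y, G y ∂((unif r).prod κ) = (∑ j, ∫ x, G (j, x) ∂κ) / r := by
  have := isProbabilityMeasure_unif hr
  rw [integral_prod _ (integrable_of_abs_le hG hB), integral_unif]

/-- The deviation is affine in the measure, the coloured-point measure is affine in φ, and the
constraints defining `Omega a` are convex. This is the linearity that makes the minimax principle
applicable to an energy of degree r. -/
theorem convex_seedDeviation {q r m : ℕ} (a : Fin q → ℝ)
    {F : (Fin r → unitInterval × Fin q) → ℝ} (hF : Measurable F) (hF1 : ∀ x, |F x| ≤ 1)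
    (p : Fin r → Fin m → unitInterval × Fin q) :
    Convex ℝ ((fun (φ : Fin q → unitInterval → ℝ)
      (y : Fin r × (Fin r → unitInterval × Fin q)) =>
        seedDeviation F (colourMeasure φ) p y.1 y.2) '' Omega a) := by
  rintro _ ⟨φ, hφ, rfl⟩ _ ⟨ψ, hψ, rfl⟩ s t hs ht hst
  have hmix : IsFracPartition (fun i x => s * φ i x + t * ψ i x) := by
    have h1 := hφ.1.measurable
    have h2 := hψ.1.measurable
    refine ⟨fun i => by fun_prop, fun i x => ?_, fun x => ?_⟩
    · have e1 := hφ.1.mem_Icc i x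
      have e2 := hψ.1.mem_Icc i x
      exact ⟨add_nonneg (mul_nonneg hs e1.1) (mul_nonneg ht e2.1), by nlinarith [e1.2, e2.2]⟩
    · rw [Finset.sum_add_distrib, ← Finset.mul_sum, ← Finset.mul_sum, hφ.1.sum_eq_one,
        hψ.1.sum_eq_one]
      linarith
  refine ⟨fun i x => s * φ i x + t * ψ i x, ⟨hmix, fun i => ?_⟩, ?_⟩
  · rw [integral_add ((hφ.1.integrable i).const_mul s) ((hψ.1.integrable i).const_mul t),
      integral_const_mul, integral_const_mul, hφ.2 i, hψ.2 i, ← add_mul, hst, one_mul]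
  · funext y
    simp only [Pi.add_apply, Pi.smul_apply, smul_eq_mul, seedDeviation]
    set G : unitInterval × Fin q → ℝ := fun w => seedKernel F p y.1 (Function.update y.2 y.1 w)
      with hG
    have hGm : Measurable G :=
      (measurable_seedKernel_right hF p _).comp (measurable_update y.2)
    have hG1 : ∀ w, |G w| ≤ 1 := fun w => abs_seedKernel_le hF1 p _ _
    have hint : ∀ {φ : Fin q → unitInterval → ℝ}, IsFracPartition φ → ∀ i,
        Integrable fun x => φ i x * G (x, i) := fun hφ i =>
      (integrable_of_abs_le (by fun_prop) fun x => hG1 (x, i)).bdd_mul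
        (hφ.measurable i).aestronglyMeasurable (c := 1) (Eventually.of_forall fun x => by
          rw [Real.norm_eq_abs, abs_of_nonneg (hφ.mem_Icc i x).1]; exact (hφ.mem_Icc i x).2)
    rw [integral_colourMeasure hmix hGm hG1, integral_colourMeasure hφ.1 hGm hG1,
      integral_colourMeasure hψ.1 hGm hG1]
    have : ∑ i, ∫ x, (s * φ i x + t * ψ i x) * G (x, i)
        = s * (∑ i, ∫ x, φ i x * G (x, i)) + t * ∑ i, ∫ x, ψ i x * G (x, i) := by
      rw [Finset.mul_sum, Finset.mul_sum, ← Finset.sum_add_distrib]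
      refine Finset.sum_congr rfl fun i _ => ?_
      rw [← integral_const_mul, ← integral_const_mul,
        ← integral_add ((hint hφ.1 i).const_mul s) ((hint hψ.1 i).const_mul t)]
      congr 1; funext x; ring
    rw [this]
    have e : s = 1 - t := by linarith
    subst e; ring

/-- The coloured-point measure with uniform colours. -/
noncomputable def uniformColour (q : ℕ) : Measure (unitInterval × Fin q) :=
  colourMeasure fun (_ : Fin q) (_ : unitInterval) => (1 : ℝ) / q

theorem isProbabilityMeasure_uniformColour {q : ℕ} (hq : 1 ≤ q) :
    IsProbabilityMeasure (uniformColour q) := by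
  have : Fact (IsFracPartition (fun (_ : Fin q) (_ : unitInterval) => (1 : ℝ) / q)) :=
    ⟨isFracPartition_const hq⟩
  unfold uniformColour
  infer_instance

/-- If the seeds predict too large an energy, some linear functional certifies that they are not
representative of any fractional partition. -/
theorem exists_separating_functional {q r m : ℕ} (hr : 0 < r) (hq : 1 ≤ q) {a : Fin q → ℝ}
    {F : (Fin r → unitInterval × Fin q) → ℝ} (hF : Measurable F) (hF1 : ∀ x, |F x| ≤ 1)
    (p : Fin r → Fin m → unitInterval × Fin q) {E ε : ℝ} (hε : 0 < ε) (hε1 : ε ≤ 1)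
    (hE : ∀ φ ∈ Omega a, ∫ x, F x ∂(Measure.pi fun _ => colourMeasure φ) ≤ E)
    (x₀ : Fin r → unitInterval × Fin q)
    (hlarge : E + 3 * r * (q : ℝ) ^ r * ε < seedKernel F p r x₀) :
    ∃ (h : unitInterval × Fin q → ℝ) (b : ℝ), Measurable h ∧ (∀ t, |h t| ≤ 1) ∧
      (∀ φ ∈ Omega a, b + ε ≤ ∫ t, h t ∂(colourMeasure φ)) ∧
      ∀ (μ : Measure (unitInterval × Fin q)) [IsProbabilityMeasure μ],
        ∫ t, h t ∂μ - b ≤ (∑ j, ∫ x, |seedDeviation F μ p j x|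
          ∂(Measure.pi fun _ => uniformColour q)) / r := by
  have hrR : (0 : ℝ) < r := by exact_mod_cast hr
  have := isProbabilityMeasure_unif hr
  have := isProbabilityMeasure_uniformColour hq
  set κ : Measure (Fin r → unitInterval × Fin q) := Measure.pi fun _ => uniformColour q with hκ
  have hdm : ∀ (μ : Measure (unitInterval × Fin q)) [IsProbabilityMeasure μ],
      Measurable fun y : Fin r × (Fin r → unitInterval × Fin q) =>
        seedDeviation F μ p y.1 y.2 := fun μ _ =>
    measurable_from_prod_countable_right fun j => measurable_seedDeviation hF μ p j
  have hprob : ∀ φ ∈ Omega a, IsProbabilityMeasure (colourMeasure φ) := fun φ hφ => by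
    have : Fact (IsFracPartition φ) := ⟨hφ.1⟩
    infer_instance
  have habs : ∀ (μ : Measure (unitInterval × Fin q)) [IsProbabilityMeasure μ],
      ∫ y, |seedDeviation F μ p y.1 y.2| ∂((unif r).prod κ)
        = (∑ j, ∫ x, |seedDeviation F μ p j x| ∂κ) / r := fun μ _ =>
    integral_unif_prod hr κ (G := fun y => |seedDeviation F μ p y.1 y.2|) (B := 2)
      (hdm μ).abs (fun y => by rw [abs_abs]; exact abs_seedDeviation_le hF1 μ p _ _)
  obtain ⟨g, hgm, hg1, hg⟩ := exists_separating_test_function ((unif r).prod κ)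
    (convex_seedDeviation a hF hF1 p)
    (by rintro _ ⟨φ, hφ, rfl⟩; have := hprob φ hφ; exact hdm _)
    (by rintro _ ⟨φ, hφ, rfl⟩ y; have := hprob φ hφ; exact abs_seedDeviation_le hF1 _ p _ _)
    hε hε1 (by
      rintro _ ⟨φ, hφ, rfl⟩
      have := hprob φ hφ
      -- Were the deviations of some φ smaller than 3ε on average, the domination by uniform colours
      -- and telescoping would put the seed prediction within 3 r q^r ε of the energy of φ,
      -- contradicting `hlarge`.
      by_contra hcon
      push Not at hcon
      rw [habs, div_lt_iff₀ hrR] at hcon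
      have h1 := abs_integral_pi_sub_seedKernel_le hF hF1 (colourMeasure φ) p x₀
      have h2 : ∑ j, ∫ x, |seedDeviation F (colourMeasure φ) p j x|
          ∂(Measure.pi fun _ => colourMeasure φ)
          ≤ (q : ℝ) ^ r * ∑ j, ∫ x, |seedDeviation F (colourMeasure φ) p j x| ∂κ := by
        rw [Finset.mul_sum]
        refine Finset.sum_le_sum fun j _ => ?_
        exact integral_pi_colourMeasure_le hq hφ.1
          (measurable_seedDeviation hF _ p j).abs (fun _ => abs_nonneg _) (B := 2)
          (fun x => by rw [abs_abs]; exact abs_seedDeviation_le hF1 _ p _ _)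
      have h3 : (q : ℝ) ^ r * ∑ j, ∫ x, |seedDeviation F (colourMeasure φ) p j x| ∂κ
          ≤ (q : ℝ) ^ r * (3 * ε * r) := by gcongr
      have h4 := (abs_le.1 h1).1
      have h5 := hE φ hφ
      have h6 : (q : ℝ) ^ r * (3 * ε * r) = 3 * r * (q : ℝ) ^ r * ε := by ring
      linarith)
  obtain ⟨h, b, hm, h1, hlin⟩ := exists_linear_functional hF hF1 hr p κ hgm hg1
  refine ⟨h, b, hm, h1, fun φ hφ => ?_, fun μ _ => ?_⟩
  · have := hprob φ hφ
    have e := hg _ ⟨φ, hφ, rfl⟩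
    rw [hlin] at e
    linarith
  · rw [← hlin, ← habs μ]
    have hdi : Integrable (fun y => |seedDeviation F μ p y.1 y.2|) ((unif r).prod κ) :=
      integrable_of_abs_le (hdm μ).abs (B := 2)
        fun y => by rw [abs_abs]; exact abs_seedDeviation_le hF1 μ p _ _
    refine integral_mono ?_ hdi fun y => ?_
    · refine integrable_of_abs_le (hgm.mul (hdm μ)) (B := 2) fun y => ?_
      rw [abs_mul]
      nlinarith [hg1 y, abs_seedDeviation_le hF1 μ p y.1 y.2, abs_nonneg (g y),
        abs_nonneg (seedDeviation F μ p y.1 y.2)]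
    · refine (le_abs_self _).trans ?_
      rw [abs_mul]
      exact mul_le_of_le_one_left (abs_nonneg _) (hg1 y)

/-- Decoupling: if an event involves a few of the coordinates as parameters, these parameters may
be treated as fixed at the price of changing the sample at those coordinates. -/
theorem measureReal_comp_mem_le {ι J Ω : Type*} [Fintype ι] [MeasurableSpace Ω]
    (μ : Measure Ω) [IsProbabilityMeasure μ] (s : J → ι) {A : Set ((J → Ω) × (ι → Ω))}
    (hA : MeasurableSet A) {δ : ℝ} (hδ0 : 0 ≤ δ)
    (hδ : ∀ v, (Measure.pi fun _ => μ).real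
      {U : ι → Ω | ∃ U', (∀ u ∉ Set.range s, U' u = U u) ∧ (v, U') ∈ A} ≤ δ) :
    (Measure.pi fun _ => μ).real {U : ι → Ω | ((fun j => U (s j)), U) ∈ A} ≤ δ := by
  classical
  -- The coordinates used as parameters are read from an independent copy. The assembled point has
  -- the original law, and the second sample differs from it only on the range of s.
  set τ : ι → ι ⊕ ι := fun i => if i ∈ Set.range s then Sum.inl i else Sum.inr i with hτ
  have hτi : Function.Injective τ := by
    intro i j hij
    by_cases hi : i ∈ Set.range s <;> by_cases hj : j ∈ Set.range s <;> simp_all [τ]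
  have hmp := measurePreserving_sumElim_comp μ hτi
  set ψ : (ι → Ω) × (ι → Ω) → ι → Ω := fun p i => Sum.elim p.1 p.2 (τ i) with hψ
  have hψs : ∀ p j, ψ p (s j) = p.1 (s j) := fun p j => by simp [hψ, hτ]
  have hψn : ∀ p u, u ∉ Set.range s → ψ p u = p.2 u := fun p u hu => by
    simp only [hψ, hτ, if_neg hu, Sum.elim_inr]
  have hT : MeasurableSet {U : ι → Ω | ((fun j => U (s j)), U) ∈ A} :=
    (by fun_prop : Measurable fun U : ι → Ω => ((fun j => U (s j)), U)) hA
  have hle : (Measure.pi fun _ => μ) {U : ι → Ω | ((fun j => U (s j)), U) ∈ A}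
      ≤ ENNReal.ofReal δ := by
    rw [← hmp.measure_preimage hT.nullMeasurableSet, Measure.prod_apply (hmp.measurable hT)]
    refine (lintegral_mono fun V => ?_ : _ ≤ ∫⁻ _V : ι → Ω, ENNReal.ofReal δ
      ∂(Measure.pi fun _ => μ)).trans (by simp)
    refine (measure_mono ?_).trans
      ((ENNReal.le_ofReal_iff_toReal_le (measure_ne_top _ _) hδ0).2 (hδ fun j => V (s j)))
    intro U hU
    refine ⟨ψ (V, U), fun u hu => hψn _ u hu, ?_⟩
    have e : (fun j => ψ (V, U) (s j)) = fun j => V (s j) := funext fun j => hψs _ j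
    have hU' : ((fun j => ψ (V, U) (s j)), ψ (V, U)) ∈ A := hU
    rwa [e] at hU'
  exact ENNReal.toReal_le_of_le_ofReal hδ0 hle

/-- The energy of the colouring `χ` of the vertices `U` for the averaged kernel `F`. -/
noncomputable def vertexEnergy {q r k : ℕ} (F : (Fin r → unitInterval × Fin q) → ℝ)
    (U : Fin k → unitInterval) (χ : Fin k → Fin q) : ℝ :=
  (∑ n : Fin r → Fin k, F fun j => (U (n j), χ (n j))) / (k : ℝ) ^ r

/-- This is the price of decoupling: at most |J| of the k vertices change, each altering the average
by at most 2/k. -/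
theorem sum_div_le_of_agree_off {k q : ℕ} {J : Type*} [Fintype J] (s : J → Fin k)
    {h : unitInterval × Fin q → ℝ} (h1 : ∀ t, |h t| ≤ 1) {U U' : Fin k → unitInterval}
    (hU : ∀ u ∉ Set.range s, U' u = U u) (χ : Fin k → Fin q) :
    (∑ u, h (U u, χ u)) / k ≤ (∑ u, h (U' u, χ u)) / k + 2 * Fintype.card J / k := by
  classical
  rw [← add_div]
  gcongr
  rw [← sub_le_iff_le_add', ← Finset.sum_sub_distrib]
  calc ∑ u, (h (U u, χ u) - h (U' u, χ u))
      ≤ ∑ u, if u ∈ Finset.univ.image s then (2 : ℝ) else 0 := by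
        refine Finset.sum_le_sum fun u _ => ?_
        split_ifs with hu
        · linarith [abs_le.1 (h1 (U u, χ u)), abs_le.1 (h1 (U' u, χ u)),
            (abs_le.1 (h1 (U u, χ u))).2, (abs_le.1 (h1 (U' u, χ u))).1]
        · rw [hU u (by simpa using hu), sub_self]
    _ = 2 * (Finset.univ.image s).card := by
        rw [Finset.sum_ite_mem]; simp [mul_comm]
    _ ≤ 2 * Fintype.card J := by
        gcongr
        exact Finset.card_image_le

/-- After decoupling, the seeds are fixed and hence so is the functional certifying that they
predict too much. Small deviations on the sample make this functional small there, which the linear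
case shows to be exponentially unlikely. -/
theorem measureReal_seeds_le {k q r m : ℕ} (hr : 0 < r) (hq : 1 ≤ q) (hk : 0 < k)
    {a : Fin q → ℝ} (ha : a ∈ stdSimplex ℝ (Fin q))
    {F : (Fin r → unitInterval × Fin q) → ℝ} (hF : Measurable F) (hF1 : ∀ x, |F x| ≤ 1)
    {E ε : ℝ} (hε : 0 < ε) (hε1 : ε ≤ 1)
    (hE : ∀ φ ∈ Omega a, ∫ x, F x ∂(Measure.pi fun _ => colourMeasure φ) ≤ E)
    (hmε : 2 / √(m : ℝ) ≤ ε / 4) (hmk : 2 * (r * m) / (k : ℝ) ≤ ε / 4) (hqk : q / (k : ℝ) ≤ ε / 4)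
    (x₀ : Fin r → unitInterval × Fin q) (s : Fin r × Fin m → Fin k)
    (y : Fin r × Fin m → Fin q) :
    (volume : Measure (Fin k → unitInterval)).real {U | ∃ χ ∈ balanced k a,
      E + 3 * r * (q : ℝ) ^ r * ε < seedKernel F (fun l i => (U (s (l, i)), y (l, i))) r x₀ ∧
      ∀ j, ∫ x, |seedDeviation F (emp fun u => (U u, χ u))
        (fun l i => (U (s (l, i)), y (l, i))) j x| ∂(Measure.pi fun _ => uniformColour q)
          ≤ 2 / √m} ≤ Real.exp (-(k * ε ^ 2 / 128)) := by
  have hrR : (0 : ℝ) < r := by exact_mod_cast hr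
  have hpu := isProbabilityMeasure_uniformColour hq
  set A : Set ((Fin r × Fin m → unitInterval) × (Fin k → unitInterval)) :=
    {w | ∃ χ ∈ balanced k a,
      E + 3 * r * (q : ℝ) ^ r * ε < seedKernel F (fun l i => (w.1 (l, i), y (l, i))) r x₀ ∧
      ∀ j, ∫ x, |seedDeviation F (emp fun u => (w.2 u, χ u))
        (fun l i => (w.1 (l, i), y (l, i))) j x| ∂(Measure.pi fun _ => uniformColour q)
          ≤ 2 / √m} with hA
  -- Decoupling needs joint measurability in parameters and sample. There are finitely many
  -- colourings, and for each one the empirical integral is a finite sum.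
  have hAm : MeasurableSet A := by
    have hA' : A = ⋃ χ ∈ balanced k a,
        ({w | E + 3 * r * (q : ℝ) ^ r * ε
            < seedKernel F (fun l i => (w.1 (l, i), y (l, i))) r x₀} ∩
        ⋂ j, {w | ∫ x, |seedDeviation F (emp fun u => (w.2 u, χ u))
          (fun l i => (w.1 (l, i), y (l, i))) j x| ∂(Measure.pi fun _ => uniformColour q)
            ≤ 2 / √m}) := by
      ext w
      simp only [hA, Set.mem_ofPred_eq, Set.mem_iUnion, Set.mem_inter_iff, Set.mem_iInter,
        exists_prop]
    rw [hA']
    refine Finset.measurableSet_biUnion _ fun χ _ => MeasurableSet.inter ?_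
      (MeasurableSet.iInter fun j => ?_)
    · refine measurableSet_lt measurable_const ?_
      exact (measurable_seedKernel hF r).comp
        (Measurable.prodMk (by fun_prop) measurable_const)
    · refine measurableSet_le ?_ measurable_const
      have hjm : Measurable fun w : ((Fin r × Fin m → unitInterval) × (Fin k → unitInterval))
          × (Fin r → unitInterval × Fin q) =>
          |seedDeviation F (emp fun u => (w.1.2 u, χ u))
            (fun l i => (w.1.1 (l, i), y (l, i))) j w.2| := by
        have e : ∀ w : ((Fin r × Fin m → unitInterval) × (Fin k → unitInterval))
            × (Fin r → unitInterval × Fin q),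
            seedDeviation F (emp fun u => (w.1.2 u, χ u))
              (fun l i => (w.1.1 (l, i), y (l, i))) j w.2
            = (∑ u, seedKernel F (fun l i => (w.1.1 (l, i), y (l, i))) j
                (Function.update w.2 j (w.1.2 u, χ u))) / k
              - seedKernel F (fun l i => (w.1.1 (l, i), y (l, i))) (j + 1) w.2 := fun w => by
          rw [seedDeviation, integral_emp]
          exact (measurable_seedKernel_right hF _ _).comp (measurable_update w.2)
        simp only [e]
        refine Measurable.abs (Measurable.sub ((Finset.measurable_sum _ fun u _ => ?_).div_const _)
          ?_)
        · exact (measurable_seedKernel hF j).comp (Measurable.prodMk (by fun_prop)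
            (measurable_update_of measurable_snd j (by fun_prop)))
        · exact (measurable_seedKernel hF (j + 1)).comp (Measurable.prodMk (by fun_prop)
            measurable_snd)
      exact (hjm.stronglyMeasurable.integral_prod_right'
        (ν := Measure.pi fun _ => uniformColour q)).measurable
  refine measureReal_comp_mem_le (volume : Measure unitInterval) s hAm (Real.exp_pos _).le
    fun v => ?_
  by_cases hlarge : E + 3 * r * (q : ℝ) ^ r * ε
      < seedKernel F (fun l i => (v (l, i), y (l, i))) r x₀
  · obtain ⟨h, b, hhm, hh1, hsep, hemp⟩ :=
      exists_separating_functional hr hq hF hF1 _ hε hε1 hE x₀ hlarge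
    -- On the original sample the functional is at most b + 2/√m + 2rm/k ≤ b + ε/2, against at least
    -- b + ε on `Omega a`. The gap ε/2 also absorbs the rounding error q/k ≤ ε/4 of the linear case.
    have hlin := measureReal_exists_balanced_le hk ha hhm one_pos hh1 hsep (s := ε / 2)
      (by linarith) (by rw [one_mul]; linarith)
    refine (measureReal_mono ?_ (measure_ne_top _ _)).trans (hlin.trans (le_of_eq ?_))
    · rintro U ⟨U', hUU', χ, hχ, -, hdev⟩
      refine ⟨χ, hχ, ?_⟩
      have := isProbabilityMeasure_emp hk fun u => (U' u, χ u)
      have h1 := hemp (emp fun u => (U' u, χ u))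
      rw [integral_emp _ hhm] at h1
      have h2 : (∑ j, ∫ x, |seedDeviation F (emp fun u => (U' u, χ u))
          (fun l i => (v (l, i), y (l, i))) j x| ∂(Measure.pi fun _ => uniformColour q)) / r
          ≤ 2 / √m := by
        rw [div_le_iff₀ hrR]
        refine (Finset.sum_le_sum fun j _ => hdev j).trans ?_
        simp [mul_comm]
      have h3 := sum_div_le_of_agree_off s hh1 hUU' χ
      simp only [Fintype.card_prod, Fintype.card_fin, Nat.cast_mul] at h3
      linarith
    · congr 1; ring
  · have : {U : Fin k → unitInterval | ∃ U', (∀ u ∉ Set.range s, U' u = U u) ∧ (v, U') ∈ A}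
        = ∅ := by
      refine Set.eq_empty_of_forall_notMem ?_
      rintro U ⟨U', -, χ, -, hl, -⟩
      exact hlarge hl
    rw [this]
    simp only [measureReal_empty]
    positivity

/-- With high probability no balanced colouring of the sample has energy much above the
graphon energy. -/
theorem measureReal_vertexEnergy_gt_le {k q r m : ℕ} (hr : 0 < r) (hq : 1 ≤ q) (hk : 0 < k)
    (hm : 0 < m) {a : Fin q → ℝ} (ha : a ∈ stdSimplex ℝ (Fin q))
    {F : (Fin r → unitInterval × Fin q) → ℝ} (hF : Measurable F) (hF1 : ∀ x, |F x| ≤ 1)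
    {E ε : ℝ} (hε : 0 < ε) (hε1 : ε ≤ 1)
    (hE : ∀ φ ∈ Omega a, ∫ x, F x ∂(Measure.pi fun _ => colourMeasure φ) ≤ E)
    (hmε : 2 / √(m : ℝ) ≤ ε / 4) (hmk : 2 * (r * m) / (k : ℝ) ≤ ε / 4)
    (hqk : q / (k : ℝ) ≤ ε / 4) :
    (volume : Measure (Fin k → unitInterval)).real {U | ∃ χ ∈ balanced k a,
      E + (3 * r * (q : ℝ) ^ r + r) * ε < vertexEnergy F U χ}
      ≤ ((k : ℝ) * q) ^ (r * m) * Real.exp (-(k * ε ^ 2 / 128)) := by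
  have hrR : (0 : ℝ) < r := by exact_mod_cast hr
  have := isProbabilityMeasure_uniformColour hq
  let x₀ : Fin r → unitInterval × Fin q := fun _ => (0, ⟨0, hq⟩)
  set B : (Fin r × Fin m → Fin k) × (Fin r × Fin m → Fin q) → Set (Fin k → unitInterval) :=
    fun w => {U | ∃ χ ∈ balanced k a,
      E + 3 * r * (q : ℝ) ^ r * ε < seedKernel F (fun l i => (U (w.1 (l, i)), w.2 (l, i))) r x₀ ∧
      ∀ j, ∫ x, |seedDeviation F (emp fun u => (U u, χ u))
        (fun l i => (U (w.1 (l, i)), w.2 (l, i))) j x| ∂(Measure.pi fun _ => uniformColour q)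
          ≤ 2 / √m} with hB
  have hsub : {U | ∃ χ ∈ balanced k a,
      E + (3 * r * (q : ℝ) ^ r + r) * ε < vertexEnergy F U χ} ⊆ ⋃ w, B w := by
    rintro U ⟨χ, hχ, hlt⟩
    have := isProbabilityMeasure_emp hk fun u => (U u, χ u)
    -- Two reference measures are needed. Under uniform colours the deviations can be compared with
    -- every fractional partition; under the empirical power they make the seed prediction agree
    -- with the actual energy up to rε/4.
    obtain ⟨s, hs⟩ := exists_seeds hk hm hF hF1 (fun u => (U u, χ u))
      (Measure.pi fun _ => uniformColour q) (Measure.pi fun _ => emp fun u => (U u, χ u))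
    refine Set.mem_iUnion.2 ⟨(fun w => s w.1 w.2, fun w => χ (s w.1 w.2)), χ, hχ, ?_,
      fun j => (hs j).1⟩
    have h1 := abs_integral_pi_sub_seedKernel_le hF hF1 (emp fun u => (U u, χ u))
      (fun l i => (U (s l i), χ (s l i))) x₀
    rw [integral_pi_emp hk _ hF] at h1
    have h2 : ∑ j, ∫ x, |seedDeviation F (emp fun u => (U u, χ u))
        (fun l i => (U (s l i), χ (s l i))) j x| ∂(Measure.pi fun _ => emp fun u => (U u, χ u))
        ≤ r * (ε / 4) := by
      refine (Finset.sum_le_sum fun j _ => ((hs j).2.trans hmε)).trans ?_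
      simp
    have h3 := (abs_le.1 h1).2
    unfold vertexEnergy at hlt
    dsimp only at h3 ⊢
    nlinarith [mul_pos hrR hε]
  -- The union runs over positions and colours of the r m seeds, not over colourings.
  calc _ ≤ (volume : Measure (Fin k → unitInterval)).real (⋃ w, B w) :=
        measureReal_mono hsub (measure_ne_top _ _)
    _ ≤ ∑ w, (volume : Measure (Fin k → unitInterval)).real (B w) := measureReal_iUnion_fintype_le _
    _ ≤ ∑ _w : (Fin r × Fin m → Fin k) × (Fin r × Fin m → Fin q),
          Real.exp (-(k * ε ^ 2 / 128)) :=
        Finset.sum_le_sum fun w _ =>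
          measureReal_seeds_le hr hq hk ha hF hF1 hε hε1 hE hmε hmk hqk x₀ w.1 w.2
    _ = _ := by
        simp [mul_pow]

/-! ### Counting maps `[r] → [k]` -/

theorem card_prescribed_div {r k : ℕ} (hk : 0 < k) (T : Finset (Fin r)) (w : Fin r → Fin k) :
    ((Finset.univ.filter fun n : Fin r → Fin k => ∀ l ∈ T, n l = w l).card : ℝ) / (k : ℝ) ^ r
      = (1 / (k : ℝ)) ^ T.card := by
  have hkR : (k : ℝ) ≠ 0 := by positivity
  have h1 : (Finset.univ.filter fun n : Fin r → Fin k => ∀ l ∈ T, n l = w l)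
      = Fintype.piFinset fun l => if l ∈ T then {w l} else Finset.univ := by
    ext n
    simp only [Finset.mem_filter, Finset.mem_univ, true_and, Fintype.mem_piFinset]
    refine forall_congr' fun l => ?_
    split_ifs with h <;> simp [h]
  rw [h1, Fintype.card_piFinset]
  push_cast
  have h2 : (k : ℝ) ^ r = ∏ _l : Fin r, (k : ℝ) := by simp
  rw [h2, ← Finset.prod_div_distrib]
  have h3 : ∀ l : Fin r, ((if l ∈ T then ({w l} : Finset (Fin k)) else Finset.univ).card : ℝ) / k
      = if l ∈ T then 1 / (k : ℝ) else 1 := fun l => by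
    split_ifs <;> simp [hkR]
  simp only [h3]
  rw [Finset.prod_ite_mem]
  simp

theorem card_hit_div_le {r k : ℕ} (hk : 0 < k) (D : Finset (Fin k)) :
    ((Finset.univ.filter fun n : Fin r → Fin k => ∃ j, n j ∈ D).card : ℝ) / (k : ℝ) ^ r
      ≤ r * D.card / k := by
  have h : (Finset.univ.filter fun n : Fin r → Fin k => ∃ j, n j ∈ D) ⊆
      (Finset.univ ×ˢ D).biUnion fun p : Fin r × Fin k =>
        Finset.univ.filter fun n => ∀ l ∈ ({p.1} : Finset (Fin r)), n l = (fun _ => p.2) l := by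
    intro n hn
    obtain ⟨j, hj⟩ := (Finset.mem_filter.1 hn).2
    simp only [Finset.mem_biUnion]
    exact ⟨(j, n j), by simp [hj], by simp⟩
  calc _ ≤ ((∑ p ∈ (Finset.univ : Finset (Fin r)) ×ˢ D, (Finset.univ.filter fun n : Fin r → Fin k =>
          ∀ l ∈ ({p.1} : Finset (Fin r)), n l = (fun _ => p.2) l).card : ℕ) : ℝ) / (k : ℝ) ^ r := by
        gcongr
        exact (Finset.card_le_card h).trans Finset.card_biUnion_le
    _ = _ := by
        push_cast
        rw [Finset.sum_div]
        simp_rw [fun p : Fin r × Fin k => card_prescribed_div hk {p.1} (fun _ => p.2)]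
        simp
        ring

theorem card_hit_two_div_le {r k : ℕ} (hk : 0 < k) {u v : Fin k} (huv : u ≠ v) :
    ((Finset.univ.filter fun n : Fin r → Fin k => (∃ i, n i = u) ∧ ∃ j, n j = v).card : ℝ)
      / (k : ℝ) ^ r ≤ r ^ 2 / k ^ 2 := by
  have h : (Finset.univ.filter fun n : Fin r → Fin k => (∃ i, n i = u) ∧ ∃ j, n j = v) ⊆
      (Finset.univ.filter fun p : Fin r × Fin r => p.1 ≠ p.2).biUnion fun p =>
        Finset.univ.filter fun n : Fin r → Fin k =>
          ∀ l ∈ ({p.1, p.2} : Finset (Fin r)), n l = (fun l => if l = p.1 then u else v) l := by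
    intro n hn
    obtain ⟨⟨i, hi⟩, j, hj⟩ := (Finset.mem_filter.1 hn).2
    have hij : i ≠ j := by rintro rfl; exact huv (hi.symm.trans hj)
    simp only [Finset.mem_biUnion]
    exact ⟨(i, j), by simp [hij], by simp [hi, hj, hij.symm]⟩
  calc _ ≤ ((∑ p ∈ Finset.univ.filter fun p : Fin r × Fin r => p.1 ≠ p.2,
          (Finset.univ.filter fun n : Fin r → Fin k => ∀ l ∈ ({p.1, p.2} : Finset (Fin r)),
            n l = (fun l => if l = p.1 then u else v) l).card : ℕ) : ℝ) / (k : ℝ) ^ r := by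
        gcongr
        exact (Finset.card_le_card h).trans Finset.card_biUnion_le
    _ = ∑ p ∈ Finset.univ.filter fun p : Fin r × Fin r => p.1 ≠ p.2, (1 / (k : ℝ)) ^ 2 := by
        push_cast
        rw [Finset.sum_div]
        refine Finset.sum_congr rfl fun p hp => ?_
        rw [card_prescribed_div hk, Finset.card_pair (Finset.mem_filter.1 hp).2]
    _ ≤ ∑ _p : Fin r × Fin r, (1 / (k : ℝ)) ^ 2 :=
        Finset.sum_le_sum_of_subset_of_nonneg (Finset.filter_subset _ _) fun _ _ _ => by positivity
    _ = _ := by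
        simp
        ring

theorem card_not_injective_div_le {r k : ℕ} (hk : 0 < k) :
    ((Finset.univ.filter fun n : Fin r → Fin k => ¬ Function.Injective n).card : ℝ)
      / (k : ℝ) ^ r ≤ r ^ 2 / k := by
  have hkR : (k : ℝ) ≠ 0 := by positivity
  have h : (Finset.univ.filter fun n : Fin r → Fin k => ¬ Function.Injective n) ⊆
      ((Finset.univ.filter fun p : Fin r × Fin r => p.1 ≠ p.2) ×ˢ
        (Finset.univ : Finset (Fin k))).biUnion fun p =>
        Finset.univ.filter fun n : Fin r → Fin k =>
          ∀ l ∈ ({p.1.1, p.1.2} : Finset (Fin r)), n l = (fun _ => p.2) l := by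
    intro n hn
    have hn := (Finset.mem_filter.1 hn).2
    simp only [Function.Injective, not_forall] at hn
    obtain ⟨i, j, hij, hne⟩ := hn
    simp only [Finset.mem_biUnion]
    exact ⟨((i, j), n i), by simp [hne], by simp [hij]⟩
  calc _ ≤ ((∑ p ∈ (Finset.univ.filter fun p : Fin r × Fin r => p.1 ≠ p.2) ×ˢ
          (Finset.univ : Finset (Fin k)),
          (Finset.univ.filter fun n : Fin r → Fin k => ∀ l ∈ ({p.1.1, p.1.2} : Finset (Fin r)),
            n l = (fun _ => p.2) l).card : ℕ) : ℝ) / (k : ℝ) ^ r := by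
        gcongr
        exact (Finset.card_le_card h).trans Finset.card_biUnion_le
    _ = ∑ p ∈ (Finset.univ.filter fun p : Fin r × Fin r => p.1 ≠ p.2) ×ˢ
          (Finset.univ : Finset (Fin k)), (1 / (k : ℝ)) ^ 2 := by
        push_cast
        rw [Finset.sum_div]
        refine Finset.sum_congr rfl fun p hp => ?_
        rw [card_prescribed_div hk,
          Finset.card_pair (Finset.mem_filter.1 (Finset.mem_product.1 hp).1).2]
    _ ≤ ∑ _p : (Fin r × Fin r) × Fin k, (1 / (k : ℝ)) ^ 2 :=
        Finset.sum_le_sum_of_subset_of_nonneg (Finset.subset_univ _) fun _ _ _ => by positivity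
    _ = _ := by
        simp
        field_simp

/-! ### The sampled energy is not much below the graphon energy -/

/-- At most a fraction r|D|/k of the maps [r] → [k] meets D, and only these terms change, each by at
most 2. -/
theorem abs_average_comp_sub_le {X : Type*} {r k : ℕ} (hk : 0 < k) {F : (Fin r → X) → ℝ}
    (hF1 : ∀ x, |F x| ≤ 1) (P P' : Fin k → X) (D : Finset (Fin k))
    (hD : ∀ u ∉ D, P u = P' u) :
    |(∑ n : Fin r → Fin k, F fun j => P (n j)) / (k : ℝ) ^ r
      - (∑ n : Fin r → Fin k, F fun j => P' (n j)) / (k : ℝ) ^ r| ≤ 2 * r * D.card / k := by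
  have hkR : (0 : ℝ) < k := by exact_mod_cast hk
  rw [← sub_div, ← Finset.sum_sub_distrib, abs_div, abs_of_pos (pow_pos hkR r)]
  calc _ ≤ (∑ n : Fin r → Fin k, if ∃ j, n j ∈ D then (2 : ℝ) else 0) / (k : ℝ) ^ r := by
        gcongr
        refine (Finset.abs_sum_le_sum_abs _ _).trans (Finset.sum_le_sum fun n _ => ?_)
        split_ifs with h
        · exact (abs_sub _ _).trans (by linarith [hF1 fun j => P (n j), hF1 fun j => P' (n j)])
        · push Not at h
          rw [funext fun j => hD (n j) (h j)]; simp
    _ = 2 * (((Finset.univ.filter fun n : Fin r → Fin k => ∃ j, n j ∈ D).card : ℝ)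
          / (k : ℝ) ^ r) := by
        rw [← Finset.sum_filter]; simp; ring
    _ ≤ 2 * (r * D.card / k) := mul_le_mul_of_nonneg_left (card_hit_div_le hk D) two_pos.le
    _ = _ := by ring

theorem abs_vertexEnergy_le {q r k : ℕ} {F : (Fin r → unitInterval × Fin q) → ℝ}
    (hF1 : ∀ x, |F x| ≤ 1) (U : Fin k → unitInterval) (χ : Fin k → Fin q) :
    |vertexEnergy F U χ| ≤ 1 := by
  rw [vertexEnergy, abs_div, abs_pow, Nat.abs_cast]
  refine div_le_one_of_le₀ ?_ (by positivity)
  refine (Finset.abs_sum_le_sum_abs _ _).trans ((Finset.sum_le_sum fun n _ => hF1 _).trans ?_)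
  simp

theorem measurable_vertexEnergy {q r k : ℕ} {F : (Fin r → unitInterval × Fin q) → ℝ}
    (hF : Measurable F) (χ : Fin k → Fin q) : Measurable fun U => vertexEnergy F U χ :=
  (Finset.measurable_sum _ fun n _ => hF.comp (by fun_prop)).div_const _

/-- An injective choice of indices yields independent points and contributes exactly the integral of
F. The remaining choices have density at most r²/k and cost at most 2 each. -/
theorem integral_average_comp_ge {X : Type*} [MeasurableSpace X] {r k : ℕ} (hk : 0 < k)
    {F : (Fin r → X) → ℝ} (hF : Measurable F) (hF1 : ∀ x, |F x| ≤ 1) (μ : Measure X)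
    [IsProbabilityMeasure μ] :
    (∫ x, F x ∂(Measure.pi fun _ => μ)) - 2 * r ^ 2 / k ≤ ∫ P : Fin k → X,
      (∑ n : Fin r → Fin k, F fun j => P (n j)) / (k : ℝ) ^ r ∂(Measure.pi fun _ => μ) := by
  have hkR : (0 : ℝ) < k := by exact_mod_cast hk
  set E := ∫ x, F x ∂(Measure.pi fun _ => μ) with hE
  have hE1 : |E| ≤ 1 := abs_integral_le_of_abs_le hF1
  have hn : ∀ n : Fin r → Fin k, (E - if ¬ Function.Injective n then 2 else 0)
      ≤ ∫ P : Fin k → X, F (fun j => P (n j)) ∂(Measure.pi fun _ => μ) := by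
    intro n
    by_cases h : Function.Injective n
    · have hmp := measurePreserving_comp_injective μ h
      have e := integral_map (μ := Measure.pi fun _ : Fin k => μ) (f := F)
        hmp.measurable.aemeasurable hF.aestronglyMeasurable
      rw [hmp.map_eq] at e
      rw [← e]; simp [h, hE]
    · rw [if_pos h]
      have := abs_integral_le_of_abs_le (μ := Measure.pi fun _ : Fin k => μ)
        (F := fun P => F fun j => P (n j)) fun P => hF1 _
      linarith [(abs_le.1 this).1, (abs_le.1 hE1).2]
  have hi : ∀ n : Fin r → Fin k, Integrable (fun P : Fin k → X => F fun j => P (n j))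
      (Measure.pi fun _ => μ) := fun n =>
    integrable_of_abs_le (hF.comp (by fun_prop)) fun P => hF1 _
  rw [integral_div, integral_finsetSum _ fun n _ => hi n]
  calc E - 2 * r ^ 2 / k ≤ E - 2 * (((Finset.univ.filter fun n : Fin r → Fin k =>
          ¬ Function.Injective n).card : ℝ) / (k : ℝ) ^ r) := by
        have := card_not_injective_div_le (r := r) hk
        have e : 2 * (r : ℝ) ^ 2 / k = 2 * (r ^ 2 / k) := by ring
        rw [e]; linarith
    _ = (∑ n : Fin r → Fin k, (E - if ¬ Function.Injective n then 2 else 0)) / (k : ℝ) ^ r := by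
        rw [Finset.sum_sub_distrib, ← Finset.sum_filter]
        simp
        field_simp
    _ ≤ _ := by gcongr with n; exact hn n

theorem integral_indicator_colourMeasure {q : ℕ} {a : Fin q → ℝ} {φ : Fin q → unitInterval → ℝ}
    (hφ : φ ∈ Omega a) (i : Fin q) :
    ∫ p, (if p.2 = i then (1 : ℝ) else 0) ∂(colourMeasure φ) = a i := by
  rw [integral_colourMeasure (G := fun p => if p.2 = i then (1 : ℝ) else 0) (B := 1) hφ.1
    ((measurable_of_countable (fun j : Fin q => if j = i then (1 : ℝ) else 0)).comp measurable_snd)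
    (fun p => by split_ifs <;> simp)]
  have h2 : ∀ j, ∫ t, φ j t * (if j = i then (1 : ℝ) else 0)
      = if j = i then ∫ t, φ j t else 0 := fun j => by
    split_ifs <;> simp
  simp only [h2, Finset.sum_ite_eq', Finset.mem_univ, if_true]
  exact hφ.2 i

/-- With high probability some balanced colouring of the sample has energy not much below that of
a given fractional partition. -/
theorem measureReal_vertexEnergy_lt_le {k q r : ℕ} (hr : 0 < r) (hk : 0 < k)
    {a : Fin q → ℝ} (ha : a ∈ stdSimplex ℝ (Fin q))
    {F : (Fin r → unitInterval × Fin q) → ℝ} (hF : Measurable F) (hF1 : ∀ x, |F x| ≤ 1)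
    {φ : Fin q → unitInterval → ℝ} (hφ : φ ∈ Omega a) {δ : ℝ} (hδ : 0 < δ)
    (hkδ : 2 * r ^ 2 / k + 2 * r * (q / √k + q / k) ≤ δ / 2) :
    (volume : Measure (Fin k → unitInterval)).real {U | ∀ χ ∈ balanced k a,
      vertexEnergy F U χ < (∫ x, F x ∂(Measure.pi fun _ => colourMeasure φ)) - δ}
      ≤ Real.exp (-(k * δ ^ 2 / (32 * r ^ 2))) := by
  have hkR : (0 : ℝ) < k := by exact_mod_cast hk
  have hrR : (0 : ℝ) < r := by exact_mod_cast hr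
  have hfact : Fact (IsFracPartition φ) := ⟨hφ.1⟩
  set E := ∫ x, F x ∂(Measure.pi fun _ => colourMeasure φ) with hE
  obtain ⟨sel, h1, h2, h3⟩ := exists_measurable_argmin (balanced_nonempty hk ha)
    (fun χ U => -vertexEnergy F U χ) fun χ => (measurable_vertexEnergy hF χ).neg
  have h2' : ∀ U, ∀ χ ∈ balanced k a, vertexEnergy F U χ ≤ vertexEnergy F U (sel U) :=
    fun U χ hχ => neg_le_neg_iff.1 (h2 U χ hχ)
  set V : (Fin k → unitInterval) → ℝ := fun U => vertexEnergy F U (sel U) with hV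
  have hVm : Measurable V := by
    have : V = fun U => ∑ χ, {ω | sel ω = χ}.indicator (fun U => vertexEnergy F U χ) U := by
      funext U; simp [hV, Set.indicator_apply]
    rw [this]
    exact Finset.measurable_sum _ fun χ _ => (measurable_vertexEnergy hF χ).indicator (h3 χ)
  have hVb : ∀ U, |V U| ≤ 1 := fun U => abs_vertexEnergy_le hF1 U _
  have hd : ∀ χ i U t, |vertexEnergy F (Function.update U i t) χ - vertexEnergy F U χ|
      ≤ 2 * r / k := fun χ i U t => by
    have := abs_average_comp_sub_le hk hF1 (fun u => (Function.update U i t u, χ u))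
      (fun u => (U u, χ u)) {i} (fun u hu => by
        rw [Function.update_of_ne (by simpa using hu)])
    simpa [vertexEnergy] using this
  have hVd : ∀ i U t, |V (Function.update U i t) - V U| ≤ 2 * r / k := fun i U t => by
    have e1 := h2' (Function.update U i t) (sel U) (h1 U)
    have e2 := h2' U (sel (Function.update U i t)) (h1 _)
    have e3 := abs_le.1 (hd (sel U) i U t)
    have e4 := abs_le.1 (hd (sel (Function.update U i t)) i U t)
    rw [abs_le]
    constructor <;> simp only [hV] <;> linarith [e3.1, e3.2, e4.1, e4.2]
  have hmean : E - δ / 2 ≤ ∫ U, V U := by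
    -- The sample is lifted to points coloured independently according to φ. Such a colouring has
    -- the right expected energy, and its class sizes miss a by 1/√k in mean.
    set μ : Measure (Fin k → unitInterval × Fin q) := Measure.pi fun _ => colourMeasure φ with hμ
    have hfst : μ.map (fun P u => (P u).1) = volume := by
      rw [hμ, Measure.pi_map_pi (fun _ => measurable_fst.aemeasurable)]
      simp only [map_fst_colourMeasure hφ.1]
      rfl
    have hfm : Measurable fun (P : Fin k → unitInterval × Fin q) u => (P u).1 := by fun_prop
    have hVint : ∫ U, V U = ∫ P, V (fun u => (P u).1) ∂μ := by
      rw [← hfst, integral_map hfm.aemeasurable hVm.aestronglyMeasurable]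
    set N : Fin q → (Fin k → unitInterval × Fin q) → ℝ := fun i P =>
      |(∑ u, if (P u).2 = i then (1 : ℝ) else 0) / k - a i| with hN
    have hind : ∀ i : Fin q, Measurable fun p : unitInterval × Fin q =>
        if p.2 = i then (1 : ℝ) else 0 := fun i =>
      (measurable_of_countable (fun j : Fin q => if j = i then (1 : ℝ) else 0)).comp
        measurable_snd
    have hNm : ∀ i, Measurable (N i) := fun i =>
      (((Finset.measurable_sum _ fun u _ =>
        (hind i).comp (measurable_pi_apply u)).div_const _).sub_const _).abs
    have hNb : ∀ i P, |N i P| ≤ 1 + |a i| := fun i P => by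
      simp only [hN]
      rw [abs_abs]
      refine (abs_sub _ _).trans ?_
      gcongr
      exact abs_average_le fun u => by split_ifs <;> simp
    have hNi : ∀ i, ∫ P, N i P ∂μ ≤ 1 / √k := fun i => by
      have := integral_abs_average_sub_le (colourMeasure φ) (hind i)
        (fun p => by split_ifs <;> simp) hk
      rwa [integral_indicator_colourMeasure hφ] at this
    set A : (Fin k → unitInterval × Fin q) → ℝ := fun P =>
      (∑ n : Fin r → Fin k, F fun j => P (n j)) / (k : ℝ) ^ r with hA
    have hAm : Measurable A :=
      (Finset.measurable_sum _ fun n _ => hF.comp (by fun_prop)).div_const _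
    -- The random colouring is repaired to a balanced one, whose energy cannot exceed the maximum V.
    have hpt : ∀ P, A P - 2 * r * (∑ i, N i P + q / k) ≤ V fun u => (P u).1 := by
      intro P
      obtain ⟨χ', hχ', hc⟩ := exists_balanced_near hk ha (fun u => (P u).2)
      have e1 := h2' (fun u => (P u).1) χ' hχ'
      have e2 := abs_average_comp_sub_le hk hF1 P (fun u => ((P u).1, χ' u))
        (Finset.univ.filter fun u => (P u).2 ≠ χ' u) (fun u hu => by
          have : (P u).2 = χ' u := by simpa using hu
          rw [← this])
      have e3 : ∀ i, |(classSize (fun u => (P u).2) i : ℝ) / k - a i| = N i P := fun i => by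
        simp [hN, classSize]
      simp only [e3] at hc
      have e4 : 2 * (r : ℝ) * ((Finset.univ.filter fun u => (P u).2 ≠ χ' u).card : ℝ) / k
          ≤ 2 * r * (∑ i, N i P + q / k) := by
        rw [mul_div_assoc]; gcongr
      have e5 := (abs_le.1 e2).2
      simp only [hV, hA, vertexEnergy] at e1 ⊢
      linarith
    have hAint : Integrable A μ := integrable_of_abs_le hAm (B := 1) fun P => by
      simp only [hA]
      rw [abs_div, abs_pow, Nat.abs_cast]
      refine div_le_one_of_le₀ ?_ (by positivity)
      refine (Finset.abs_sum_le_sum_abs _ _).trans ((Finset.sum_le_sum fun n _ => hF1 _).trans ?_)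
      simp
    have hNint : ∀ i, Integrable (N i) μ := fun i => integrable_of_abs_le (hNm i) (hNb i)
    have hSint : Integrable (fun P => ∑ i, N i P + (q : ℝ) / k) μ :=
      (integrable_finsetSum _ fun i _ => hNint i).add (integrable_const _)
    calc E - δ / 2 ≤ (E - 2 * r ^ 2 / k) - 2 * r * (∑ _i : Fin q, 1 / √(k : ℝ) + q / k) := by
          have : ∑ _i : Fin q, 1 / √(k : ℝ) = q / √k := by simp; rfl
          rw [this]; linarith
      _ ≤ (∫ P, A P ∂μ) - 2 * r * (∑ i, ∫ P, N i P ∂μ + q / k) := by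
          gcongr with i
          · exact integral_average_comp_ge hk hF hF1 (colourMeasure φ)
          · exact hNi i
      _ = ∫ P, (A P - 2 * r * (∑ i, N i P + q / k)) ∂μ := by
          rw [integral_sub hAint (hSint.const_mul _), integral_const_mul,
            integral_add (integrable_finsetSum _ fun i _ => hNint i) (integrable_const _),
            integral_finsetSum _ fun i _ => hNint i]
          simp
      _ ≤ ∫ P, V (fun u => (P u).1) ∂μ :=
          integral_mono (hAint.sub (hSint.const_mul _))
            (integrable_of_abs_le (hVm.comp hfm) fun P => hVb _) hpt
      _ = ∫ U, V U := hVint.symm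
  have hmc := measureReal_le_le_of_boundedDifferences (volume : Measure unitInterval)
    (c := fun _ : Fin k => 2 * r / k) (V := 4 * r ^ 2 / k) (s := δ / 2) hVm
    hVb hVd (by positivity) (by
      simp only [Finset.sum_const, Finset.card_univ, Fintype.card_fin, nsmul_eq_mul]
      apply le_of_eq; field_simp; ring) (by linarith)
  refine le_trans (measureReal_mono ?_ (measure_ne_top _ _)) (hmc.trans (le_of_eq ?_))
  · intro U hU
    have := hU (sel U) (h1 U)
    have e : ∫ y, V y ∂(Measure.pi fun _ => (volume : Measure unitInterval)) = ∫ U, V U := rfl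
    simp only [Set.mem_ofPred_eq]
    rw [e]
    simp only [hV] at hmean ⊢
    linarith
  · congr 1
    field_simp
    ring

/-! ### Separating the vertex coordinates from the others -/

/-- The unique element of a set with one element, or else the set itself. -/
noncomputable def singletonOr {α β : Type*} (S : Finset α) (b : β) : α ⊕ β :=
  if h : S.card = 1 then Sum.inl (Finset.card_eq_one.1 h).choose else Sum.inr b

theorem singletonOr_singleton {α β : Type*} (x : α) (b : β) :
    singletonOr {x} b = Sum.inl x := by
  have h : ({x} : Finset α).card = 1 := Finset.card_singleton x
  rw [singletonOr, dif_pos h]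
  have := (Finset.card_eq_one.1 h).choose_spec
  rw [Finset.singleton_inj] at this
  rw [← this]

theorem singletonOr_of_card_ne {α β : Type*} {S : Finset α} (h : S.card ≠ 1) (b : β) :
    singletonOr S b = Sum.inr b := by
  rw [singletonOr, dif_neg h]

/-- Injectivity exhibits `withVertices` as a reindexing of independent uniform coordinates, which
makes it measure preserving. -/
theorem singletonOr_injective {α : Type*} {p : Finset α → Prop} :
    Function.Injective fun S : {S : Finset α // p S} => singletonOr S.1 S := by
  intro S T h
  dsimp only at h
  by_cases hS : S.1.card = 1 <;> by_cases hT : T.1.card = 1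
  · obtain ⟨x, hx⟩ := Finset.card_eq_one.1 hS
    obtain ⟨y, hy⟩ := Finset.card_eq_one.1 hT
    rw [hx, hy, singletonOr_singleton, singletonOr_singleton, Sum.inl.injEq] at h
    exact Subtype.ext (by rw [hx, hy, h])
  · obtain ⟨x, hx⟩ := Finset.card_eq_one.1 hS
    rw [hx, singletonOr_singleton, singletonOr_of_card_ne hT] at h
    simp at h
  · obtain ⟨y, hy⟩ := Finset.card_eq_one.1 hT
    rw [hy, singletonOr_singleton, singletonOr_of_card_ne hS] at h
    simp at h
  · rw [singletonOr_of_card_ne hT, singletonOr_of_card_ne hS] at h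
    simpa using h

/-- Replace the coordinates indexed by singletons. -/
noncomputable def withVertices {α : Type*} {p : Finset α → Prop} (t : α → unitInterval)
    (w : {S : Finset α // p S} → unitInterval) : {S : Finset α // p S} → unitInterval :=
  fun S => Sum.elim t w (singletonOr S.1 S)

theorem measurePreserving_withVertices {α : Type*} [Fintype α] {p : Finset α → Prop}
    [Fintype {S : Finset α // p S}] :
    MeasurePreserving (fun y : (α → unitInterval) × ({S : Finset α // p S} → unitInterval) =>
      withVertices y.1 y.2) :=
  measurePreserving_sumElim_comp volume singletonOr_injective

theorem withVertices_vertex {r : ℕ} (t : Fin r → unitInterval) (w : Cube r) (j : Fin r) :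
    Cube.vertex (withVertices t w) j = t j := by
  simp [Cube.vertex, withVertices, singletonOr_singleton]

/-- The vertex coordinates of a sample. -/
def Sample.vertices {k r : ℕ} (hr : 1 ≤ r) (U : Sample k r) (u : Fin k) : unitInterval :=
  U ⟨{u}, Finset.singleton_nonempty u, by simpa using hr⟩

theorem vertices_withVertices {k r : ℕ} (hr : 1 ≤ r) (t : Fin k → unitInterval)
    (w : Sample k r) : Sample.vertices hr (withVertices t w) = t := by
  funext u
  simp [Sample.vertices, withVertices, singletonOr_singleton]

theorem measurePreserving_vertices {k r : ℕ} (hr : 1 ≤ r) :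
    MeasurePreserving (fun U : Sample k r => Sample.vertices hr U) :=
  measurePreserving_comp_injective volume
    (σ := fun u : Fin k => (⟨{u}, Finset.singleton_nonempty u, by simpa using hr⟩ :
      {S : Finset (Fin k) // S.Nonempty ∧ S.card ≤ r})) fun u v h => by simpa using h

/-- For an injective n, the image of a face is a singleton exactly when the face is, so vertex
coordinates go to vertex coordinates. -/
theorem edgePoint_withVertices {k r : ℕ} (t : Fin k → unitInterval) (w : Sample k r)
    {n : Fin r → Fin k} (hn : Function.Injective n) :
    Sample.edgePoint (withVertices t w) n
      = withVertices (fun j => t (n j)) (Sample.edgePoint w n) := by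
  funext S
  simp only [Sample.edgePoint, withVertices]
  by_cases hS : S.1.card = 1
  · obtain ⟨j, hj⟩ := Finset.card_eq_one.1 hS
    simp only [hj, Finset.image_singleton, singletonOr_singleton, Sum.elim_inl]
  · rw [singletonOr_of_card_ne hS, singletonOr_of_card_ne]
    · simp [Sample.edgePoint]
    · rwa [Finset.card_image_of_injective _ hn]

theorem measurePreserving_edgePoint {k r : ℕ} {n : Fin r → Fin k}
    (hn : Function.Injective n) : MeasurePreserving (fun U : Sample k r => U.edgePoint n) :=
  measurePreserving_comp_injective volume
    (σ := fun S : {S : Finset (Fin r) // S.Nonempty} =>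
      (⟨S.1.image n, S.2.image n, Finset.card_image_le.trans (card_finset_fin_le S.1)⟩ :
        {S : Finset (Fin k) // S.Nonempty ∧ S.card ≤ r})) fun S T h => by
    simp only [Subtype.mk.injEq] at h
    exact Subtype.ext (Finset.image_injective hn h)

/-! ### Concentration given the vertices -/

/-- The kernel `f` with the coordinates not indexed by vertices integrated out. -/
noncomputable def vertexKernel {q r : ℕ} (f : (Fin r → Fin q) → Cube r → ℝ)
    (p : Fin r → unitInterval × Fin q) : ℝ :=
  ∫ w : Cube r, f (fun j => (p j).2) (withVertices (fun j => (p j).1) w)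

section
variable {q r : ℕ} {f : (Fin r → Fin q) → Cube r → ℝ}

theorem abs_vertexKernel_le (hf1 : ∀ z x, |f z x| ≤ 1) (p : Fin r → unitInterval × Fin q) :
    |vertexKernel f p| ≤ 1 :=
  abs_integral_le_of_abs_le fun _ => hf1 _ _

theorem measurable_vertexKernel (hf : ∀ z, Measurable (f z)) : Measurable (vertexKernel f) := by
  have h1 : Measurable fun y : (Fin r → unitInterval) × (Fin r → Fin q) =>
      ∫ w : Cube r, f y.2 (withVertices y.1 w) := by
    refine measurable_from_prod_countable_left fun z => ?_
    exact (((hf z).comp (measurePreserving_withVertices (α := Fin r)).measurable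
      ).stronglyMeasurable.integral_prod_right' (ν := (volume : Measure (Cube r)))).measurable
  exact h1.comp (by fun_prop : Measurable fun p : Fin r → unitInterval × Fin q =>
    ((fun j => (p j).1), fun j => (p j).2))

/-- The energy of a fractional partition for the kernels `f`. -/
noncomputable def cubeEnergy (f : (Fin r → Fin q) → Cube r → ℝ)
    (φ : Fin q → unitInterval → ℝ) : ℝ :=
  ∑ z : Fin r → Fin q, ∫ x : Cube r, f z x * ∏ j, φ (z j) (x.vertex j)

/-- The colour weights depend on the vertex coordinates only, so Fubini integrates the remaining
coordinates out of f alone. -/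
theorem cubeEnergy_eq (hf : ∀ z, Measurable (f z)) (hf1 : ∀ z x, |f z x| ≤ 1)
    {φ : Fin q → unitInterval → ℝ} (hφ : IsFracPartition φ) :
    cubeEnergy f φ = ∫ p, vertexKernel f p ∂(Measure.pi fun _ => colourMeasure φ) := by
  rw [integral_pi_colourMeasure hφ (measurable_vertexKernel hf) (abs_vertexKernel_le hf1),
    cubeEnergy]
  refine Finset.sum_congr rfl fun z _ => ?_
  have hv : ∀ j, Measurable fun x : Cube r => x.vertex j := fun j => measurable_pi_apply _
  have hm : Measurable fun x : Cube r => f z x * ∏ j, φ (z j) (x.vertex j) :=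
    (hf z).mul (Finset.measurable_prod _ fun j _ => (hφ.measurable _).comp (hv j))
  have hmp := measurePreserving_withVertices (α := Fin r)
    (p := fun S : Finset (Fin r) => S.Nonempty)
  have hb : ∀ x : Cube r, |f z x * ∏ j, φ (z j) (x.vertex j)| ≤ 1 := fun x => by
    rw [abs_mul, Finset.abs_prod]
    refine mul_le_one₀ (hf1 z x) (Finset.prod_nonneg fun j _ => abs_nonneg _)
      (Finset.prod_le_one (fun j _ => abs_nonneg _) fun j _ => ?_)
    rw [abs_of_nonneg (hφ.mem_Icc _ _).1]
    exact (hφ.mem_Icc _ _).2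
  have e := integral_map (μ := (volume : Measure ((Fin r → unitInterval) × Cube r)))
    (f := fun x : Cube r => f z x * ∏ j, φ (z j) (x.vertex j))
    hmp.measurable.aemeasurable hm.aestronglyMeasurable
  rw [hmp.map_eq] at e
  rw [e, Measure.volume_eq_prod, integral_prod]
  · simp only [withVertices_vertex, integral_mul_const]
    rfl
  · exact integrable_of_abs_le (hm.comp hmp.measurable) fun y => hb _

/-- The energy of the colouring `χ` of a sample; `d` are the values on degenerate edges. -/
noncomputable def sampleEnergy {k : ℕ} (f : (Fin r → Fin q) → Cube r → ℝ)
    (d : (Fin r → Fin q) → ℝ) (U : Sample k r) (χ : Fin k → Fin q) : ℝ :=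
  (∑ n : Fin r → Fin k, if Function.Injective n then f (fun j => χ (n j)) (U.edgePoint n)
    else d fun j => χ (n j)) / (k : ℝ) ^ r

/-- The density of the edges having `S` as a face with at least two vertices. -/
noncomputable def faceDensity (k r : ℕ) (S : Finset (Fin k)) : ℝ :=
  ((Finset.univ.filter fun n : Fin r → Fin k => Function.Injective n ∧
    ∃ T : Finset (Fin r), T.Nonempty ∧ T.card ≠ 1 ∧ T.image n = S).card : ℝ) / (k : ℝ) ^ r

theorem faceDensity_nonneg (k r : ℕ) (S : Finset (Fin k)) : 0 ≤ faceDensity k r S := by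
  unfold faceDensity; positivity

/-- An injective edge with this face must contain two prescribed distinct vertices. If S has fewer
than two elements, there is no such edge. -/
theorem faceDensity_le {k : ℕ} (hk : 0 < k) (S : Finset (Fin k)) :
    faceDensity k r S ≤ r ^ 2 / k ^ 2 := by
  by_cases hS : 1 < S.card
  · obtain ⟨u, hu, v, hv, huv⟩ := Finset.one_lt_card.1 hS
    refine le_trans ?_ (card_hit_two_div_le hk huv)
    unfold faceDensity
    refine div_le_div_of_nonneg_right (Nat.cast_le.2 (Finset.card_le_card fun n hn => ?_))
      (by positivity)
    obtain ⟨-, T, -, -, hT⟩ := (Finset.mem_filter.1 hn).2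
    rw [← hT] at hu hv
    obtain ⟨i, -, hi⟩ := Finset.mem_image.1 hu
    obtain ⟨j, -, hj⟩ := Finset.mem_image.1 hv
    exact Finset.mem_filter.2 ⟨Finset.mem_univ _, ⟨i, hi⟩, j, hj⟩
  · have : (Finset.univ.filter fun n : Fin r → Fin k => Function.Injective n ∧
        ∃ T : Finset (Fin r), T.Nonempty ∧ T.card ≠ 1 ∧ T.image n = S) = ∅ := by
      refine Finset.filter_eq_empty_iff.2 fun n _ => ?_
      rintro ⟨hn, T, h1, h2, h3⟩
      have := Finset.card_image_of_injective T hn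
      rw [h3] at this
      have := h1.card_pos
      omega
    rw [faceDensity, this]
    simp
    positivity

/-- Double counting: every edge has at most 2^r faces. Combined with the uniform O(1/k²) bound, this
makes the sum of squared influences O(1/k²), although there are many coordinates. -/
theorem sum_faceDensity_le {k : ℕ} (hk : 0 < k) :
    ∑ S : Finset (Fin k), faceDensity k r S ≤ 2 ^ r := by
  have hkR : (0 : ℝ) < k := by exact_mod_cast hk
  unfold faceDensity
  rw [← Finset.sum_div, div_le_iff₀ (pow_pos hkR r)]
  have h1 : ∑ S : Finset (Fin k), (Finset.univ.filter fun n : Fin r → Fin k =>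
        Function.Injective n ∧
        ∃ T : Finset (Fin r), T.Nonempty ∧ T.card ≠ 1 ∧ T.image n = S).card
      ≤ ∑ _n : Fin r → Fin k, 2 ^ r := by
    simp_rw [Finset.card_filter]
    rw [Finset.sum_comm]
    refine Finset.sum_le_sum fun n _ => ?_
    rw [← Finset.card_filter]
    calc _ ≤ ((Finset.univ : Finset (Finset (Fin r))).image fun T => T.image n).card := by
          refine Finset.card_le_card fun S hS => ?_
          obtain ⟨-, T, -, -, hT⟩ := (Finset.mem_filter.1 hS).2
          exact Finset.mem_image.2 ⟨T, Finset.mem_univ _, hT⟩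
      _ ≤ (Finset.univ : Finset (Finset (Fin r))).card := Finset.card_image_le
      _ = 2 ^ r := by simp
  have h2 : (∑ _n : Fin r → Fin k, 2 ^ r : ℕ) = 2 ^ r * k ^ r := by
    simp [mul_comm]
  rw [h2] at h1
  exact_mod_cast h1

/-- For fixed vertices, the energy of a colouring concentrates. -/
theorem measureReal_sampleEnergy_withVertices {k : ℕ} (hk : 0 < k) (hr : 0 < r)
    (hf : ∀ z, Measurable (f z)) (hf1 : ∀ z x, |f z x| ≤ 1) {d : (Fin r → Fin q) → ℝ}
    (hd : ∀ z, |d z| ≤ 1) (χ : Fin k → Fin q) (t : Fin k → unitInterval) {s : ℝ} (hs : 0 ≤ s) :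
    (volume : Measure (Sample k r)).real
      {w | s + 2 * r ^ 2 / k ≤
        |sampleEnergy f d (withVertices t w) χ - vertexEnergy (vertexKernel f) t χ|}
      ≤ 2 * Real.exp (-(s ^ 2 * k ^ 2 / (2 ^ (r + 3) * r ^ 2))) := by
  classical
  have hkR : (0 : ℝ) < k := by exact_mod_cast hk
  have hrR : (0 : ℝ) < r := by exact_mod_cast hr
  have hkr : (0 : ℝ) < (k : ℝ) ^ r := pow_pos hkR r
  set g : (Fin r → Fin k) → Sample k r → ℝ := fun n w =>
    if Function.Injective n then
      f (fun j => χ (n j)) (withVertices (fun j => t (n j)) (Sample.edgePoint w n)) else 0 with hg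
  have hgm : ∀ n, Measurable (g n) := fun n => by
    by_cases hn : Function.Injective n
    · simp only [hg, hn, if_true]
      exact (hf _).comp ((measurePreserving_withVertices (α := Fin r)).measurable.comp
        (measurable_const.prodMk (measurePreserving_edgePoint hn).measurable))
    · simp only [hg, hn, if_false]; exact measurable_const
  have hg1 : ∀ n w, |g n w| ≤ 1 := fun n w => by
    simp only [hg]; split_ifs
    · exact hf1 _ _
    · simp
  set G : Sample k r → ℝ := fun w => (∑ n, g n w) / (k : ℝ) ^ r with hG
  have hGm : Measurable G := (Finset.measurable_sum _ fun n _ => hgm n).div_const _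
  have hGb : ∀ w, |G w| ≤ 1 := fun w => by
    simp only [hG]
    rw [abs_div, abs_of_pos hkr, div_le_one hkr]
    refine (Finset.abs_sum_le_sum_abs _ _).trans ((Finset.sum_le_sum fun n _ => hg1 n w).trans ?_)
    simp
  -- With the vertices fixed, changing the coordinate of S matters only to edges having S as a face
  -- with at least two vertices. The singleton coordinates of w have no influence.
  have hGd : ∀ (S : {S : Finset (Fin k) // S.Nonempty ∧ S.card ≤ r}) (w : Sample k r)
      (y : unitInterval), |G (Function.update w S y) - G w| ≤ 2 * faceDensity k r S.1 := by
    intro S w y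
    simp only [hG, faceDensity]
    rw [← sub_div, ← Finset.sum_sub_distrib, abs_div, abs_of_pos hkr, ← mul_div_assoc]
    gcongr
    refine (Finset.abs_sum_le_sum_abs _ _).trans ?_
    calc _ ≤ ∑ n : Fin r → Fin k, if Function.Injective n ∧
          ∃ T : Finset (Fin r), T.Nonempty ∧ T.card ≠ 1 ∧ T.image n = S.1 then (2 : ℝ) else 0 := by
          refine Finset.sum_le_sum fun n _ => ?_
          split_ifs with h
          · exact (abs_sub _ _).trans (by linarith [hg1 n (Function.update w S y), hg1 n w])
          · rw [abs_nonpos_iff, sub_eq_zero]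
            by_cases hn : Function.Injective n
            · simp only [hg, hn, if_true]
              congr 1
              funext T
              by_cases hT : T.1.card = 1
              · obtain ⟨j, hj⟩ := Finset.card_eq_one.1 hT
                simp only [withVertices, hj, singletonOr_singleton, Sum.elim_inl]
              · simp only [withVertices, singletonOr_of_card_ne hT, Sum.elim_inr,
                  Sample.edgePoint]
                rw [Function.update_of_ne]
                intro hcon
                exact h ⟨hn, T.1, T.2, hT, congrArg Subtype.val hcon⟩
            · simp only [hg, hn, if_false]
      _ = _ := by rw [← Finset.sum_filter]; simp [mul_comm]
  have hsq : ∑ S : {S : Finset (Fin k) // S.Nonempty ∧ S.card ≤ r},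
      (2 * faceDensity k r S.1) ^ 2 ≤ (2 : ℝ) ^ (r + 2) * (r : ℝ) ^ 2 / (k : ℝ) ^ 2 := by
    calc _ ≤ ∑ S : {S : Finset (Fin k) // S.Nonempty ∧ S.card ≤ r},
          4 * (r ^ 2 / k ^ 2) * faceDensity k r S.1 := by
          refine Finset.sum_le_sum fun S _ => ?_
          have h1 := faceDensity_le (r := r) hk S.1
          have h2 := faceDensity_nonneg k r S.1
          nlinarith [mul_le_mul_of_nonneg_right h1 h2]
      _ = 4 * (r ^ 2 / k ^ 2) * ∑ S : {S : Finset (Fin k) // S.Nonempty ∧ S.card ≤ r},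
          faceDensity k r S.1 := by rw [Finset.mul_sum]
      _ ≤ 4 * (r ^ 2 / k ^ 2) * 2 ^ r := by
          gcongr
          refine le_trans ?_ (sum_faceDensity_le (r := r) hk)
          refine le_of_eq_of_le (Finset.sum_map Finset.univ
            (Function.Embedding.subtype fun S : Finset (Fin k) => S.Nonempty ∧ S.card ≤ r)
            (faceDensity k r)).symm ?_
          exact Finset.sum_le_sum_of_subset_of_nonneg (Finset.subset_univ _)
            fun S _ _ => faceDensity_nonneg k r S
      _ = _ := by ring
  -- G puts 0 on edges with a repeated vertex, whereas `vertexEnergy` counts them; this costs r²/k.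
  -- The values d of `sampleEnergy` on such edges cost another r²/k in `hdiag`.
  have hmean : |(∫ w, G w) - vertexEnergy (vertexKernel f) t χ| ≤ r ^ 2 / k := by
    have hn : ∀ n, ∫ w, g n w = if Function.Injective n then
        vertexKernel f (fun j => (t (n j), χ (n j))) else 0 := fun n => by
      by_cases hn : Function.Injective n
      · have hmp := measurePreserving_edgePoint hn
        have e := integral_map (μ := (volume : Measure (Sample k r)))
          (f := fun x : Cube r => f (fun j => χ (n j)) (withVertices (fun j => t (n j)) x))
          hmp.measurable.aemeasurable
          ((hf _).comp ((measurePreserving_withVertices (α := Fin r)).measurable.comp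
            (measurable_const.prodMk measurable_id))).aestronglyMeasurable
        rw [hmp.map_eq] at e
        simp only [hg, hn, if_true, vertexKernel]
        exact e.symm
      · simp [hg, hn]
    have hmul : ∫ w, G w = (∑ n : Fin r → Fin k, if Function.Injective n then
        vertexKernel f (fun j => (t (n j), χ (n j))) else 0) / (k : ℝ) ^ r := by
      simp only [hG]
      rw [integral_div, integral_finsetSum _ fun n _ => integrable_of_abs_le (hgm n) (hg1 n)]
      simp only [hn]
    rw [hmul, vertexEnergy, ← sub_div, ← Finset.sum_sub_distrib, abs_div, abs_of_pos hkr]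
    refine le_trans ?_ (card_not_injective_div_le (r := r) hk)
    gcongr
    rw [Finset.card_filter]
    push_cast
    refine (Finset.abs_sum_le_sum_abs _ _).trans (Finset.sum_le_sum fun n _ => ?_)
    by_cases hn : Function.Injective n
    · simp [hn]
    · simp only [hn, if_false, zero_sub, abs_neg, not_false_eq_true, if_true]
      exact abs_vertexKernel_le hf1 _
  have hdiag : ∀ w, |sampleEnergy f d (withVertices t w) χ - G w| ≤ r ^ 2 / k := fun w => by
    simp only [sampleEnergy, hG]
    rw [← sub_div, ← Finset.sum_sub_distrib, abs_div, abs_of_pos hkr]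
    refine le_trans ?_ (card_not_injective_div_le (r := r) hk)
    gcongr
    rw [Finset.card_filter]
    push_cast
    refine (Finset.abs_sum_le_sum_abs _ _).trans (Finset.sum_le_sum fun n _ => ?_)
    by_cases hn : Function.Injective n
    · simp [hg, hn, edgePoint_withVertices t w hn]
    · simp only [hg, hn, if_false, sub_zero, not_false_eq_true, if_true]
      exact hd _
  have hV : (0 : ℝ) < 2 ^ (r + 2) * r ^ 2 / k ^ 2 := by positivity
  have hup := measureReal_ge_le_of_boundedDifferences (volume : Measure unitInterval) hGm hGb
    hGd hV hsq hs
  have hlo := measureReal_le_le_of_boundedDifferences (volume : Measure unitInterval) hGm hGb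
    hGd hV hsq hs
  have hexp : -s ^ 2 / (2 * (2 ^ (r + 2) * (r : ℝ) ^ 2 / k ^ 2))
      = -(s ^ 2 * k ^ 2 / (2 ^ (r + 3) * r ^ 2)) := by
    field_simp
    ring
  rw [hexp] at hup hlo
  refine (measureReal_mono ?_ (measure_ne_top _ _)).trans
    ((measureReal_union_le _ _).trans ((add_le_add hup hlo).trans_eq (two_mul _).symm))
  intro w hw
  simp only [Set.mem_ofPred_eq] at hw
  have h1 := abs_le.1 (hdiag w)
  have h2 := abs_le.1 hmean
  have e : ∫ y, G y ∂(Measure.pi fun _ => (volume : Measure unitInterval)) = ∫ w, G w := rfl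
  simp only [Set.mem_union, Set.mem_ofPred_eq]
  rw [e]
  have e2 : 2 * (r : ℝ) ^ 2 / k = r ^ 2 / k + r ^ 2 / k := by ring
  rw [e2] at hw
  rcases le_abs.1 hw with h | h
  · left; linarith [h1.2, h2.2]
  · right; linarith [h1.1, h2.1]

/-- With high probability, the energies of all colourings of the sample are close to those given
by the averaged kernel. -/
theorem measureReal_sampleEnergy_sub_le {k : ℕ} (hk : 0 < k) (hr : 1 ≤ r)
    (hf : ∀ z, Measurable (f z)) (hf1 : ∀ z x, |f z x| ≤ 1) {d : (Fin r → Fin q) → ℝ}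
    (hd : ∀ z, |d z| ≤ 1) {s : ℝ} (hs : 0 ≤ s) :
    (volume : Measure (Sample k r)).real
      {U | ∃ χ, s + 2 * r ^ 2 / k ≤
        |sampleEnergy f d U χ - vertexEnergy (vertexKernel f) (Sample.vertices hr U) χ|}
      ≤ (q : ℝ) ^ k * (2 * Real.exp (-(s ^ 2 * k ^ 2 / (2 ^ (r + 3) * r ^ 2)))) := by
  have hsplit : {U : Sample k r | ∃ χ, s + 2 * r ^ 2 / k ≤
        |sampleEnergy f d U χ - vertexEnergy (vertexKernel f) (Sample.vertices hr U) χ|}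
      = ⋃ χ, {U | s + 2 * r ^ 2 / k ≤
        |sampleEnergy f d U χ - vertexEnergy (vertexKernel f) (Sample.vertices hr U) χ|} := by
    ext U; simp
  rw [hsplit]
  -- The union bound over q^k colourings is harmless here because the exponent is quadratic in k.
  refine (measureReal_iUnion_fintype_le _).trans ?_
  refine (Finset.sum_le_sum (g := fun _ =>
    2 * Real.exp (-(s ^ 2 * k ^ 2 / (2 ^ (r + 3) * r ^ 2)))) fun χ _ => ?_).trans
    (by simp)
  have hmp := measurePreserving_withVertices (α := Fin k)
    (p := fun S : Finset (Fin k) => S.Nonempty ∧ S.card ≤ r)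
  have hm : Measurable fun U : Sample k r =>
      |sampleEnergy f d U χ - vertexEnergy (vertexKernel f) (Sample.vertices hr U) χ| := by
    refine Measurable.abs (Measurable.sub ?_ ?_)
    · refine (Finset.measurable_sum _ fun n _ => ?_).div_const _
      by_cases hn : Function.Injective n
      · simp only [hn, if_true]
        exact (hf _).comp (measurePreserving_edgePoint hn).measurable
      · simp only [hn, if_false]; exact measurable_const
    · exact (measurable_vertexEnergy (measurable_vertexKernel hf) χ).comp
        (measurePreserving_vertices hr).measurable
  have hset := measurableSet_le (measurable_const (a := s + 2 * (r : ℝ) ^ 2 / k)) hm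
  set δ := 2 * Real.exp (-(s ^ 2 * k ^ 2 / (2 ^ (r + 3) * (r : ℝ) ^ 2))) with hδ
  have hδ0 : 0 ≤ δ := by positivity
  refine ENNReal.toReal_le_of_le_ofReal hδ0 ?_
  rw [← hmp.measure_preimage hset.nullMeasurableSet, Measure.volume_eq_prod,
    Measure.prod_apply (hmp.measurable hset)]
  refine (lintegral_mono fun t => ?_ : _ ≤ ∫⁻ _t : Fin k → unitInterval, ENNReal.ofReal δ).trans
    (by simp)
  refine (ENNReal.le_ofReal_iff_toReal_le (measure_ne_top _ _) hδ0).2 ?_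
  have := measureReal_sampleEnergy_withVertices hk hr hf hf1 hd χ t hs
  refine le_of_eq_of_le ?_ this
  rw [measureReal_def]
  congr 2
  ext w
  simp only [Set.mem_preimage, Set.mem_ofPred_eq, vertices_withVertices]

end

theorem omega_nonempty {q : ℕ} {a : Fin q → ℝ} (ha : a ∈ stdSimplex ℝ (Fin q)) :
    (Omega a).Nonempty := by
  refine ⟨fun i _ => a i, ⟨fun i => measurable_const, fun i _ => ⟨ha.1 i, ?_⟩, fun _ => ha.2⟩,
    fun i => by simp⟩
  rw [← ha.2]
  exact Finset.single_le_sum (fun j _ => ha.1 j) (Finset.mem_univ i)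

/-! ### Combining the two directions -/

/-- Deviation bound for the ground state energies, with explicit parameters. -/
theorem measureReal_groundState_sub_gt_le {k q r m : ℕ} (hr : 1 ≤ r) (hq : 1 ≤ q) (hk : 0 < k)
    (hm : 0 < m) {a : Fin q → ℝ} (ha : a ∈ stdSimplex ℝ (Fin q))
    {f : (Fin r → Fin q) → Cube r → ℝ} {d : (Fin r → Fin q) → ℝ}
    (hf : ∀ z, Measurable (f z)) (hf1 : ∀ z x, |f z x| ≤ 1) (hd : ∀ z, |d z| ≤ 1)
    {δ : ℝ} (hδ : 0 < δ) (hδ1 : δ ≤ 1)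
    (hmδ : 2 / √(m : ℝ) ≤ δ / 4) (hmk : 2 * (r * m) / (k : ℝ) ≤ δ / 4)
    (hqk : q / (k : ℝ) ≤ δ / 4) (hkδ : 2 * r ^ 2 / k + 2 * r * (q / √k + q / k) ≤ δ / 2) :
    (volume : Measure (Sample k r)).real
      {U | (3 * r * (q : ℝ) ^ r + r + 4) * δ < |sSup (cubeEnergy f '' Omega a)
        - sSup (sampleEnergy f d U '' (balanced k a : Set (Fin k → Fin q)))|}
      ≤ (q : ℝ) ^ k * (2 * Real.exp (-(δ ^ 2 * k ^ 2 / (2 ^ (r + 3) * r ^ 2))))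
        + (((k : ℝ) * q) ^ (r * m) * Real.exp (-(k * δ ^ 2 / 128))
        + Real.exp (-(k * δ ^ 2 / (32 * r ^ 2)))) := by
  set F := vertexKernel f with hF
  have hFm : Measurable F := measurable_vertexKernel hf
  have hF1 : ∀ p, |F p| ≤ 1 := abs_vertexKernel_le hf1
  set E := sSup (cubeEnergy f '' Omega a) with hE
  have hprob : ∀ φ ∈ Omega a, IsProbabilityMeasure (colourMeasure φ) := fun φ hφ => by
    have : Fact (IsFracPartition φ) := ⟨hφ.1⟩
    infer_instance
  have hbdd : BddAbove (cubeEnergy f '' Omega a) := by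
    refine ⟨1, ?_⟩
    rintro _ ⟨φ, hφ, rfl⟩
    have := hprob φ hφ
    rw [cubeEnergy_eq hf hf1 hφ.1]
    exact (le_abs_self _).trans (abs_integral_le_of_abs_le hF1)
  have hEle : ∀ φ ∈ Omega a, ∫ x, F x ∂(Measure.pi fun _ => colourMeasure φ) ≤ E := fun φ hφ => by
    rw [← cubeEnergy_eq hf hf1 hφ.1]
    exact le_csSup hbdd ⟨φ, hφ, rfl⟩
  obtain ⟨_, ⟨φ, hφ, rfl⟩, hφE⟩ := exists_lt_of_lt_csSup ((omega_nonempty ha).image (cubeEnergy f))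
    (sub_lt_self E hδ)
  rw [cubeEnergy_eq hf hf1 hφ.1] at hφE
  have h1 := measureReal_sampleEnergy_sub_le hk hr hf hf1 hd hδ.le
  have h2 := measureReal_vertexEnergy_gt_le hr hq hk hm ha hFm hF1 hδ hδ1 hEle hmδ hmk hqk
  have h3 := measureReal_vertexEnergy_lt_le hr hk ha hFm hF1 hφ hδ hkδ
  -- The inequality for outer measures suffices, so measurability of the exceptional events is not
  -- needed.
  have hpull : ∀ S : Set (Fin k → unitInterval),
      (volume : Measure (Sample k r)).real {U | Sample.vertices hr U ∈ S}
        ≤ (volume : Measure (Fin k → unitInterval)).real S := fun S => by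
    have hmp := measurePreserving_vertices (k := k) hr
    have := Measure.le_map_apply (μ := (volume : Measure (Sample k r)))
      hmp.measurable.aemeasurable S
    rw [hmp.map_eq] at this
    exact ENNReal.toReal_mono (measure_ne_top _ _) this
  refine (measureReal_mono (fun U hU => ?_) (measure_ne_top _ _)).trans
    ((measureReal_union_le _ _).trans (add_le_add h1 ((measureReal_union_le _ _).trans
      (add_le_add ((hpull _).trans h2) ((hpull _).trans h3)))))
  by_contra hcon
  simp only [Set.mem_union, not_or, Set.mem_ofPred_eq] at hcon hU
  obtain ⟨c1, c2, c3⟩ := hcon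
  push Not at c1 c2 c3
  obtain ⟨χ₁, hχ₁, hge⟩ := c3
  have hrk : 2 * (r : ℝ) ^ 2 / k ≤ δ := by
    have : 0 ≤ 2 * (r : ℝ) * (q / √k + q / k) := by positivity
    linarith
  have hne : (sampleEnergy f d U '' (balanced k a : Set (Fin k → Fin q))).Nonempty :=
    ⟨_, χ₁, hχ₁, rfl⟩
  -- Passing to the averaged kernel costs δ + 2r²/k ≤ 2δ. The lower bound loses δ more for the
  -- choice of φ and δ more for the sampled maximum.
  have hup : sSup (sampleEnergy f d U '' (balanced k a : Set (Fin k → Fin q)))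
      ≤ E + (3 * r * (q : ℝ) ^ r + r) * δ + 2 * δ := by
    refine csSup_le hne ?_
    rintro _ ⟨χ, hχ, rfl⟩
    have e1 := (abs_lt.1 (c1 χ)).2
    have e2 := c2 χ hχ
    linarith
  have hlo : E - 4 * δ ≤ sSup (sampleEnergy f d U '' (balanced k a : Set (Fin k → Fin q))) := by
    refine le_trans ?_ (le_csSup (((balanced k a).finite_toSet.image _).bddAbove) ⟨χ₁, hχ₁, rfl⟩)
    have e1 := (abs_lt.1 (c1 χ₁)).1
    linarith
  have hpos : 0 ≤ (3 * r * (q : ℝ) ^ r + r) * δ := by positivity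
  refine absurd hU (not_lt.2 (abs_le.2 ⟨?_, ?_⟩))
  · linarith
  · linarith

/-! ### Choice of parameters -/

/-- The constant in the sample size. -/
noncomputable def sampleConstant (r q : ℕ) : ℝ :=
  let Λ : ℝ := 3 * r * (q : ℝ) ^ r + r + 4
  let B : ℝ := 256 * (65 * r * Λ ^ 2) * Λ ^ 2
  520 * r * Λ ^ 2 * Λ + 4 * q * Λ + (2 * Λ * (2 * r ^ 2 + 4 * r * q)) ^ 2 + 64 * r ^ 2 * Λ ^ 2
    + Λ ^ 2 * 2 ^ (r + 3) * r ^ 2 * (q + 3) + 2 * B * (2 * B * q + 4) + 512 * Λ ^ 2 + 1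

-- All conditions hold with δ = ε/Λ and m of order δ^-2. Each of the constants t₁, …, t₇ secures one
-- requirement on k, and adding them secures all at once.
set_option maxHeartbeats 800000 in
theorem parameters_spec {r q : ℕ} (hr : 1 ≤ r) (hq : 1 ≤ q) {ε : ℝ} (hε : 0 < ε) (hε4 : ε ≤ 1 / 4)
    {k : ℕ} (hk : sampleConstant r q * ((ε ^ 4)⁻¹ * Real.log ε⁻¹) ≤ k) :
    ∃ (m : ℕ) (δ : ℝ), 0 < k ∧ 0 < m ∧ 0 < δ ∧ δ ≤ 1 ∧ (3 * r * (q : ℝ) ^ r + r + 4) * δ = ε ∧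
      2 / √(m : ℝ) ≤ δ / 4 ∧ 2 * (r * m) / (k : ℝ) ≤ δ / 4 ∧ q / (k : ℝ) ≤ δ / 4 ∧
      2 * r ^ 2 / k + 2 * r * (q / √k + q / k) ≤ δ / 2 ∧
      (q : ℝ) ^ k * (2 * Real.exp (-(δ ^ 2 * k ^ 2 / (2 ^ (r + 3) * r ^ 2))))
        + (((k : ℝ) * q) ^ (r * m) * Real.exp (-(k * δ ^ 2 / 128))
        + Real.exp (-(k * δ ^ 2 / (32 * r ^ 2)))) < ε := by
  have hr1 : (1 : ℝ) ≤ r := by exact_mod_cast hr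
  have hq1 : (1 : ℝ) ≤ q := by exact_mod_cast hq
  obtain ⟨Λ, hΛ⟩ : ∃ Λ : ℝ, Λ = 3 * r * (q : ℝ) ^ r + r + 4 := ⟨_, rfl⟩
  obtain ⟨A, hA⟩ : ∃ A : ℝ, A = 65 * r * Λ ^ 2 := ⟨_, rfl⟩
  obtain ⟨B, hB⟩ : ∃ B : ℝ, B = 256 * A * Λ ^ 2 := ⟨_, rfl⟩
  obtain ⟨L, hL⟩ : ∃ L : ℝ, L = Real.log ε⁻¹ := ⟨_, rfl⟩
  obtain ⟨t₁, ht₁⟩ : ∃ t : ℝ, t = 520 * r * Λ ^ 2 * Λ := ⟨_, rfl⟩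
  obtain ⟨t₂, ht₂⟩ : ∃ t : ℝ, t = 4 * q * Λ := ⟨_, rfl⟩
  obtain ⟨t₃, ht₃⟩ : ∃ t : ℝ, t = (2 * Λ * (2 * r ^ 2 + 4 * r * q)) ^ 2 := ⟨_, rfl⟩
  obtain ⟨t₄, ht₄⟩ : ∃ t : ℝ, t = 64 * r ^ 2 * Λ ^ 2 := ⟨_, rfl⟩
  obtain ⟨t₅, ht₅⟩ : ∃ t : ℝ, t = Λ ^ 2 * 2 ^ (r + 3) * r ^ 2 * (q + 3) := ⟨_, rfl⟩
  obtain ⟨t₆, ht₆⟩ : ∃ t : ℝ, t = 2 * B * (2 * B * q + 4) := ⟨_, rfl⟩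
  obtain ⟨t₇, ht₇⟩ : ∃ t : ℝ, t = 512 * Λ ^ 2 := ⟨_, rfl⟩
  have hT : sampleConstant r q = t₁ + t₂ + t₃ + t₄ + t₅ + t₆ + t₇ + 1 := by
    rw [ht₁, ht₂, ht₃, ht₄, ht₅, ht₆, ht₇, hB, hA, hΛ, sampleConstant]
  rw [hT, ← hL] at hk
  rw [← hΛ]
  have hqr : (1 : ℝ) ≤ (q : ℝ) ^ r := one_le_pow₀ hq1
  have hΛ1 : 1 ≤ Λ := by
    have : 0 ≤ 3 * r * (q : ℝ) ^ r + r := by positivity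
    linarith only [hΛ, this]
  have hA0 : 0 < A := by rw [hA]; positivity
  have hB0 : 0 < B := by rw [hB]; positivity
  -- The bound ε ≤ 1/4 is used here: log 4 ≥ 1. Lower bounds on k without a logarithm may then be
  -- strengthened by a factor L.
  have hL1 : 1 ≤ L := by
    rw [hL, Real.le_log_iff_exp_le (by positivity), le_inv_comm₀ (Real.exp_pos _) hε]
    refine hε4.trans ?_
    rw [one_div, inv_le_inv₀ (by norm_num) (Real.exp_pos _)]
    linarith [Real.exp_one_lt_d9]
  have hεL : Real.exp (-L) = ε := by rw [hL, Real.log_inv, neg_neg, Real.exp_log hε]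
  have hε1 : ε ≤ 1 := by linarith
  have hX : L ≤ (ε ^ 4)⁻¹ * L :=
    le_mul_of_one_le_left (by linarith) ((one_le_inv₀ (by positivity)).2 (pow_le_one₀ hε.le hε1))
  have p₁ : 0 ≤ t₁ := by rw [ht₁]; positivity
  have p₂ : 0 ≤ t₂ := by rw [ht₂]; positivity
  have p₃ : 0 ≤ t₃ := by rw [ht₃]; positivity
  have p₄ : 0 ≤ t₄ := by rw [ht₄]; positivity
  have p₅ : 0 ≤ t₅ := by rw [ht₅]; positivity
  have p₆ : 0 ≤ t₆ := by rw [ht₆]; positivity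
  have p₇ : 0 ≤ t₇ := by rw [ht₇]; positivity
  have hkL : ∀ t, t ≤ t₁ + t₂ + t₃ + t₄ + t₅ + t₆ + t₇ + 1 → t * L ≤ k * ε ^ 4 := by
    intro t ht
    have h1 : t * ((ε ^ 4)⁻¹ * L) ≤ k := (mul_le_mul_of_nonneg_right ht (by positivity)).trans hk
    have h2 : t * ((ε ^ 4)⁻¹ * L) * ε ^ 4 ≤ k * ε ^ 4 := by gcongr
    calc t * L = t * ((ε ^ 4)⁻¹ * L) * ε ^ 4 := by field_simp
      _ ≤ _ := h2
  have hk1 : ∀ t, 0 ≤ t → t ≤ t₁ + t₂ + t₃ + t₄ + t₅ + t₆ + t₇ + 1 → t ≤ k * ε ^ 4 :=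
    fun t h0 ht => (le_mul_of_one_le_right h0 hL1).trans (hkL t ht)
  have hkpos : (0 : ℝ) < k := by
    have := hk1 1 zero_le_one (by linarith only [p₁, p₂, p₃, p₄, p₅, p₆, p₇])
    by_contra hcon
    push Not at hcon
    have : (k : ℝ) * ε ^ 4 ≤ 0 := mul_nonpos_of_nonpos_of_nonneg hcon (by positivity)
    linarith
  have hLk : L ≤ k := by
    have := hkL 1 (by linarith only [p₁, p₂, p₃, p₄, p₅, p₆, p₇])
    have h2 : (k : ℝ) * ε ^ 4 ≤ k * 1 := by gcongr; exact pow_le_one₀ hε.le hε1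
    linarith
  have e21 : ε ^ 2 ≤ ε := pow_le_of_le_one hε.le hε1 two_ne_zero
  have e42 : ε ^ 4 ≤ ε ^ 2 := pow_le_pow_of_le_one hε.le hε1 (by norm_num)
  have e41 : ε ^ 4 ≤ ε := e42.trans e21
  have hk2 : ∀ t, t ≤ t₁ + t₂ + t₃ + t₄ + t₅ + t₆ + t₇ + 1 → t * L ≤ k * ε ^ 2 := fun t ht =>
    (hkL t ht).trans (by gcongr)
  obtain ⟨δ, hδdef⟩ : ∃ δ, δ = ε / Λ := ⟨_, rfl⟩
  have hδ : 0 < δ := by rw [hδdef]; positivity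
  have hδε : δ ≤ ε := by rw [hδdef]; exact div_le_self hε.le hΛ1
  have hδ2 : δ ^ 2 = ε ^ 2 / Λ ^ 2 := by rw [hδdef, div_pow]
  -- The value 64/δ² is exactly what makes 2/√m ≤ δ/4.
  refine ⟨⌈64 / δ ^ 2⌉₊, δ, by exact_mod_cast hkpos, Nat.ceil_pos.2 (by positivity), hδ,
    hδε.trans hε1, by rw [hδdef]; field_simp, ?_⟩
  set m := ⌈64 / δ ^ 2⌉₊ with hm
  have hm1 : 64 / δ ^ 2 ≤ m := Nat.le_ceil _
  have hm2 : (m : ℝ) * ε ^ 2 ≤ 65 * Λ ^ 2 := by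
    have h1 : (m : ℝ) < 64 / δ ^ 2 + 1 := Nat.ceil_lt_add_one (by positivity)
    have h2 : 64 / δ ^ 2 * ε ^ 2 = 64 * Λ ^ 2 := by rw [hδ2]; field_simp
    have h3 : (m : ℝ) * ε ^ 2 ≤ (64 / δ ^ 2 + 1) * ε ^ 2 := by gcongr
    have h4 : 1 ≤ Λ ^ 2 := one_le_pow₀ hΛ1
    linarith only [h2, h3, h4, e21, hε1]
  refine ⟨?_, ?_, ?_, ?_, ?_⟩
  · have h1 : 8 / δ ≤ √(m : ℝ) := by
      refine Real.le_sqrt_of_sq_le (le_trans (le_of_eq ?_) hm1)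
      rw [div_pow]; norm_num
    have hs0 : 0 < √(m : ℝ) := lt_of_lt_of_le (by positivity) h1
    rw [div_le_iff₀ hδ] at h1
    rw [div_le_div_iff₀ hs0 (by norm_num)]
    linarith
  · rw [div_le_div_iff₀ hkpos (by norm_num), hδdef, div_mul_eq_mul_div, le_div_iff₀ (by positivity)]
    have h1 := hk1 t₁ p₁ (by linarith only [p₁, p₂, p₃, p₄, p₅, p₆, p₇])
    have h2 : 8 * r * Λ * (m * ε ^ 2) ≤ t₁ := by
      have : 8 * r * Λ * (m * ε ^ 2) ≤ 8 * r * Λ * (65 * Λ ^ 2) := by gcongr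
      refine this.trans (le_of_eq ?_); rw [ht₁]; ring
    have h3 : (2 * (r * m) * 4 * Λ) * ε ^ 2 ≤ (ε * k) * ε ^ 2 := by
      have h4 : (k : ℝ) * ε ^ 4 ≤ (ε * k) * ε ^ 2 := by
        have : (k : ℝ) * ε ^ 3 * ε ≤ k * ε ^ 3 * 1 := by gcongr
        linarith only [this]
      linarith only [h1, h2, h4]
    exact le_of_mul_le_mul_right h3 (by positivity)
  · rw [div_le_div_iff₀ hkpos (by norm_num), hδdef, div_mul_eq_mul_div, le_div_iff₀ (by positivity)]
    have h1 := hk1 t₂ p₂ (by linarith only [p₁, p₂, p₃, p₄, p₅, p₆, p₇])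
    have h2 : (k : ℝ) * ε ^ 4 ≤ k * ε := by gcongr
    rw [ht₂] at h1
    linarith only [h1, h2]
  · set s := √(k : ℝ) with hs
    have hss : s ^ 2 = k := Real.sq_sqrt hkpos.le
    have hs0 : 0 < s := Real.sqrt_pos.2 hkpos
    have h1 := hk1 t₃ p₃ (by linarith only [p₁, p₂, p₃, p₄, p₅, p₆, p₇])
    have h2 : 2 * Λ * (2 * r ^ 2 + 4 * r * q) ≤ s * ε ^ 2 := by
      refine le_of_sq_le_sq ?_ (by positivity)
      rw [← ht₃, mul_pow, hss]
      calc t₃ ≤ k * ε ^ 4 := h1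
        _ = k * (ε ^ 2) ^ 2 := by ring
    have hs1 : 1 ≤ s := by
      have : (1 : ℝ) ≤ s * ε ^ 2 := by
        refine le_trans ?_ h2
        have h6 : 1 ≤ (r : ℝ) * q := one_le_mul_of_one_le_of_one_le hr1 hq1
        have h7 : 1 ≤ 2 * (r : ℝ) ^ 2 + 4 * r * q := by linarith only [h6, sq_nonneg (r : ℝ)]
        exact one_le_mul_of_one_le_of_one_le (by linarith only [hΛ1]) h7
      have h5 : s * ε ^ 2 ≤ s * 1 := by gcongr; linarith
      linarith
    have hks : (1 : ℝ) / k ≤ 1 / s := by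
      rw [← hss]
      exact one_div_le_one_div_of_le hs0 (le_self_pow₀ hs1 two_ne_zero)
    have h3 : 2 * (r : ℝ) ^ 2 / k + 2 * r * (q / s + q / k) ≤ (2 * r ^ 2 + 4 * r * q) / s := by
      have e1 : 2 * (r : ℝ) ^ 2 / k + 2 * r * (q / s + q / k)
        = (2 * r ^ 2 + 2 * r * q) * (1 / k) + 2 * r * q * (1 / s) := by ring
      have e2 : (2 * (r : ℝ) ^ 2 + 4 * r * q) / s
        = (2 * r ^ 2 + 2 * r * q) * (1 / s) + 2 * r * q * (1 / s) := by ring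
      rw [e1, e2]
      gcongr
    refine h3.trans ?_
    rw [div_le_div_iff₀ hs0 two_pos, hδdef, div_mul_eq_mul_div, le_div_iff₀ (by positivity)]
    have h4 : s * ε ^ 2 ≤ s * ε := by gcongr
    linarith only [h2, h4]
  · have n1 : Real.exp (-(k * δ ^ 2 / (32 * r ^ 2))) ≤ ε ^ 2 := by
      rw [← hεL, ← Real.exp_nat_mul, Real.exp_le_exp]
      push_cast
      have h1 := hk2 t₄ (by linarith only [p₁, p₂, p₃, p₄, p₅, p₆, p₇])
      rw [hδ2]
      have h2 : 2 * L ≤ k * (ε ^ 2 / Λ ^ 2) / (32 * r ^ 2) := by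
        rw [le_div_iff₀ (by positivity), ← mul_div_assoc, le_div_iff₀ (by positivity)]
        refine le_trans (le_of_eq ?_) h1
        rw [ht₄]; ring
      linarith only [h2]
    have n2 : (q : ℝ) ^ k * (2 * Real.exp (-(δ ^ 2 * k ^ 2 / (2 ^ (r + 3) * r ^ 2))))
        ≤ 2 * ε ^ 3 := by
      have hqe : (q : ℝ) ^ k ≤ Real.exp (k * q) := by
        rw [Real.exp_nat_mul]
        gcongr
        linarith [Real.add_one_le_exp (q : ℝ)]
      have h1 := hk2 t₅ (by linarith only [p₁, p₂, p₃, p₄, p₅, p₆, p₇])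
      have h2 : k * (q + 3 : ℝ) ≤ δ ^ 2 * k ^ 2 / (2 ^ (r + 3) * r ^ 2) := by
        rw [le_div_iff₀ (by positivity), hδ2, div_mul_eq_mul_div, le_div_iff₀ (by positivity)]
        have h3 : t₅ ≤ k * ε ^ 2 := (le_mul_of_one_le_right p₅ hL1).trans h1
        have h4 : k * t₅ ≤ k * (k * ε ^ 2) := by gcongr
        rw [ht₅] at h4
        linarith only [h4]
      calc (q : ℝ) ^ k * (2 * Real.exp (-(δ ^ 2 * k ^ 2 / (2 ^ (r + 3) * r ^ 2))))
          ≤ Real.exp (k * q) * (2 * Real.exp (-(k * (q + 3)))) := by gcongr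
        _ = 2 * Real.exp (-(3 * k)) := by
          rw [mul_left_comm, ← Real.exp_add]; congr 2; ring
        _ ≤ 2 * Real.exp (3 * -L) := by gcongr; linarith
        _ = 2 * ε ^ 3 := by
          rw [← hεL, ← Real.exp_nat_mul]; norm_num
    have n3 : ((k : ℝ) * q) ^ (r * m) * Real.exp (-(k * δ ^ 2 / 128)) ≤ ε ^ 2 := by
      have hkq : (0 : ℝ) < k * q := by positivity
      -- This breaks the circularity between k and log k. Factoring kq as (kε⁴/2B)(2Bqε^-4) and
      -- using log x ≤ x - 1 on the first factor and on 2Bq leaves only the explicit term 4L.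
      have hlog : Real.log (k * q) ≤ k * ε ^ 4 / B := by
        have h1 : (k : ℝ) * q = (k * ε ^ 4 / (2 * B)) * (2 * B * q * (ε⁻¹) ^ 4) := by
          field_simp
        rw [h1, Real.log_mul (by positivity) (by positivity),
          Real.log_mul (by positivity) (by positivity), Real.log_pow, ← hL]
        have h2 := Real.log_le_sub_one_of_pos (show 0 < (k : ℝ) * ε ^ 4 / (2 * B) by positivity)
        have h3 := Real.log_le_sub_one_of_pos (show 0 < 2 * B * (q : ℝ) by positivity)
        have h4 := hkL t₆ (by linarith only [p₁, p₂, p₃, p₄, p₅, p₆, p₇])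
        have h5 : 2 * B * q + 4 * L ≤ k * ε ^ 4 / (2 * B) := by
          rw [le_div_iff₀ (by positivity)]
          refine le_trans ?_ h4
          rw [ht₆]
          have : 2 * B * (q : ℝ) ≤ 2 * B * q * L := le_mul_of_one_le_right (by positivity) hL1
          calc (2 * B * q + 4 * L) * (2 * B) ≤ (2 * B * q * L + 4 * L) * (2 * B) := by gcongr
            _ = 2 * B * (2 * B * q + 4) * L := by ring
        have h6 : (k : ℝ) * ε ^ 4 / B = k * ε ^ 4 / (2 * B) + k * ε ^ 4 / (2 * B) := by
          field_simp; ring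
        rw [h6]
        push_cast
        linarith only [h2, h3, h5]
      -- The number of seed choices uses up half of the exponent kδ²/128; the other half yields the
      -- factor ε².
      have hrm : (r * m : ℝ) * Real.log (k * q) ≤ k * δ ^ 2 / 256 := by
        have h1 : (r * m : ℝ) * ε ^ 2 ≤ A := by
          rw [hA]
          calc (r * m : ℝ) * ε ^ 2 = r * (m * ε ^ 2) := by ring
            _ ≤ r * (65 * Λ ^ 2) := by gcongr
            _ = 65 * r * Λ ^ 2 := by ring
        have hrm0 : (0 : ℝ) ≤ r * m := by positivity
        calc (r * m : ℝ) * Real.log (k * q) ≤ (r * m : ℝ) * (k * ε ^ 4 / B) := by gcongr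
          _ = (r * m * ε ^ 2) * (k * ε ^ 2 / B) := by ring
          _ ≤ A * (k * ε ^ 2 / B) := by gcongr
          _ = k * δ ^ 2 / 256 := by rw [hB, hδ2]; field_simp
      have h7 := hk2 t₇ (by linarith only [p₁, p₂, p₃, p₄, p₅, p₆, p₇])
      have h8 : 2 * L ≤ k * δ ^ 2 / 256 := by
        rw [hδ2, le_div_iff₀ (by norm_num), ← mul_div_assoc, le_div_iff₀ (by positivity)]
        refine le_trans (le_of_eq ?_) h7
        rw [ht₇]; ring
      have h9 : ((k : ℝ) * q) ^ (r * m) = Real.exp ((r * m : ℝ) * Real.log (k * q)) := by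
        have : (r * m : ℝ) = ((r * m : ℕ) : ℝ) := by push_cast; rfl
        rw [this, Real.exp_nat_mul, Real.exp_log hkq]
      rw [h9, ← Real.exp_add, ← hεL, ← Real.exp_nat_mul, Real.exp_le_exp]
      push_cast
      linarith only [hrm, h8]
    have e2 : ε ^ 2 ≤ ε / 4 := by nlinarith only [hε, hε4]
    have e3 : ε ^ 3 ≤ ε / 16 := by nlinarith only [e2, hε, hε4]
    linarith only [n1, n2, n3, e2, e3, hε]

/-- The number of sampled vertices sufficient for precision `ε`. -/
noncomputable def sampleSize (r q : ℕ) (ε : ℝ) : ℕ :=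
  -- Capping at 1/4 keeps the logarithm at least 1 and covers large ε through the stronger statement
  -- at 1/4.
  ⌈sampleConstant r q * (((min ε (1 / 4)) ^ 4)⁻¹ * Real.log (min ε (1 / 4))⁻¹)⌉₊

theorem sampleConstant_nonneg (r q : ℕ) : 0 ≤ sampleConstant r q := by
  rw [sampleConstant]; positivity

theorem isBigO_sampleSize (r q : ℕ) :
    (fun ε : ℝ => (sampleSize r q ε : ℝ)) =O[𝓝[>] (0 : ℝ)]
      (fun ε : ℝ => (ε ^ 4)⁻¹ * Real.log ε⁻¹) := by
  refine IsBigO.of_bound (sampleConstant r q + 1) ?_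
  filter_upwards [Ioo_mem_nhdsGT (show (0 : ℝ) < 1 / 4 by norm_num)] with ε hε
  have h1 : 1 ≤ Real.log ε⁻¹ := by
    rw [Real.le_log_iff_exp_le (inv_pos.2 hε.1), le_inv_comm₀ (Real.exp_pos _) hε.1]
    refine hε.2.le.trans ?_
    rw [one_div, inv_le_inv₀ (by norm_num) (Real.exp_pos _)]
    linarith [Real.exp_one_lt_d9]
  have h2 : 1 ≤ (ε ^ 4)⁻¹ :=
    (one_le_inv₀ (pow_pos hε.1 4)).2 (pow_le_one₀ hε.1.le (by linarith [hε.2]))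
  have h3 := one_le_mul_of_one_le_of_one_le h2 h1
  have h4 := Nat.ceil_lt_add_one
    (mul_nonneg (sampleConstant_nonneg r q) (zero_le_one.trans h3))
  rw [Real.norm_of_nonneg (Nat.cast_nonneg _), Real.norm_of_nonneg (zero_le_one.trans h3),
    sampleSize, min_eq_left hε.2.le]
  linarith

theorem sSup_image_const_mul {α : Type*} {B : ℝ} (hB : 0 ≤ B) (h : α → ℝ) (S : Set α) :
    sSup ((fun x => B * h x) '' S) = B * sSup (h '' S) := by
  rw [← smul_eq_mul, ← Real.sSup_smul_of_nonneg hB, ← Set.image_smul, Set.image_image]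
  rfl

/-- Both energies scale linearly in the kernel, so division by B reduces to kernels bounded by 1. -/
theorem measureReal_groundState_sub_gt_lt {k q r : ℕ} (hr : 1 ≤ r) (hq : 1 ≤ q)
    {a : Fin q → ℝ} (ha : a ∈ stdSimplex ℝ (Fin q))
    {f : (Fin r → Fin q) → Cube r → ℝ} {d : (Fin r → Fin q) → ℝ} {B : ℝ} (hB : 0 ≤ B)
    (hf : ∀ z, Measurable (f z)) (hfB : ∀ z x, |f z x| ≤ B) (hdB : ∀ z, |d z| ≤ B)
    {ε : ℝ} (hε : 0 < ε) (hk : sampleSize r q ε ≤ k) :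
    (volume : Measure (Sample k r)).real
      {U | ε * B < |sSup (cubeEnergy f '' Omega a)
        - sSup (sampleEnergy f d U '' (balanced k a : Set (Fin k → Fin q)))|} < ε := by
  have hε' : 0 < min ε (1 / 4) := lt_min hε (by norm_num)
  obtain ⟨m, δ, hk0, hm, hδ, hδ1, hδε, c1, c2, c3, c4, hlt⟩ :=
    parameters_spec hr hq hε' (min_le_right _ _) (Nat.ceil_le.1 hk)
  have hdiv : ∀ y, |y| ≤ B → |y / B| ≤ 1 := fun y hy => by
    rw [abs_div, abs_of_nonneg hB]
    exact div_le_one_of_le₀ hy hB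
  -- For B = 0 the division returns 0, which is correct because y itself vanishes.
  have hmul : ∀ y, |y| ≤ B → B * (y / B) = y := fun y hy => by
    rcases hB.eq_or_lt with h | h
    · rw [← h] at hy
      simp [abs_nonpos_iff.1 hy]
    · field_simp
  have key := measureReal_groundState_sub_gt_le (f := fun z x => f z x / B)
    (d := fun z => d z / B) hr hq hk0 hm ha (fun z => (hf z).div_const B)
    (fun z x => hdiv _ (hfB z x)) (fun z => hdiv _ (hdB z)) hδ hδ1 c1 c2 c3 c4
  rw [hδε] at key
  have h1 : cubeEnergy f = fun φ => B * cubeEnergy (fun z x => f z x / B) φ := by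
    funext φ
    simp only [cubeEnergy, Finset.mul_sum, ← integral_const_mul, ← mul_assoc, hmul _ (hfB _ _)]
  have h2 : ∀ U : Sample k r, sampleEnergy f d U
      = fun χ => B * sampleEnergy (fun z x => f z x / B) (fun z => d z / B) U χ := fun U => by
    funext χ
    simp only [sampleEnergy, ← mul_div_assoc, Finset.mul_sum, mul_ite]
    simp only [mul_div_assoc, hmul _ (hfB _ _), hmul _ (hdB _)]
  refine (measureReal_mono (fun U hU => ?_) (measure_ne_top _ _)).trans_lt
    ((key.trans_lt hlt).trans_le (min_le_left _ _))
  rw [Set.mem_ofPred_eq, h1, h2, sSup_image_const_mul hB, sSup_image_const_mul hB, ← mul_sub,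
    abs_mul, abs_of_nonneg hB, mul_comm ε] at hU
  exact (min_le_left _ _).trans_lt (lt_of_mul_lt_mul_left hU hB)

/-! ### Layered energies -/

/-- The integer partition given by a colouring. -/
def partitionOf {k q : ℕ} (χ : Fin k → Fin q) (u : Fin k) (i : Fin q) : ℝ :=
  if χ u = i then 1 else 0

theorem sum_partitionOf {k q : ℕ} (χ : Fin k → Fin q) (i : Fin q) :
    ∑ u, partitionOf χ u i = classSize χ i := by
  simp [partitionOf, classSize]

/-- A 0/1 row with sum one has a single entry equal to one, whose position is the colour of the
vertex. -/
theorem omegaHat_eq (k : ℕ) {q : ℕ} (a : Fin q → ℝ) :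
    omegaHat k a = partitionOf '' (balanced k a : Set (Fin k → Fin q)) := by
  ext x
  constructor
  · rintro ⟨hx, hxa⟩
    have h1 : ∀ u, ∃ i, x u i = 1 := fun u => by
      by_contra! h
      have := hx.sum_eq_one u
      rw [Finset.sum_eq_zero fun i _ => (hx.zero_or_one u i).resolve_right (h i)] at this
      exact zero_ne_one this
    choose χ hχ using h1
    have h2 : partitionOf χ = x := by
      funext u i
      rw [partitionOf]
      split_ifs with h
      · rw [← h, hχ]
      · refine ((hx.zero_or_one u i).resolve_right fun h1 => ?_).symm
        have h3 := Finset.sum_le_sum_of_subset_of_nonneg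
          (f := x u) (Finset.subset_univ {χ u, i}) fun j _ _ => by
            rcases hx.zero_or_one u j with h | h <;> simp [h]
        rw [Finset.sum_pair h, hχ, h1, hx.sum_eq_one] at h3
        norm_num at h3
    refine ⟨χ, ?_, h2⟩
    simp only [balanced, Finset.coe_filter, Finset.mem_univ, true_and, Set.mem_ofPred_eq]
    intro i
    rw [← sum_partitionOf, h2]
    exact hxa i
  · rintro ⟨χ, hχ, rfl⟩
    simp only [balanced, Finset.coe_filter, Finset.mem_univ, true_and, Set.mem_ofPred_eq] at hχ
    refine ⟨⟨fun u i => ?_, fun u => by simp [partitionOf]⟩, fun i => ?_⟩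
    · rw [partitionOf]
      split_ifs <;> simp
    · rw [sum_partitionOf]
      exact hχ i

theorem sum_mul_prod_partitionOf {k q r : ℕ} (χ : Fin k → Fin q) (n : Fin r → Fin k)
    (g : (Fin r → Fin q) → ℝ) :
    ∑ z, g z * ∏ j, partitionOf χ (n j) (z j) = g fun j => χ (n j) := by
  rw [Finset.sum_eq_single fun j => χ (n j)]
  · simp [partitionOf]
  · intro z _ hz
    obtain ⟨j, hj⟩ := Function.ne_iff.1 hz
    rw [Finset.prod_eq_zero (Finset.mem_univ j), mul_zero]
    simp [partitionOf, hj.symm]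
  · simp

theorem graphEnergy_partitionOf {E K : Type*} [Fintype E] [TopologicalSpace K] {r q k : ℕ}
    (G : E → (Fin r → Fin k) → K) (J : Interaction E K r q) (χ : Fin k → Fin q) :
    graphEnergy G J (partitionOf χ)
      = (∑ n : Fin r → Fin k, ∑ e, J e (fun j => χ (n j)) (G e n)) / (k : ℝ) ^ r := by
  rw [graphEnergy, ← Finset.mul_sum, one_div, mul_comm, ← div_eq_mul_inv]
  congr 1
  refine (Finset.sum_congr rfl fun e _ => ?_).trans Finset.sum_comm
  rw [Finset.sum_comm]
  exact Finset.sum_congr rfl fun n _ => sum_mul_prod_partitionOf χ n fun z => J e z (G e n)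

/-- All layers are evaluated at the same edge points, so summing over them gives a single kernel,
with the common diagonal colour providing the values on degenerate edges. -/
theorem microEnergyHat_sampleGraph {E K : Type*} [Fintype E] [TopologicalSpace K]
    [MeasurableSpace K] {r q k : ℕ} (a : Fin q → ℝ) (ι : K) (W : E → Graphon K r)
    (U : Sample k r) (J : Interaction E K r q) :
    microEnergyHat a (sampleGraph ι W U) J
      = sSup (sampleEnergy (fun z x => ∑ e, J e z (W e x)) (fun z => ∑ e, J e z ι) U ''
        (balanced k a : Set (Fin k → Fin q))) := by
  rw [microEnergyHat, omegaHat_eq, Set.image_image]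
  congr 1
  refine Set.image_congr fun χ _ => ?_
  rw [graphEnergy_partitionOf, sampleEnergy]
  congr 1
  refine Finset.sum_congr rfl fun n _ => ?_
  simp only [sampleGraph]
  split_ifs <;> rfl

theorem abs_mul_prod_le {q r : ℕ} {φ : Fin q → unitInterval → ℝ} (hφ : IsFracPartition φ)
    (z : Fin r → Fin q) (x : Cube r) {y B : ℝ} (hy : |y| ≤ B) :
    |y * ∏ j, φ (z j) (x.vertex j)| ≤ B := by
  rw [abs_mul, Finset.abs_prod]
  refine (mul_le_of_le_one_right (abs_nonneg y) (Finset.prod_le_one (fun j _ => abs_nonneg _)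
    fun j _ => ?_)).trans hy
  rw [abs_of_nonneg (hφ.mem_Icc _ _).1]
  exact (hφ.mem_Icc _ _).2

theorem microEnergy_eq {E K : Type*} [Fintype E] [TopologicalSpace K] [CompactSpace K]
    [MeasurableSpace K] [BorelSpace K] {r q : ℕ} (a : Fin q → ℝ) (W : E → Graphon K r)
    (J : Interaction E K r q) :
    microEnergy a W J = sSup (cubeEnergy (fun z x => ∑ e, J e z (W e x)) '' Omega a) := by
  rw [microEnergy]
  congr 1
  refine Set.image_congr fun φ hφ => ?_
  rw [graphonEnergy, cubeEnergy, Finset.sum_comm]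
  refine Finset.sum_congr rfl fun z _ => ?_
  simp only [Finset.sum_mul]
  refine (integral_finsetSum _ fun e _ => ?_).symm
  refine integrable_of_abs_le (B := ‖J e z‖) ?_ fun x => abs_mul_prod_le hφ.1 z x
    ((J e z).norm_coe_le_norm _)
  exact ((J e z).continuous.measurable.comp (W e).measurable_toFun).mul
    (Finset.measurable_prod _ fun j _ => (hφ.1.measurable _).comp (measurable_pi_apply _))

theorem abs_interaction_le {E K : Type*} [Fintype E] [TopologicalSpace K] [CompactSpace K]
    {r q : ℕ} (J : Interaction E K r q) (e : E) (z : Fin r → Fin q) (c : K) :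
    |J e z c| ≤ ‖J‖ :=
  ((J e z).norm_coe_le_norm c).trans ((norm_le_pi_norm (J e) z).trans (norm_le_pi_norm J e))

theorem abs_sum_le_card_mul {E : Type*} [Fintype E] {y : E → ℝ} {B : ℝ} (hy : ∀ e, |y e| ≤ B) :
    |∑ e, y e| ≤ Fintype.card E * B := by
  refine (Finset.abs_sum_le_sum_abs _ _).trans ((Finset.sum_le_sum fun e _ => hy e).trans ?_)
  simp

theorem measureReal_microEnergy_sub_gt_lt {E K : Type*} [Fintype E] [TopologicalSpace K]
    [CompactSpace K] [MeasurableSpace K] [BorelSpace K] {k q r : ℕ} (hr : 1 ≤ r) (hq : 1 ≤ q)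
    {a : Fin q → ℝ} (ha : a ∈ stdSimplex ℝ (Fin q)) {ε : ℝ} (hε : 0 < ε)
    (hk : sampleSize r q ε ≤ k) (ι : K) (J : Interaction E K r q) (W : E → Graphon K r) :
    (volume : Measure (Sample k r)).real
      {U | ε * Fintype.card E * ‖J‖ <
        |microEnergy a W J - microEnergyHat a (sampleGraph ι W U) J|} < ε := by
  simp only [microEnergy_eq, microEnergyHat_sampleGraph, mul_assoc]
  exact measureReal_groundState_sub_gt_lt hr hq ha (by positivity)
    (fun z => Finset.measurable_sum _ fun e _ =>
      (J e z).continuous.measurable.comp (W e).measurable_toFun)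
    (fun z x => abs_sum_le_card_mul fun e => abs_interaction_le J e z _)
    (fun z => abs_sum_le_card_mul fun e => abs_interaction_le J e z _) hε hk

/-! ### Real colours -/

section
variable {E : Type*} {d : ℝ} {r : ℕ} (W : E → Graphon (Set.Icc (-d) d) r)

theorem layeredSupNorm_nonneg : 0 ≤ layeredSupNorm W :=
  Real.iSup_nonneg fun _ => ENNReal.toReal_nonneg

theorem ae_abs_le_layeredSupNorm [Finite E] (e : E) :
    ∀ᵐ x, |(W e x : ℝ)| ≤ layeredSupNorm W := by
  have hfin : eLpNorm (fun x => (W e x : ℝ)) ⊤ volume ≠ ⊤ := by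
    refine (eLpNorm_exponent_top (f := fun x => (W e x : ℝ)) (μ := volume) ▸
      (eLpNormEssSup_lt_top_of_ae_bound (C := d) (ae_of_all _ fun x => ?_))).ne
    exact abs_le.2 (W e x).2
  have h1 := ae_le_eLpNormEssSup (f := fun x => (W e x : ℝ)) (μ := volume)
  filter_upwards [h1] with x hx
  rw [← eLpNorm_exponent_top] at hx
  have h2 := ENNReal.toReal_mono hfin hx
  rw [toReal_enorm] at h2
  exact h2.trans (le_ciSup (f := fun e => (eLpNorm (fun x => (W e x : ℝ)) ⊤ volume).toReal)
    (Set.finite_range _).bddAbove e)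

end

/-- The general bound would involve d instead of the essential supremum. Clipping the graphons at
±‖W‖_∞ gives kernels with the sharper bound everywhere, and it changes the energies only on a null
set of samples. The diagonal colour 0 contributes 0 and so respects the bound. -/
theorem measureReal_microEnergy_linear_sub_gt_lt {E : Type*} [Fintype E] {k q r : ℕ}
    (hr : 1 ≤ r) (hq : 1 ≤ q) {a : Fin q → ℝ} (ha : a ∈ stdSimplex ℝ (Fin q)) {ε : ℝ}
    (hε : 0 < ε) (hk : sampleSize r q ε ≤ k) {d : ℝ} (hd : 0 ≤ d)
    (A : E → (Fin r → Fin q) → ℝ) (W : E → Graphon (Set.Icc (-d) d) r) :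
    (volume : Measure (Sample k r)).real
      {U | ε * Fintype.card E * ‖A‖ * layeredSupNorm W <
        |microEnergy a W (linearInteraction d A) -
          microEnergyHat a (sampleGraph ⟨0, neg_nonpos.mpr hd, hd⟩ W U)
            (linearInteraction d A)|} < ε := by
  set w := layeredSupNorm W
  have hw : 0 ≤ w := layeredSupNorm_nonneg W
  set f : (Fin r → Fin q) → Cube r → ℝ :=
    fun z x => ∑ e, A e z * max (-w) (min w (W e x)) with hf
  have hclip : ∀ t : ℝ, |t| ≤ w → max (-w) (min w t) = t := fun t ht => by
    rw [min_eq_right (abs_le.1 ht).2, max_eq_right (abs_le.1 ht).1]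
  have hclip' : ∀ t : ℝ, |max (-w) (min w t)| ≤ w := fun t =>
    abs_le.2 ⟨le_max_left _ _, max_le (by linarith) (min_le_left _ _)⟩
  have hfm : ∀ z, Measurable (f z) := fun z =>
    Finset.measurable_sum _ fun e _ => measurable_const.mul (measurable_const.max
      (measurable_const.min (measurable_subtype_coe.comp (W e).measurable_toFun)))
  have hfB : ∀ z x, |f z x| ≤ Fintype.card E * (‖A‖ * w) := fun z x =>
    abs_sum_le_card_mul fun e => by
      rw [abs_mul]
      exact mul_le_mul ((norm_le_pi_norm (A e) z).trans (norm_le_pi_norm A e)) (hclip' _)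
        (abs_nonneg _) (norm_nonneg _)
  have hae : ∀ᵐ x : Cube r, ∀ z, ∑ e, linearInteraction d A e z (W e x) = f z x := by
    filter_upwards [ae_all_iff.2 fun e => ae_abs_le_layeredSupNorm W e] with x hx z
    exact Finset.sum_congr rfl fun e _ => by rw [hclip _ (hx e)]; rfl
  have hE : microEnergy a W (linearInteraction d A) = sSup (cubeEnergy f '' Omega a) := by
    rw [microEnergy_eq]
    congr 1
    refine Set.image_congr fun φ _ => Finset.sum_congr rfl fun z _ => integral_congr_ae ?_
    filter_upwards [hae] with x hx
    rw [hx z]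
  -- Each injective edge evaluates the graphons at a uniform point of the cube, and there are
  -- finitely many edges, so almost surely no sampled edge is affected by clipping.
  have hS : ∀ᵐ U : Sample k r, ∀ n : Fin r → Fin k, Function.Injective n →
      ∀ z, ∑ e, linearInteraction d A e z (W e (U.edgePoint n)) = f z (U.edgePoint n) :=
    ae_all_iff.2 fun n => by
      by_cases hn : Function.Injective n
      · filter_upwards [(measurePreserving_edgePoint hn).quasiMeasurePreserving.ae hae]
          with U hU _ using hU
      · exact ae_of_all _ fun U h => absurd h hn
  refine lt_of_le_of_lt ?_ (measureReal_groundState_sub_gt_lt hr hq ha (by positivity) hfm hfB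
    (d := fun _ => 0) (fun z => by rw [abs_zero]; positivity) hε hk)
  refine ENNReal.toReal_mono (measure_ne_top _ _) (measure_mono_ae ?_)
  filter_upwards [hS] with U hU hlt
  have hH : microEnergyHat a (sampleGraph ⟨0, neg_nonpos.mpr hd, hd⟩ W U) (linearInteraction d A)
      = sSup (sampleEnergy f (fun _ => 0) U '' (balanced k a : Set (Fin k → Fin q))) := by
    rw [microEnergyHat_sampleGraph]
    congr 1
    refine Set.image_congr fun χ _ => ?_
    rw [sampleEnergy, sampleEnergy]
    congr 1
    refine Finset.sum_congr rfl fun n _ => ?_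
    split_ifs with hn
    · exact hU n hn _
    · simp [linearInteraction]
  change ε * Fintype.card E * ‖A‖ * w < _ at hlt
  change ε * (Fintype.card E * (‖A‖ * w)) < _
  rw [hE, hH] at hlt
  calc ε * (Fintype.card E * (‖A‖ * w)) = ε * Fintype.card E * ‖A‖ * w := by ring
    _ < _ := hlt

end GroundState

theorem corollary5p4 (r q : ℕ) (hr : 1 ≤ r) (hq : 1 ≤ q) :
    ∃ k₀ : ℝ → ℕ,
      (fun ε : ℝ => (k₀ ε : ℝ)) =O[𝓝[>] (0 : ℝ)]
        (fun ε : ℝ => (ε ^ 4)⁻¹ * Real.log ε⁻¹) ∧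
      ∀ (E : Type*) [Fintype E] (a : Fin q → ℝ), a ∈ stdSimplex ℝ (Fin q) →
        ∀ (ε : ℝ), 0 < ε → ∀ (k : ℕ), k₀ ε ≤ k →
          -- arbitrary compact Polish colour space
          (∀ (K : Type*) [TopologicalSpace K] [CompactSpace K] [PolishSpace K]
            [MeasurableSpace K] [BorelSpace K] (ι : K)
            (J : GroundState.Interaction E K r q) (W : E → GroundState.Graphon K r),
            (volume : Measure (GroundState.Sample k r)).real
              {U | ε * Fintype.card E * ‖J‖ <
                |GroundState.microEnergy a W J -
                  GroundState.microEnergyHat a (GroundState.sampleGraph ι W U) J|} < ε) ∧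
          -- bounded real colours, real interaction arrays acting by multiplication
          (∀ (d : ℝ) (hd : 0 ≤ d) (A : E → (Fin r → Fin q) → ℝ)
            (W : E → GroundState.Graphon (Set.Icc (-d) d) r),
            (volume : Measure (GroundState.Sample k r)).real
              {U | ε * Fintype.card E * ‖A‖ * GroundState.layeredSupNorm W <
                |GroundState.microEnergy a W (GroundState.linearInteraction d A) -
                  GroundState.microEnergyHat a
                    (GroundState.sampleGraph ⟨0, neg_nonpos.mpr hd, hd⟩ W U)
                    (GroundState.linearInteraction d A)|} < ε) :=
  ⟨GroundState.sampleSize r q, GroundState.isBigO_sampleSize r q, fun _ _ _ ha _ hε _ hk =>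
    ⟨fun _ _ _ _ _ _ ι J W =>
      GroundState.measureReal_microEnergy_sub_gt_lt hr hq ha hε hk ι J W,
    fun _ hd A W => GroundState.measureReal_microEnergy_linear_sub_gt_lt hr hq ha hε hk hd A W⟩⟩
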